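/- Let $D$ be a finite directed graph (at most one edge for each ordered pair of vertices; antiparallel edges and loops are allowed), given with a nice path decomposition, that is, a path decomposition whose first and last bags are empty and in which each bag arises from the previous one by introducing or forgetting one vertex. A 2-dimensional simplicial complex $Y_D$ is built along the decomposition as follows. *Building blocks.* All cylinders are triangulated prisms between circles with three vertices. Let $S_4$ be the union of three cylinders $X_1,X_2,X_3$ that have one boundary circle in common, where in addition one interior vertex of $X_1$ is identified with one interior vertex of $X_2$ (a 0-dimensional singularity), and which are otherwise disjoint. The gadget of a vertex $v$ has two parts $\mathcal A^v$ (for edges ending at $v$) and $\mathcal B^v$ (for edges starting at $v$), each with a distinguished free boundary circle $\overline{\mathcal A^v}$, $\overline{\mathcal B^v}$. *Construction.* The leaf gives the empty complex. When $w$ is introduced, $\mathcal A^w$ and $\mathcal B^w$ are started as two disjoint cylinders, and for each other vertex $x$ of the bag $\mathcal A^x$ and $\mathcal B^x$ are extended by a cylinder at their distinguished circles. When $w$ is forgotten, for each edge $uv$ between $w$ and a vertex of the bag (including $w$ itself) a copy of $S_4$ is attached to $\mathcal B^u$ and one to $\mathcal A^v$: the free boundary of $X_2$ is glued to the old distinguished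 circle, the free boundary of $X_3$ is the new distinguished circle, and the free boundaries of the two copies of $X_1$ are joined by a cylinder $Y^{uv}$; finally $\mathcal A^w$ and $\mathcal B^w$ are extended by a cylinder each and joined, so that $\overline{\mathcal A^w}=\overline{\mathcal B^w}$. All identifications of circles respect their parametrizations. $Y_D$ is the complex obtained at the root. *Terminology.* A combinatorial surface is a finite complex (possibly empty or disconnected) that is pure of dimension 2 and in which the link of each vertex is a simple path or a simple cycle; it is closed if its boundary is empty. Subcomplexes are disjoint if they have no simplex in common. For a simplicial complex $K$ and a subcomplex $B$, the problem SR$(K,B,X)$ asks whether $K$ contains a combinatorial surface with boundary $B$ homeomorphic to the surface $X$; SoG$(K,B,g,c)$ asks whether $K$ contains a combinatorial surface with boundary $B$, total genus $g$ and $c$ connected components; SP$(K,B,c)$ asks the latter without the condition on the genus. The total genus is the sum of the genera of the components, where orientable components count twice if some component is non-orientable. **Lemma.** There are absolute constants $c,C,d$ such that the following hold for all $D$ and all nice path decompositions of $D$. 1. For every integer $\ell\ge 0$ the following are equivalent: (a) $D$ contains $\ell$ pairwise vertex-disjoint directed simple cycles; (b) $Y_D$ contains $\ell$ pairwise disjoint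 nonempty closed combinatorial surfaces; (c) $Y_D$ contains $\ell$ pairwise disjoint closed combinatorial surfaces that are tori; (d) SP$(Y_D,\emptyset,\ell)$ has a positive answer; (e) SoG$(Y_D,\emptyset,\ell,\ell)$ has a positive answer; (f) SR$(Y_D,\emptyset,X_\ell)$ has a positive answer, where $X_\ell$ is the disjoint union of $\ell$ tori. 2. Every connected nonempty closed combinatorial surface contained in $Y_D$ is homeomorphic to the torus $S^1\times S^1$. 3. The construction also yields a path decomposition of the Hasse diagram of $Y_D$: each step of the nice path decomposition contributes the bag consisting of all simplices added in this step together with the last cylinders of $\mathcal A^x$ and $\mathcal B^x$ for all $x$ in the old bag, followed by the bag consisting of the last cylinders of $\mathcal A^x$ and $\mathcal B^x$ for all $x$ in the new bag. If the given nice path decomposition of $D$ has width $k$, then this path decomposition has width at most $c(k+1)-1$, where the width is the size of a largest bag minus one. 4. The triangles of $Y_D$ and (generators of) the bags of this path decomposition are computed in at most $C(n+1)^d$ elementary steps, where $n$ is the number of vertices of $D$. Hence $(D,\ell)\mapsto (Y_D,\ell)$, $(Y_D,\ell,\ell)$, $(Y_D,X_\ell)$ are polynomial-time reductions from Directed Cycle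 Packing to SP, SoG and SR that increase the width of the given path decomposition at most linearly. -/

import Mathlib

universe u v

namespace CyclesToTori

/-! ## Directed graphs and path decompositions -/

/-- A directed simple cycle: vertices `vert 0, …, vert len`, all distinct, with an edge from each
vertex to the next one and from the last one to the first (addition in `Fin` wraps around). -/
structure DirectedCycle {V : Type u} (D : Digraph V) where
  len : ℕ
  vert : Fin (len + 1) → V
  injective : Function.Injective vert
  adj : ∀ i, D.Adj (vert i) (vert (i + 1))

/-- `D` contains `l` pairwise vertex-disjoint directed cycles. -/
def HasDisjointCycles {V : Type u} (D : Digraph V) (l : ℕ) : Prop :=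
  ∃ C : Fin l → DirectedCycle D,
    Pairwise fun i j => Disjoint (Set.range (C i).vert) (Set.range (C j).vert)

/-- The sequence `bags` of bags is a path decomposition of the graph with vertex set `W` whose edges
are the pairs related by `E` (directions of edges play no role). -/
structure IsPathDecomposition {α : Type u} (W : Set α) (E : α → α → Prop)
    (bags : List (Finset α)) : Prop where
  ne_nil : bags ≠ []
  vertices : ∀ a, a ∈ W ↔ ∃ B ∈ bags, a ∈ B
  edges : ∀ a b, E a b → ∃ B ∈ bags, a ∈ B ∧ b ∈ B
  connected : ∀ a i j k, i ≤ j → j ≤ k →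
    a ∈ bags.getD i ∅ → a ∈ bags.getD k ∅ → a ∈ bags.getD j ∅

/-- The size of a largest bag: the width of the decomposition plus one. -/
def maxBag {α : Type u} (bags : List (Finset α)) : ℕ :=
  (bags.map Finset.card).foldr max 0

/-- The step from one node of a nice path decomposition to the next one (from the leaf to the
root). -/
inductive Move (V : Type u) where
  | introduce (w : V)
  | forget (w : V)

/-- The bag after a move. -/
def Move.apply {V : Type u} [DecidableEq V] : Move V → List V → List V
  | .introduce w, bag => w :: bag
  | .forget w, bag => bag.erase w

/-- All bags of the sequence of moves that starts at `bag`. -/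
def bagsFrom {V : Type u} [DecidableEq V] : List V → List (Move V) → List (List V)
  | bag, [] => [bag]
  | bag, m :: ms => bag :: bagsFrom (m.apply bag) ms

/-- Only new vertices are introduced, only vertices of the bag are forgotten, and the last bag (that
of the root) is empty. -/
def Legal {V : Type u} [DecidableEq V] : List V → List (Move V) → Prop
  | bag, [] => bag = []
  | bag, .introduce w :: ms => w ∉ bag ∧ Legal (w :: bag) ms
  | bag, .forget w :: ms => w ∈ bag ∧ Legal (bag.erase w) ms

/-- A nice path decomposition of `D`: the bag of the leaf is empty, each further node introduces or
forgets one vertex, and the bag of the root is empty. -/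
structure NicePathDecomposition {V : Type u} [DecidableEq V] (D : Digraph V) where
  moves : List (Move V)
  legal : Legal [] moves
  isPathDecomposition :
    IsPathDecomposition Set.univ D.Adj ((bagsFrom [] moves).map List.toFinset)

/-- The bags, from the leaf to the root. -/
def NicePathDecomposition.bags {V : Type u} [DecidableEq V] {D : Digraph V}
    (P : NicePathDecomposition D) : List (Finset V) :=
  (bagsFrom [] P.moves).map List.toFinset

/-! ## Simplicial complexes and combinatorial surfaces

A simplicial complex is a `PreAbstractSimplicialComplex`: a downward closed set of nonempty finite
sets. -/

section Complexes

variable {P : Type u}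

/-- The faces generated by a list of simplices. -/
def closure [DecidableEq P] (L : List (Finset P)) : Finset (Finset P) :=
  L.toFinset.biUnion fun t => t.powerset.erase ∅

/-- The simplicial complex generated by a list of simplices. -/
def generated [DecidableEq P] (L : List (Finset P)) : PreAbstractSimplicialComplex P where
  faces := {s | s ∈ closure L}
  isRelLowerSet_faces := by
    intro s hs
    simp only [closure, Set.mem_ofPred_eq, Finset.mem_biUnion, Finset.mem_erase,
      Finset.mem_powerset] at hs ⊢
    obtain ⟨t, ht, hne, hst⟩ := hs
    exact ⟨Finset.nonempty_iff_ne_empty.mpr hne,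
      fun r hr hr' => ⟨t, ht, hr'.ne_empty, hr.trans hst⟩⟩

/-- Adjacency in the Hasse diagram of `K`, whose vertices are the simplices of `K`. -/
def HasseAdj (K : PreAbstractSimplicialComplex P) (s t : Finset P) : Prop :=
  s ∈ K ∧ t ∈ K ∧ s ⊆ t ∧ t.card = s.card + 1

/-- The geometric realization of a (finite) complex, in barycentric coordinates. -/
def realization (K : PreAbstractSimplicialComplex P) : Set (P → ℝ) :=
  {x | (∀ p, 0 ≤ x p) ∧ ∃ s ∈ K, (∀ p, p ∉ s → x p = 0) ∧ ∑ p ∈ s, x p = 1}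

/-- The simplices of the link of the vertex `p`. -/
def vertexLink (K : PreAbstractSimplicialComplex P) (p : P) : Set (Finset P) :=
  {t | t ∈ K ∧ p ∉ t ∧ ∃ s ∈ K, p ∈ s ∧ t ⊆ s}

/-- A simple path with `m + 1 ≥ 1` edges. -/
def IsSimplePath [DecidableEq P] (L : Set (Finset P)) : Prop :=
  ∃ (m : ℕ) (f : Fin (m + 2) → P), Function.Injective f ∧
    L = {t | (∃ i, t = {f i}) ∨ ∃ i : Fin (m + 1), t = {f i.castSucc, f i.succ}}

/-- A simple cycle with `m + 3 ≥ 3` edges. -/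
def IsSimpleCycle [DecidableEq P] (L : Set (Finset P)) : Prop :=
  ∃ (m : ℕ) (f : Fin (m + 3) → P), Function.Injective f ∧
    L = {t | (∃ i, t = {f i}) ∨ ∃ i, t = {f i, f (i + 1)}}

/-- A combinatorial surface with (possibly empty) boundary: a finite pure 2-dimensional complex in
which the link of each vertex is a simple path or a simple cycle. It may be disconnected, and the
empty complex counts as the surface without connected components. -/
structure IsSurface [DecidableEq P] (S : PreAbstractSimplicialComplex P) : Prop where
  finite : S.faces.Finite
  dim_le : ∀ s ∈ S, s.card ≤ 3
  pure : ∀ s ∈ S, ∃ t ∈ S, s ⊆ t ∧ t.card = 3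
  link : ∀ p, {p} ∈ S → IsSimplePath (vertexLink S p) ∨ IsSimpleCycle (vertexLink S p)

/-- The boundary of a 2-dimensional complex: the closure of the set of edges with exactly one proper
coface. -/
def boundary (K : PreAbstractSimplicialComplex P) : PreAbstractSimplicialComplex P where
  faces := {s | s.Nonempty ∧ ∃ e ∈ K, s ⊆ e ∧ e.card = 2 ∧ {t | t ∈ K ∧ e ⊂ t}.ncard = 1}
  isRelLowerSet_faces := by
    rintro s ⟨hs, e, he, hse, h⟩
    exact ⟨hs, fun r hr hr' => ⟨hr', e, he, hr.trans hse, h⟩⟩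

/-- A nonempty 2-manifold without boundary. -/
structure IsClosedSurface [DecidableEq P] (S : PreAbstractSimplicialComplex P) : Prop where
  isSurface : IsSurface S
  boundary_eq : boundary S = ⊥
  ne_bot : S ≠ ⊥

/-- The graph of vertices and edges of `K`. -/
def skeleton [DecidableEq P] (K : PreAbstractSimplicialComplex P) :
    SimpleGraph {p : P // {p} ∈ K} where
  Adj p q := p ≠ q ∧ {p.1, q.1} ∈ K
  symm := ⟨fun p q h => ⟨h.1.symm, by rw [Finset.pair_comm]; exact h.2⟩⟩
  loopless := ⟨fun _ h => h.1 rfl⟩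

/-- `K` is nonempty and connected. -/
def IsConnected [DecidableEq P] (K : PreAbstractSimplicialComplex P) : Prop :=
  (skeleton K).Connected

/-- The number of connected components of `K`. -/
noncomputable def numComponents [DecidableEq P] (K : PreAbstractSimplicialComplex P) : ℕ :=
  Nat.card (skeleton K).ConnectedComponent

/-- A connected component, as a subcomplex. -/
def component [DecidableEq P] (K : PreAbstractSimplicialComplex P)
    (c : (skeleton K).ConnectedComponent) : PreAbstractSimplicialComplex P where
  faces := {s | s ∈ K ∧ ∀ p ∈ s, ∃ h : {p} ∈ K, (skeleton K).connectedComponentMk ⟨p, h⟩ = c}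
  isRelLowerSet_faces := by
    rintro s ⟨hs, h⟩
    exact ⟨(K.isRelLowerSet_faces hs).1,
      fun r hr hr' => ⟨(K.isRelLowerSet_faces hs).2 hr hr', fun p hp => h p (hr hp)⟩⟩

/-- The Euler characteristic of a finite complex of dimension at most two. -/
noncomputable def eulerChar (K : PreAbstractSimplicialComplex P) : ℤ :=
  ({s | s ∈ K ∧ s.card = 1}.ncard : ℤ) - {s | s ∈ K ∧ s.card = 2}.ncard
    + {s | s ∈ K ∧ s.card = 3}.ncard

/-- A surface is orientable if its triangles can be given cyclic orders (`O a b c`: the triangle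
`abc` is oriented as `a → b → c → a`) so that two triangles with a common edge induce opposite
directions on that edge. -/
def Orientable [DecidableEq P] (S : PreAbstractSimplicialComplex P) : Prop :=
  ∃ O : P → P → P → Prop,
    (∀ a b c, O a b c → O b c a) ∧
    (∀ a b c, ({a, b, c} : Finset P) ∈ S → ({a, b, c} : Finset P).card = 3 →
      (O a b c ↔ ¬ O b a c)) ∧
    (∀ a b c d, ({a, b, c} : Finset P) ∈ S → ({a, b, c} : Finset P).card = 3 →
      ({a, b, d} : Finset P) ∈ S → ({a, b, d} : Finset P).card = 3 → c ≠ d →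
      O a b c → O b a d)

open Classical in
/-- The genus `g` of a connected surface `S` with `b` boundary components: the Euler characteristic is
`2 - 2g - b` if `S` is orientable (`g` handles), and `2 - g - b` if it is not (`g` is the number of
crosscaps plus twice the number of handles). -/
noncomputable def genus [DecidableEq P] (S : PreAbstractSimplicialComplex P) : ℤ :=
  if Orientable S then (2 - eulerChar S - numComponents (boundary S)) / 2
  else 2 - eulerChar S - numComponents (boundary S)

open Classical in
/-- The total genus of a surface: the sum of the genera of its components, where orientable
components count twice if some component is not orientable. -/
noncomputable def totalGenus [DecidableEq P] (S : PreAbstractSimplicialComplex P) : ℤ :=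
  ∑ᶠ c : (skeleton S).ConnectedComponent,
    if Orientable (component S c) ∧ ∃ d, ¬ Orientable (component S d)
    then 2 * genus (component S c) else genus (component S c)

/-- Subsurface Recognition: does `K` contain a subcomplex homeomorphic to the surface `X` and with
boundary `B`? -/
def SubsurfaceRecognition [DecidableEq P] (K B : PreAbstractSimplicialComplex P)
    (X : Type v) [TopologicalSpace X] : Prop :=
  ∃ S ≤ K, IsSurface S ∧ boundary S = B ∧ Nonempty (realization S ≃ₜ X)

/-- Sum-of-Genus Subsurface Recognition: does `K` contain a surface of total genus `g` with `c`
connected components and with boundary `B`? -/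
def SumOfGenusRecognition [DecidableEq P] (K B : PreAbstractSimplicialComplex P)
    (g : ℤ) (c : ℕ) : Prop :=
  ∃ S ≤ K, IsSurface S ∧ boundary S = B ∧ totalGenus S = g ∧ numComponents S = c

/-- Subsurface Packing: does `K` contain a surface with `c` connected components and boundary `B`? -/
def SubsurfacePacking [DecidableEq P] (K B : PreAbstractSimplicialComplex P) (c : ℕ) : Prop :=
  ∃ S ≤ K, IsSurface S ∧ boundary S = B ∧ numComponents S = c

/-- The torus. -/
abbrev Torus : Type := Circle × Circle

/-- `S` is homeomorphic to the torus. -/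
def IsTorus (S : PreAbstractSimplicialComplex P) : Prop :=
  Nonempty (realization S ≃ₜ Torus)

/-- `K` contains `l` pairwise disjoint subcomplexes with the property `Q`. -/
def HasDisjointSubcomplexes (K : PreAbstractSimplicialComplex P) (l : ℕ)
    (Q : PreAbstractSimplicialComplex P → Prop) : Prop :=
  ∃ T : Fin l → PreAbstractSimplicialComplex P,
    (∀ i, T i ≤ K ∧ Q (T i)) ∧ Pairwise fun i j => Disjoint (T i).faces (T j).faces

end Complexes

/-! ## Step counting

The construction is written as a program whose elementary operations (reading or writing an entry of
a table, testing an adjacency or an equality, writing a simplex, visiting an element of a list) cost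
one step each. -/

/-- A result together with the number of steps spent on it. -/
structure Timed (α : Type) where
  val : α
  steps : ℕ

namespace Timed

instance : Monad Timed where
  pure a := ⟨a, 1⟩
  bind x f := ⟨(f x.val).val, x.steps + (f x.val).steps⟩

/-- Read the entry of a table at `x`. -/
def look {V α : Type} (f : V → α) (x : V) : Timed α := ⟨f x, 1⟩

/-- Write the entry of a table at `x`. -/
def store {V α : Type} [DecidableEq V] (f : V → α) (x : V) (a : α) : Timed (V → α) :=
  ⟨Function.update f x a, 1⟩

/-- Test a proposition: an adjacency of the input graph or an equality of vertices. -/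
def test (p : Prop) [Decidable p] : Timed Bool := ⟨decide p, 1⟩

/-- Write down a list, element by element. -/
def draw {α : Type} (L : List α) : Timed (List α) := ⟨L, L.length + 1⟩

/-- Concatenate two lists by copying the first one. -/
def append {α : Type} (L M : List α) : Timed (List α) := ⟨L ++ M, L.length + 1⟩

/-- Remove an element from a list by searching through the list. -/
def remove {α : Type} [DecidableEq α] (L : List α) (a : α) : Timed (List α) :=
  ⟨L.erase a, L.length + 1⟩

end Timed

/-! ## The construction

The complex is glued from cylinders. Each cylinder joins two triangulated circles with three
vertices, called hoops here. The gadget of a vertex `v` consists of two parts: the part `𝒜` that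
receives the gadgets of the edges ending at `v`, and the part `ℬ` that emits the gadgets of the edges
starting at `v`. Both parts grow during the construction, and they are joined when `v` is
forgotten. -/

/-- The names of the hoops: the `k`-th hoop of the part `𝒜` of the gadget of `v`, the `k`-th hoop of
the part `ℬ`, the hoop at which the two parts are joined, and the hoops along an edge gadget. -/
inductive Hoop (V : Type) where
  | inc (v : V) (k : ℕ)
  | out (v : V) (k : ℕ)
  | mid (v : V)
  | edge (u v : V) (j : Fin 6)
  deriving DecidableEq

/-- The vertices of the complex: three points on each hoop. -/
abbrev Point (V : Type) := Hoop V × Fin 3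

section Construction

variable {V : Type}

/-- The three points of a hoop. -/
def ring (c : Hoop V) : Fin 3 → Point V := fun i => (c, i)

variable [DecidableEq V]

/-- The hoop `c` with its point `0` replaced by the point `0` of the hoop `d`, so that the two
circles touch in exactly this point: a 0-dimensional singularity. -/
def pinched (c d : Hoop V) : Fin 3 → Point V := Function.update (ring c) 0 (d, 0)

/-- The six triangles of a cylinder between the circles `f` and `g` (`S₁`). -/
def tube (f g : Fin 3 → Point V) : List (Finset (Point V)) :=
  [0, 1, 2].flatMap fun i => [{f i, f (i + 1), g (i + 1)}, {f i, g i, g (i + 1)}]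

/-- The cylinder that is glued from the cylinders between consecutive circles. -/
def tubes : List (Fin 3 → Point V) → List (Finset (Point V))
  | f :: g :: L => tube f g ++ tubes (g :: L)
  | _ => []

/-- The numbers of the current last hoops of the parts `𝒜` and `ℬ` of each vertex gadget: these
hoops are the boundary components at which the parts can be extended. -/
structure Tops (V : Type) where
  inc : V → ℕ
  out : V → ℕ

/-- Newly written triangles, and the updated numbers of the last hoops. -/
structure Patch (V : Type) where
  facets : List (Finset (Point V))
  tops : Tops V

/-- Extend both parts of the gadget of `x` by a cylinder. -/
def pad (x : V) (s : Tops V) : Timed (Patch V) := do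
  let k ← Timed.look s.inc x
  let h ← Timed.look s.out x
  let L ← Timed.draw
    (tubes [ring (.inc x k), ring (.inc x (k + 1))] ++
      tubes [ring (.out x (h + 1)), ring (.out x h)])
  let i ← Timed.store s.inc x (k + 1)
  let o ← Timed.store s.out x (h + 1)
  return ⟨L, ⟨i, o⟩⟩

/-- Extend both parts of the gadgets of all listed vertices by a cylinder. -/
def padAll : List V → Tops V → Timed (Patch V)
  | [], s => return ⟨[], s⟩
  | x :: xs, s => do
    let p ← pad x s
    let q ← padAll xs p.tops
    let L ← Timed.append p.facets q.facets
    return ⟨L, q.tops⟩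

/-- Attach the gadget of the edge `uv` to the last hoops of the part `ℬ` of `u` and of the part `𝒜`
of `v`.

Each end is attached through a copy of `S₄`, three cylinders that meet in a common circle. At `v` the
common circle is `inc v (k + 3)`. The cylinder `X₂` runs from the old last hoop `inc v k` to it, `X₃`
from it to the new last hoop `inc v (k + 4)`, and `X₁` from the edge gadget to it; the hoop in the
middle of `X₁` and the hoop `inc v (k + 1)` of `X₂` touch in one point. The situation at `u` is
symmetric. The cylinder between the hoops `edge u v 2` and `edge u v 3` joins the two copies. -/
def attach (u v : V) (s : Tops V) : Timed (Patch V) := do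
  let h ← Timed.look s.out u
  let k ← Timed.look s.inc v
  let L ← Timed.draw
    (tubes [ring (.out u (h + 4)), ring (.out u (h + 3)), ring (.out u (h + 2)),
        ring (.out u (h + 1)), ring (.out u h)] ++
      tubes [ring (.out u (h + 3)), ring (.edge u v 0),
        pinched (.edge u v 1) (.out u (h + 1)), ring (.edge u v 2), ring (.edge u v 3),
        pinched (.edge u v 4) (.inc v (k + 1)), ring (.edge u v 5), ring (.inc v (k + 3))] ++
      tubes [ring (.inc v k), ring (.inc v (k + 1)), ring (.inc v (k + 2)),
        ring (.inc v (k + 3)), ring (.inc v (k + 4))])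
  let o ← Timed.store s.out u (h + 4)
  let i ← Timed.store s.inc v (k + 4)
  return ⟨L, ⟨i, o⟩⟩

/-- Attach the gadget of `uv` if the test `b` was positive. -/
def attachIf (b : Bool) (u v : V) (s : Tops V) : Timed (Patch V) :=
  if b then attach u v s else pure ⟨[], s⟩

/-- Attach the gadgets of all edges between `w` and the listed vertices. -/
def attachAll (D : Digraph V) [DecidableRel D.Adj] (w : V) :
    List V → Tops V → Timed (Patch V)
  | [], s => return ⟨[], s⟩
  | x :: xs, s => do
    let a ← Timed.test (D.Adj x w)
    let p ← attachIf a x w s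
    let b ← Timed.test (D.Adj w x)
    let e ← Timed.test (x = w)
    let q ← attachIf (b && !e) w x p.tops
    let r ← attachAll D w xs q.tops
    let L ← Timed.append q.facets r.facets
    let M ← Timed.append p.facets L
    return ⟨M, r.tops⟩

/-- Join the two parts of the gadget of `w` along a common boundary circle. -/
def join (w : V) (s : Tops V) : Timed (List (Finset (Point V))) := do
  let k ← Timed.look s.inc w
  let h ← Timed.look s.out w
  Timed.draw (tubes [ring (.inc w k), ring (.mid w), ring (.out w h)])

/-- The bag after a move, the triangles that the move adds, and the last hoops after it. When a
vertex is introduced, two new disjoint cylinders are started for it, and the parts of the gadgets of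
all vertices of the bag are extended by a cylinder. When a vertex is forgotten, the gadgets of all
edges between it and the vertices of the bag are attached, and the two parts of its own gadget are
joined. -/
def stage (D : Digraph V) [DecidableRel D.Adj] (bag : List V) (s : Tops V) :
    Move V → Timed (List V × Patch V)
  | .introduce w => do
    let p ← padAll (w :: bag) s
    return (w :: bag, p)
  | .forget w => do
    let p ← attachAll D w bag s
    let L ← join w p.tops
    let M ← Timed.append L p.facets
    let bag' ← Timed.remove bag w
    return (bag', ⟨M, p.tops⟩)

/-- The last cylinders of both parts of the gadgets of the listed vertices. -/
def collars (s : Tops V) : List V → Timed (List (Finset (Point V)))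
  | [] => return []
  | x :: xs => do
    let k ← Timed.look s.inc x
    let h ← Timed.look s.out x
    let L ← Timed.draw
      (tubes [ring (.inc x (k - 1)), ring (.inc x k)] ++
        tubes [ring (.out x h), ring (.out x (h - 1))])
    let M ← collars s xs
    Timed.append L M

/-- The triangles of a complex, and the bags of a path decomposition of its Hasse diagram, each given
by simplices that generate it. -/
structure Output (V : Type) where
  facets : List (Finset (Point V))
  bags : List (List (Finset (Point V)))

/-- The induction along the path decomposition. `R` consists of the collars of the vertices in the
current bag. Each move contributes two bags: the old collars together with all new simplices, and
the new collars. -/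
def build (D : Digraph V) [DecidableRel D.Adj] (bag : List V) (s : Tops V)
    (R : List (Finset (Point V))) : List (Move V) → Timed (Output V)
  | [] => return ⟨[], []⟩
  | m :: ms => do
    let t ← stage D bag s m
    let R' ← collars t.2.tops t.1
    let B ← Timed.append R t.2.facets
    let o ← build D t.1 t.2.tops R' ms
    let L ← Timed.append t.2.facets o.facets
    return ⟨L, B :: R' :: o.bags⟩

/-- The whole construction; the leaf contributes the empty complex and an empty bag. -/
def construction (D : Digraph V) [DecidableRel D.Adj] (P : NicePathDecomposition D) :
    Timed (Output V) := do
  let o ← build D [] ⟨fun _ => 0, fun _ => 0⟩ [] P.moves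
  return ⟨o.facets, [] :: o.bags⟩

/-- The complex `Y_D`. -/
def Y (D : Digraph V) [DecidableRel D.Adj] (P : NicePathDecomposition D) :
    PreAbstractSimplicialComplex (Point V) :=
  generated (construction D P).val.facets

/-- The path decomposition of the Hasse diagram of `Y_D`. -/
def hasseBags (D : Digraph V) [DecidableRel D.Adj] (P : NicePathDecomposition D) :
    List (Finset (Finset (Point V))) :=
  (construction D P).val.bags.map closure

end Construction

end CyclesToTori

/-!
The complex `Y D P` is a union of cylinders between circles with three vertices, the hoops. Each part
of it that is built in consecutive steps is described by a `Layout`: for each vertex `v` there are two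
chains of hoops `inc v k` and `out v k`, joined by a hoop `mid v` when `v` is forgotten, and for each
edge `uv` a chain of hoops `edge u v j` leads from the chain `out u` to the chain `inc v`. Layouts of
consecutive parts can be composed (`Drawn.comp`), and an induction along the path decomposition shows
that `Y D P` is the complex of a layout that contains exactly the edges of `D` (`exists_layout`). The
point is that two adjacent vertices share a bag, so that the gadget of an edge is attached when the
first of its ends is forgotten.

*Closed surfaces.* In a closed surface each edge has exactly two cofaces and all links are connected
(`exists_two_cofaces`, `link_connected`). An edge of `Y D P` that is not on a hoop lies in two
triangles, both of the same cylinder, so that a closed surface contains all triangles of a cylinder or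
none, and it continues beyond the ends of its cylinders. At the hoop where three cylinders meet, two of
them lead to two hoops that touch in a point. They cannot both be used, because the link of that point
would be disconnected (`HoopSystem.UsedHoop.circ_injective`). Hence the cylinders of a closed surface
can only be followed in the direction of the edges of `D` (`Layout.used_right_unique`,
`Layout.used_left_unique`): each component is a cyclic sequence of cylinders, that is, a triangulated
torus `gridComplex F` (`Layout.exists_eq_gridComplex`), and it passes the gadgets of the vertices of a
directed cycle (`Layout.exists_directedCycle`). Conversely, the hoops along a directed cycle form a
torus (`Layout.exists_gridComplex_le`), and disjoint cycles yield disjoint tori.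

*Topology.* The realization of the triangulated torus is mapped to the product of the realizations of
two cycles by summing the barycentric coordinates over rows and over columns. This map is continuous
and bijective, hence a homeomorphism by compactness (`isTorus_grid`). The genus is computed from the
Euler characteristic (`genus_grid`). A closed surface in `Y D P` is therefore determined up to
homeomorphism by its number of components, and so is its total genus (`realization_homeomorph`,
`totalGenus_eq`).

*The path decomposition of the Hasse diagram.* The triangles added before a bag is reached and those
added afterwards have only vertices of the last hoops of the vertices in the bag in common, and a
common face lies on one of these hoops, hence in a collar (`mem_closure_collars`). This is the
convexity condition; the bounds on the width and on the number of steps are obtained by counting.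
-/

namespace CyclesToTori

/-! ### Links and edges of closed surfaces -/

section Links

variable {P : Type*}

lemma face_nonempty {K : PreAbstractSimplicialComplex P} {s : Finset P} (hs : s ∈ K) :
    s.Nonempty :=
  (K.isRelLowerSet_faces hs).1

lemma face_mono {K : PreAbstractSimplicialComplex P} {r s : Finset P} (hs : s ∈ K) (hr : r ⊆ s)
    (hn : r.Nonempty) : r ∈ K :=
  (K.isRelLowerSet_faces hs).2 hr hn

lemma vertex_mem {K : PreAbstractSimplicialComplex P} {s : Finset P} (hs : s ∈ K) {p : P}
    (hp : p ∈ s) : {p} ∈ K :=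
  face_mono hs (Finset.singleton_subset_iff.mpr hp) (Finset.singleton_nonempty p)

variable [DecidableEq P]

lemma pair_mem {K : PreAbstractSimplicialComplex P} {s : Finset P} (hs : s ∈ K) {p q : P}
    (hp : p ∈ s) (hq : q ∈ s) : {p, q} ∈ K :=
  face_mono hs (by simp [Finset.insert_subset_iff, hp, hq]) (Finset.insert_nonempty _ _)

lemma ne_of_card_triple {a b c : P} (h : ({a, b, c} : Finset P).card = 3) :
    a ≠ b ∧ a ≠ c ∧ b ≠ c := by
  refine ⟨?_, ?_, ?_⟩ <;> rintro rfl
  · rw [Finset.insert_eq_of_mem (by simp)] at h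
    exact absurd h (by have := Finset.card_le_two (a := a) (b := c); omega)
  · rw [Finset.insert_eq_of_mem (by simp)] at h
    exact absurd h (by have := Finset.card_le_two (a := b) (b := a); omega)
  · rw [Finset.pair_eq_singleton] at h
    exact absurd h (by have := Finset.card_le_two (a := a) (b := b); omega)

lemma mem_vertexLink {K : PreAbstractSimplicialComplex P} {p : P} {t : Finset P} :
    t ∈ vertexLink K p ↔ t.Nonempty ∧ p ∉ t ∧ insert p t ∈ K := by
  constructor
  · rintro ⟨ht, hp, s, hs, hps, hts⟩
    exact ⟨face_nonempty ht, hp,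
      face_mono hs (Finset.insert_subset hps hts) (Finset.insert_nonempty _ _)⟩
  · rintro ⟨hn, hp, h⟩
    exact ⟨face_mono h (Finset.subset_insert _ _) hn, hp, _, h, Finset.mem_insert_self _ _,
      Finset.subset_insert _ _⟩

lemma one_add_one_ne_zero_fin {m : ℕ} : (1 : Fin (m + 3)) + 1 ≠ 0 := by
  simp only [ne_eq, Fin.ext_iff, Fin.val_add, Fin.val_one, Fin.val_zero]
  rw [Nat.mod_eq_of_lt (by omega)]
  omega

lemma exists_eq_of_singleton_mem_cycle {m : ℕ} {f : Fin (m + 3) → P} {q : P}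
    (h : (∃ i, ({q} : Finset P) = {f i}) ∨ ∃ i, ({q} : Finset P) = {f i, f (i + 1)}) :
    ∃ i, q = f i := by
  rcases h with ⟨i, hi⟩ | ⟨i, hi⟩
  · exact ⟨i, by simpa using hi⟩
  · have h1 : f i ∈ ({q} : Finset P) := by rw [hi]; simp
    exact ⟨i, (by simpa using h1 : f i = q).symm⟩

/-- If the link of `p` were a path, then the edge from `p` to an end of this path would have a single
coface and would lie in the boundary. -/
lemma isSimpleCycle_link {S : PreAbstractSimplicialComplex P} (hS : IsSurface S)
    (hb : boundary S = ⊥) {p : P} (hp : {p} ∈ S) : IsSimpleCycle (vertexLink S p) := by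
  rcases hS.link p hp with ⟨m, f, hf, hL⟩ | h
  swap
  · exact h
  exfalso
  have hL' : ∀ t, (t.Nonempty ∧ p ∉ t ∧ insert p t ∈ S) ↔
      ((∃ i, t = {f i}) ∨ ∃ i : Fin (m + 1), t = {f i.castSucc, f i.succ}) := by
    intro t
    rw [← mem_vertexLink, hL]; rfl
  obtain ⟨-, hp0, he⟩ := (hL' {f 0}).mpr (Or.inl ⟨0, rfl⟩)
  have h01 : f 0 ≠ f 1 := fun h => absurd (hf h) (by simp)
  obtain ⟨-, hp1, ht⟩ := (hL' {f 0, f 1}).mpr (Or.inr ⟨0, rfl⟩)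
  have hpe : p ≠ f 0 := by simpa using hp0
  -- the only coface of the edge from `p` to the end `f 0` of the path
  have hcof : {t | t ∈ S ∧ ({p, f 0} : Finset P) ⊂ t} = {insert p {f 0, f 1}} := by
    ext t
    simp only [Set.mem_ofPred_eq, Set.mem_singleton_iff]
    constructor
    · rintro ⟨htS, hsub⟩
      have hpt : p ∈ t := hsub.1 (by simp)
      have h0t : f 0 ∈ t.erase p := Finset.mem_erase.mpr ⟨hpe.symm, hsub.1 (by simp)⟩
      have hins : insert p (t.erase p) = t := Finset.insert_erase hpt
      rcases (hL' (t.erase p)).mp ⟨⟨_, h0t⟩, by simp, by rwa [hins]⟩ with ⟨i, hi⟩ | ⟨i, hi⟩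
      · rw [hi, Finset.mem_singleton] at h0t
        rw [← h0t] at hi
        rw [hi] at hins
        exact absurd hins.symm.subset hsub.2
      · rw [hi, Finset.mem_insert, Finset.mem_singleton] at h0t
        rcases h0t with h | h
        · have : i = 0 := by
            have := congrArg Fin.val (hf h)
            exact Fin.ext (by simpa using this.symm)
          subst this
          rw [← hins, hi]; rfl
        · exact absurd (hf h) (Fin.succ_ne_zero i).symm
    · rintro rfl
      refine ⟨ht, ?_, ?_⟩
      · intro x hx
        simp only [Finset.mem_insert, Finset.mem_singleton] at hx ⊢
        tauto
      · intro hsub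
        have : f 1 ∈ ({p, f 0} : Finset P) := hsub (by simp)
        simp only [Finset.mem_insert, Finset.mem_singleton] at this hp1
        rcases this with h | h
        · exact hp1 (Or.inr h.symm)
        · exact h01 h.symm
  have : ({p} : Finset P) ∈ boundary S :=
    ⟨Finset.singleton_nonempty p, {p, f 0}, he, by simp, Finset.card_pair hpe, by
      rw [hcof, Set.ncard_singleton]⟩
  rw [hb] at this
  exact this

/-- In a closed surface, each edge is contained in exactly two triangles. -/
lemma exists_two_cofaces {S : PreAbstractSimplicialComplex P} (hS : IsSurface S)
    (hb : boundary S = ⊥) {p q : P} (hpq : p ≠ q) (h : {p, q} ∈ S) :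
    ∃ z₁ z₂, z₁ ≠ z₂ ∧ ∀ z, (z ≠ p ∧ z ≠ q ∧ {p, q, z} ∈ S) ↔ z = z₁ ∨ z = z₂ := by
  obtain ⟨m, f, hf, hL⟩ := isSimpleCycle_link hS hb (vertex_mem h (p := p) (by simp))
  have hL' : ∀ t, (t.Nonempty ∧ p ∉ t ∧ insert p t ∈ S) ↔
      ((∃ i, t = {f i}) ∨ ∃ i, t = {f i, f (i + 1)}) := by
    intro t
    rw [← mem_vertexLink, hL]; rfl
  obtain ⟨i, rfl⟩ := exists_eq_of_singleton_mem_cycle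
    ((hL' {q}).mp ⟨by simp, by simpa using hpq, h⟩)
  refine ⟨f (i + 1), f (i - 1), ?_, fun z => ?_⟩
  · intro h
    have h2 := hf h
    have h3 : (1 : Fin (m + 3)) + 1 = 0 := by
      have h4 : i + (1 + 1) = i + 0 := by rw [add_zero, ← add_assoc, h2, sub_add_cancel]
      exact add_left_cancel h4
    exact one_add_one_ne_zero_fin h3
  · constructor
    · rintro ⟨hzp, hzq, hz⟩
      rcases (hL' {f i, z}).mp ⟨by simp, by simp [hpq, hzp.symm], hz⟩ with ⟨j, hj⟩ | ⟨j, hj⟩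
      · have h1 : f i ∈ ({f j} : Finset P) := by rw [← hj]; simp
        have h2 : z ∈ ({f j} : Finset P) := by rw [← hj]; simp
        simp only [Finset.mem_singleton] at h1 h2
        exact absurd (h2.trans h1.symm) hzq
      · have h1 : f i ∈ ({f j, f (j + 1)} : Finset P) := by rw [← hj]; simp
        have h2 : z ∈ ({f j, f (j + 1)} : Finset P) := by rw [← hj]; simp
        simp only [Finset.mem_insert, Finset.mem_singleton] at h1 h2
        rcases h1 with h1 | h1
        · obtain rfl := hf h1
          rcases h2 with h2 | h2
          · exact absurd h2 hzq
          · exact Or.inl h2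
        · have h3 := hf h1
          subst h3
          rcases h2 with h2 | h2
          · exact Or.inr (by rw [h2]; congr 1; exact eq_sub_of_add_eq rfl)
          · exact absurd h2 hzq
    · have one_ne : (1 : Fin (m + 3)) ≠ 0 := by simp
      rintro (rfl | rfl)
      · obtain ⟨-, h1, h2⟩ := (hL' {f i, f (i + 1)}).mpr (Or.inr ⟨i, rfl⟩)
        simp only [Finset.mem_insert, Finset.mem_singleton, not_or] at h1
        exact ⟨Ne.symm h1.2, fun h => one_ne (by simpa using hf h), h2⟩
      · obtain ⟨-, h1, h2⟩ := (hL' {f (i - 1), f (i - 1 + 1)}).mpr (Or.inr ⟨_, rfl⟩)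
        rw [sub_add_cancel] at h1 h2
        simp only [Finset.mem_insert, Finset.mem_singleton, not_or] at h1
        refine ⟨Ne.symm h1.1, fun h => one_ne (by simpa using hf h), ?_⟩
        rwa [Finset.pair_comm (f i)]

lemma exists_other_coface {S : PreAbstractSimplicialComplex P} (hS : IsSurface S)
    (hb : boundary S = ⊥) {p q z : P}
    (h : {p, q, z} ∈ S) (hc : ({p, q, z} : Finset P).card = 3) :
    ∃ z', z' ≠ z ∧ z' ≠ p ∧ z' ≠ q ∧ {p, q, z'} ∈ S := by
  obtain ⟨h1, h2, h3⟩ := ne_of_card_triple hc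
  obtain ⟨z₁, z₂, hne, hz⟩ := exists_two_cofaces hS hb h1 (pair_mem h (by simp) (by simp))
  rcases (hz z).mp ⟨h2.symm, h3.symm, h⟩ with rfl | rfl
  · exact ⟨z₂, hne.symm, (hz z₂).mpr (Or.inr rfl)⟩
  · exact ⟨z₁, hne, (hz z₁).mpr (Or.inl rfl)⟩

open Fin.CommRing in
/-- Links in closed surfaces are connected: a nonempty set of neighbors of `p` that is closed under
adjacency in the link contains all neighbors. -/
lemma link_connected {S : PreAbstractSimplicialComplex P} (hS : IsSurface S)
    (hb : boundary S = ⊥) {p q₀ : P} (N : Set P) (hq₀ : q₀ ∈ N) (hne : q₀ ≠ p) (h : {p, q₀} ∈ S)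
    (hN : ∀ q q', q ∈ N → q ≠ q' → q ≠ p → q' ≠ p → {p, q, q'} ∈ S → q' ∈ N) {q : P}
    (hqp : q ≠ p) (hq : {p, q} ∈ S) : q ∈ N := by
  obtain ⟨m, f, hf, hL⟩ := isSimpleCycle_link hS hb (vertex_mem h (p := p) (by simp))
  have hL' : ∀ t, (t.Nonempty ∧ p ∉ t ∧ insert p t ∈ S) ↔
      ((∃ i, t = {f i}) ∨ ∃ i, t = {f i, f (i + 1)}) := by
    intro t
    rw [← mem_vertexLink, hL]; rfl
  obtain ⟨i, rfl⟩ := exists_eq_of_singleton_mem_cycle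
    ((hL' {q₀}).mp ⟨by simp, by simpa using hne.symm, h⟩)
  obtain ⟨j, rfl⟩ := exists_eq_of_singleton_mem_cycle
    ((hL' {q}).mp ⟨by simp, by simpa using hqp.symm, hq⟩)
  have one_ne : (1 : Fin (m + 3)) ≠ 0 := by simp
  -- walk along the link from the position `i` of `q₀`
  have key : ∀ k : ℕ, f (i + (k : Fin (m + 3))) ∈ N := by
    intro k
    induction k with
    | zero => simpa using hq₀
    | succ k ih =>
      obtain ⟨-, h1, h2⟩ := (hL' _).mpr (Or.inr ⟨i + (k : Fin (m + 3)), rfl⟩)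
      simp only [Finset.mem_insert, Finset.mem_singleton, not_or] at h1
      have := hN _ _ ih (fun h => one_ne (by simpa using hf h)) (Ne.symm h1.1) (Ne.symm h1.2) h2
      rw [Nat.cast_add, Nat.cast_one, ← add_assoc]
      exact this
  have := key (j - i).val
  rwa [Fin.cast_val_eq_self, add_sub_cancel] at this

/-- A complex in which all links are cycles has no boundary. -/
lemma boundary_eq_bot_of_link {S : PreAbstractSimplicialComplex P}
    (h : ∀ p, {p} ∈ S → IsSimpleCycle (vertexLink S p)) : boundary S = ⊥ := by
  refine PreAbstractSimplicialComplex.ext (Set.eq_empty_of_forall_notMem ?_)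
  rintro s ⟨-, e, he, -, hcard, hco⟩
  obtain ⟨p, q, hpq, rfl⟩ := Finset.card_eq_two.mp hcard
  obtain ⟨m, f, hf, hL⟩ := h p (vertex_mem he (by simp))
  have hL' : ∀ t, (t.Nonempty ∧ p ∉ t ∧ insert p t ∈ S) ↔
      ((∃ i, t = {f i}) ∨ ∃ i, t = {f i, f (i + 1)}) := by
    intro t
    rw [← mem_vertexLink, hL]; rfl
  obtain ⟨i, rfl⟩ := exists_eq_of_singleton_mem_cycle
    ((hL' {q}).mp ⟨by simp, by simpa using hpq, he⟩)
  obtain ⟨t, ht⟩ := Set.ncard_eq_one.mp hco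
  have one_ne : (1 : Fin (m + 3)) ≠ 0 := by simp
  have mem : ∀ z, z ≠ f i → p ≠ z → {p, f i, z} ∈ S → {p, f i, z} = t := by
    intro z hz hpz hzS
    have : ({p, f i, z} : Finset P) ∈ {t | t ∈ S ∧ ({p, f i} : Finset P) ⊂ t} := by
      refine ⟨hzS, ?_, fun hsub => ?_⟩
      · intro x hx
        simp only [Finset.mem_insert, Finset.mem_singleton] at hx ⊢
        tauto
      · have : z ∈ ({p, f i} : Finset P) := hsub (by simp)
        simp only [Finset.mem_insert, Finset.mem_singleton] at this
        exact this.elim (fun h => hpz h.symm) hz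
    rw [ht] at this
    exact this
  -- the two neighbors of `f i` in the link yield two different cofaces
  obtain ⟨-, h1, h2⟩ := (hL' {f i, f (i + 1)}).mpr (Or.inr ⟨i, rfl⟩)
  obtain ⟨-, h3, h4⟩ := (hL' {f (i - 1), f (i - 1 + 1)}).mpr (Or.inr ⟨_, rfl⟩)
  rw [sub_add_cancel] at h3 h4
  simp only [Finset.mem_insert, Finset.mem_singleton, not_or] at h1 h3
  rw [Finset.pair_comm] at h4
  have e1 := mem _ (fun h => one_ne (by simpa using hf h)) h1.2 h2
  have e2 := mem _ (fun h => one_ne (by simpa using hf h)) h3.1 h4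
  have : f (i + 1) ∈ ({p, f i, f (i - 1)} : Finset P) := by rw [e2, ← e1]; simp
  simp only [Finset.mem_insert, Finset.mem_singleton] at this
  rcases this with h | h | h
  · exact h1.2 h.symm
  · exact one_ne (by simpa using hf h)
  · have := hf h
    exact one_add_one_ne_zero_fin (by
      have h5 : i + (1 + 1) = i + 0 := by rw [add_zero, ← add_assoc, this, sub_add_cancel]
      exact add_left_cancel h5)

end Links

/-! ### Triangulated tori -/

section Grid

/-- The vertices of the standard triangulated torus: `m + 3` circles with three vertices each. -/
abbrev Grid (m : ℕ) : Type := ZMod (m + 3) × ZMod 3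

/-- The six differences between a vertex of the standard torus and its neighbors, in cyclic order:
the sides of the unit squares and the diagonals in direction `(1, 1)`. -/
def hex (m : ℕ) : Fin 6 → Grid m :=
  ![(1, 0), (1, 1), (0, 1), (-1, 0), (-1, -1), (0, -1)]

lemma one_ne_zero_grid (m : ℕ) : (1 : ZMod (m + 3)) ≠ 0 := by
  change (1 : Fin (m + 3)) ≠ 0
  simp

lemma one_add_one_ne_zero_grid (m : ℕ) : (1 : ZMod (m + 3)) + 1 ≠ 0 :=
  one_add_one_ne_zero_fin

lemma one_ne_neg_one_grid (m : ℕ) : (1 : ZMod (m + 3)) ≠ -1 := fun h =>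
  one_add_one_ne_zero_grid m (by nth_rewrite 1 [h]; exact neg_add_cancel 1)

lemma hex_add_three (m : ℕ) (i : Fin 6) : hex m (i + 3) = -hex m i := by
  fin_cases i <;> simp [hex]

lemma hex_add_hex (m : ℕ) (i : Fin 6) : hex m i + hex m (i + 2) = hex m (i + 1) := by
  fin_cases i <;> simp [hex]

lemma hex_ne_zero (m : ℕ) (i : Fin 6) : hex m i ≠ 0 := by
  have h1 := one_ne_zero_grid m
  have h3 : (1 : ZMod 3) ≠ 0 := one_ne_zero_grid 0
  fin_cases i <;> simp [hex, Prod.ext_iff, h1, h3]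

lemma hex_injective (m : ℕ) : Function.Injective (hex m) := by
  have h1 := one_ne_zero_grid m
  have h2 := one_ne_neg_one_grid m
  have h3 : (1 : ZMod 3) ≠ 0 := one_ne_zero_grid 0
  have h4 : (1 : ZMod 3) ≠ -1 := one_ne_neg_one_grid 0
  intro i j h
  fin_cases i <;> fin_cases j <;>
    first
    | rfl
    | (exfalso; revert h
       simp [hex, Prod.ext_iff, h1, h2, h3, h4, h1.symm, h2.symm, h3.symm, h4.symm])

variable {P : Type*} [DecidableEq P] {m : ℕ}

/-- The triangle at `x` between the directions `i` and `i + 1`, in the vertex labelling `F`. -/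
def hexTriangle (F : Grid m → P) (x : Grid m) (i : Fin 6) : Finset P :=
  {F x, F (x + hex m i), F (x + hex m (i + 1))}

/-- The triangulated torus with the vertex labelling `F`. -/
def gridComplex (F : Grid m → P) : PreAbstractSimplicialComplex P where
  faces := {s | s.Nonempty ∧ ∃ x i, s ⊆ hexTriangle F x i}
  isRelLowerSet_faces := by
    rintro s ⟨hs, x, i, h⟩
    exact ⟨hs, fun r hr hr' => ⟨hr', x, i, hr.trans h⟩⟩

lemma mem_gridComplex {F : Grid m → P} {s : Finset P} :
    s ∈ gridComplex F ↔ s.Nonempty ∧ ∃ x i, s ⊆ hexTriangle F x i := Iff.rfl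

/-- A triangle seen from its second vertex. -/
lemma hexTriangle_rotate (F : Grid m → P) (x : Grid m) (i : Fin 6) :
    hexTriangle F (x + hex m i) (i + 2) = hexTriangle F x i := by
  have h1 : x + hex m i + hex m (i + 2) = x + hex m (i + 1) := by rw [add_assoc, hex_add_hex]
  have h2 : x + hex m i + hex m (i + 2 + 1) = x := by
    rw [add_assoc i, show (2 + 1 : Fin 6) = 3 from rfl, hex_add_three]; abel
  rw [hexTriangle, h1, h2, hexTriangle]
  ext p
  simp only [Finset.mem_insert, Finset.mem_singleton]
  tauto

lemma hexTriangle_rotate' (F : Grid m → P) (x : Grid m) (i : Fin 6) :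
    hexTriangle F (x + hex m (i + 1)) (i + 4) = hexTriangle F x i := by
  rw [← hexTriangle_rotate F x i, ← hexTriangle_rotate F (x + hex m i) (i + 2), add_assoc x,
    hex_add_hex, add_assoc i, show (2 + 2 : Fin 6) = 4 from rfl]

lemma hexTriangle_mem (F : Grid m → P) (x : Grid m) (i : Fin 6) :
    hexTriangle F x i ∈ gridComplex F :=
  ⟨⟨F x, by simp [hexTriangle]⟩, x, i, subset_rfl⟩

/-- The star of a vertex of the triangulated torus consists of six triangles. -/
lemma subset_hexTriangle {F : Grid m → P} (hF : Function.Injective F) {s : Finset P}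
    (hs : s ∈ gridComplex F) {x : Grid m} (hx : F x ∈ s) : ∃ i, s ⊆ hexTriangle F x i := by
  obtain ⟨-, y, i, h⟩ := hs
  have := h hx
  simp only [hexTriangle, Finset.mem_insert, Finset.mem_singleton] at this
  rcases this with h' | h' | h' <;> obtain rfl := hF h'
  · exact ⟨i, h⟩
  · exact ⟨i + 2, by rwa [hexTriangle_rotate]⟩
  · exact ⟨i + 4, by rwa [hexTriangle_rotate']⟩

lemma exists_of_mem_face {F : Grid m → P} {s : Finset P} (hs : s ∈ gridComplex F) {p : P}
    (hp : p ∈ s) : ∃ x, p = F x := by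
  obtain ⟨-, y, i, h⟩ := hs
  have := h hp
  simp only [hexTriangle, Finset.mem_insert, Finset.mem_singleton] at this
  rcases this with h' | h' | h' <;> exact ⟨_, h'⟩

lemma card_hexTriangle {F : Grid m → P} (hF : Function.Injective F) (x : Grid m) (i : Fin 6) :
    (hexTriangle F x i).card = 3 := by
  refine Finset.card_eq_three.mpr ⟨_, _, _, ?_, ?_, ?_, rfl⟩
  · intro h; exact hex_ne_zero m i (by simpa using hF h)
  · intro h; exact hex_ne_zero m (i + 1) (by simpa using hF h)
  · intro h
    have h1 := hex_injective m (add_left_cancel (hF h))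
    exact (by decide : ∀ i : Fin 6, i ≠ i + 1) i h1

/-- If a vertex of the torus and two further points span a triangle, then these points are
consecutive neighbors of the vertex. -/
lemma exists_of_triple_mem {F : Grid m → P} (hF : Function.Injective F) {x : Grid m} {q r : P}
    (h : {F x, q, r} ∈ gridComplex F) (hcard : ({F x, q, r} : Finset P).card = 3) :
    ∃ i, (q = F (x + hex m i) ∧ r = F (x + hex m (i + 1))) ∨
      (r = F (x + hex m i) ∧ q = F (x + hex m (i + 1))) := by
  obtain ⟨i, hi⟩ := subset_hexTriangle hF h (x := x) (by simp)
  obtain ⟨h1, h2, h3⟩ := ne_of_card_triple hcard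
  have hq : q ∈ hexTriangle F x i := hi (by simp)
  have hr : r ∈ hexTriangle F x i := hi (by simp)
  simp only [hexTriangle, Finset.mem_insert, Finset.mem_singleton] at hq hr
  refine ⟨i, ?_⟩
  rcases hq with rfl | rfl | rfl
  · exact absurd rfl h1
  · rcases hr with rfl | rfl | rfl
    · exact absurd rfl h2
    · exact absurd rfl h3
    · exact Or.inl ⟨rfl, rfl⟩
  · rcases hr with rfl | rfl | rfl
    · exact absurd rfl h2
    · exact Or.inr ⟨rfl, rfl⟩
    · exact absurd rfl h3

lemma isSimpleCycle_link_grid {F : Grid m → P} (hF : Function.Injective F) {p : P}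
    (hp : {p} ∈ gridComplex F) : IsSimpleCycle (vertexLink (gridComplex F) p) := by
  obtain ⟨x, rfl⟩ := exists_of_mem_face hp (Finset.mem_singleton_self p)
  refine ⟨3, fun i => F (x + hex m i), fun i j h => hex_injective m (add_left_cancel (hF h)), ?_⟩
  ext t
  rw [mem_vertexLink]
  constructor
  · rintro ⟨hn, hx, ht⟩
    obtain ⟨i, hi⟩ := subset_hexTriangle hF ht (x := x) (by simp)
    have hsub : t ⊆ {F (x + hex m i), F (x + hex m (i + 1))} := by
      intro q hq
      have h1 := hi (Finset.mem_insert_of_mem hq)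
      simp only [hexTriangle, Finset.mem_insert, Finset.mem_singleton] at h1 ⊢
      rcases h1 with rfl | h1
      · exact absurd hq hx
      · exact h1
    by_cases ha : F (x + hex m i) ∈ t <;> by_cases hb : F (x + hex m (i + 1)) ∈ t
    · exact Or.inr ⟨i, Finset.Subset.antisymm hsub (by
        intro q hq
        simp only [Finset.mem_insert, Finset.mem_singleton] at hq
        rcases hq with rfl | rfl <;> assumption)⟩
    · refine Or.inl ⟨i, Finset.eq_singleton_iff_unique_mem.mpr ⟨ha, fun q hq => ?_⟩⟩
      have := hsub hq
      simp only [Finset.mem_insert, Finset.mem_singleton] at this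
      exact this.resolve_right (fun h => hb (h ▸ hq))
    · refine Or.inl ⟨i + 1, Finset.eq_singleton_iff_unique_mem.mpr ⟨hb, fun q hq => ?_⟩⟩
      have := hsub hq
      simp only [Finset.mem_insert, Finset.mem_singleton] at this
      exact this.resolve_left (fun h => ha (h ▸ hq))
    · obtain ⟨q, hq⟩ := hn
      have := hsub hq
      simp only [Finset.mem_insert, Finset.mem_singleton] at this
      rcases this with rfl | rfl <;> contradiction
  · have hne : ∀ i, F x ≠ F (x + hex m i) := fun i h => hex_ne_zero m i (by simpa using hF h)
    rintro (⟨i, rfl⟩ | ⟨i, rfl⟩)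
    · refine ⟨by simp, by simpa using hne i, face_mono (hexTriangle_mem F x i) ?_ (by simp)⟩
      intro q hq
      simp only [hexTriangle, Finset.mem_insert, Finset.mem_singleton] at hq ⊢
      tauto
    · exact ⟨by simp, by simp [hne i, hne (i + 1)], hexTriangle_mem F x i⟩

lemma isSurface_grid {F : Grid m → P} (hF : Function.Injective F) :
    IsSurface (gridComplex F) where
  finite := by
    refine (Set.finite_iUnion fun x : Grid m × Fin 6 =>
      (hexTriangle F x.1 x.2).powerset.finite_toSet).subset ?_
    rintro s ⟨-, x, i, h⟩
    exact Set.mem_iUnion.mpr ⟨(x, i), by simpa using h⟩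
  dim_le := by
    rintro s ⟨-, x, i, h⟩
    exact (Finset.card_le_card h).trans (card_hexTriangle hF x i).le
  pure := by
    rintro s ⟨-, x, i, h⟩
    exact ⟨_, hexTriangle_mem F x i, h, card_hexTriangle hF x i⟩
  link p hp := Or.inr (isSimpleCycle_link_grid hF hp)

lemma boundary_grid {F : Grid m → P} (hF : Function.Injective F) :
    boundary (gridComplex F) = ⊥ :=
  boundary_eq_bot_of_link fun _ hp => isSimpleCycle_link_grid hF hp

lemma isClosedSurface_grid {F : Grid m → P} (hF : Function.Injective F) :
    IsClosedSurface (gridComplex F) where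
  isSurface := isSurface_grid hF
  boundary_eq := boundary_grid hF
  ne_bot h := by
    have := hexTriangle_mem F 0 0
    rw [h] at this
    exact this

lemma isConnected_grid {F : Grid m → P} (hF : Function.Injective F) :
    IsConnected (gridComplex F) := by
  have hv : ∀ x, {F x} ∈ gridComplex F := fun x =>
    vertex_mem (hexTriangle_mem F x 0) (by simp [hexTriangle])
  have hstep : ∀ x i, (skeleton (gridComplex F)).Adj ⟨F x, hv x⟩ ⟨F (x + hex m i), hv _⟩ := by
    intro x i
    refine ⟨fun h => hex_ne_zero m i (by simpa using hF (congrArg Subtype.val h)), ?_⟩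
    exact pair_mem (hexTriangle_mem F x i) (by simp [hexTriangle]) (by simp [hexTriangle])
  have hreach : ∀ j i : ℕ, (skeleton (gridComplex F)).Reachable ⟨F 0, hv 0⟩
      ⟨F ((j : ZMod (m + 3)), (i : ZMod 3)), hv _⟩ := by
    intro j i
    induction j with
    | zero =>
      induction i with
      | zero => simp only [Nat.cast_zero]; rfl
      | succ i ih =>
        refine ih.trans ?_
        have := hstep (((0 : ℕ) : ZMod (m + 3)), (i : ZMod 3)) 2
        simp only [hex, Matrix.cons_val, Prod.mk_add_mk, add_zero] at this
        simpa using this.reachable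
    | succ j ih =>
      refine ih.trans ?_
      have := hstep ((j : ZMod (m + 3)), (i : ZMod 3)) 0
      simpa [hex] using this.reachable
  have hall : ∀ q, (skeleton (gridComplex F)).Reachable ⟨F 0, hv 0⟩ q := by
    rintro ⟨q, hq⟩
    obtain ⟨⟨j, i⟩, rfl⟩ := exists_of_mem_face hq (Finset.mem_singleton_self q)
    have := hreach j.val i.val
    rwa [show (((j.val : ℕ) : ZMod (m + 3)), ((i.val : ℕ) : ZMod 3)) = (j, i) by
      rw [ZMod.natCast_zmod_val, ZMod.natCast_zmod_val]] at this
  exact { preconnected := fun p q => (hall p).symm.trans (hall q), nonempty := ⟨⟨F 0, hv 0⟩⟩ }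

lemma orientable_grid {F : Grid m → P} (hF : Function.Injective F) :
    Orientable (gridComplex F) := by
  have key : ∀ p q r, ({p, q, r} : Finset P) ∈ gridComplex F →
      ({p, q, r} : Finset P).card = 3 →
      ∃ x i, p = F x ∧ ((q = F (x + hex m i) ∧ r = F (x + hex m (i + 1))) ∨
        (r = F (x + hex m i) ∧ q = F (x + hex m (i + 1)))) := by
    intro p q r h hc
    obtain ⟨x, rfl⟩ := exists_of_mem_face h (p := p) (by simp)
    obtain ⟨i, hi⟩ := exists_of_triple_mem hF h hc
    exact ⟨x, i, rfl, hi⟩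
  have inj : ∀ {x : Grid m} {i j : Fin 6}, F (x + hex m i) = F (x + hex m j) → i = j :=
    fun h => hex_injective m (add_left_cancel (hF h))
  -- at each vertex, the triangles are oriented in the cyclic order of the six directions
  let O : P → P → P → Prop := fun p q r =>
    ∃ x i, p = F x ∧ q = F (x + hex m i) ∧ r = F (x + hex m (i + 1))
  have cyc : ∀ a b c, O a b c → O b c a := by
    rintro _ _ _ ⟨x, i, rfl, rfl, rfl⟩
    refine ⟨x + hex m i, i + 2, rfl, ?_, ?_⟩
    · rw [add_assoc, hex_add_hex]
    · rw [add_assoc i, show (2 + 1 : Fin 6) = 3 from rfl, hex_add_three]; congr 1; abel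
  have asymm : ∀ a b c, O a b c → ¬ O b a c := by
    rintro _ _ _ ⟨x, i, rfl, rfl, rfl⟩ h
    obtain ⟨y, j, h1, h2, h3⟩ := cyc _ _ _ h
    obtain rfl := hF h1
    have e1 := inj h2
    have e2 := inj h3
    subst e2
    exact (by decide : ∀ j : Fin 6, j + 1 + 1 ≠ j) _ e1
  have total : ∀ a b c, ({a, b, c} : Finset P) ∈ gridComplex F →
      ({a, b, c} : Finset P).card = 3 → O a b c ∨ O b a c := by
    intro a b c h hc
    obtain ⟨x, i, rfl, ⟨rfl, rfl⟩ | ⟨rfl, rfl⟩⟩ := key a b c h hc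
    · exact Or.inl ⟨x, i, rfl, rfl, rfl⟩
    · exact Or.inr (cyc _ _ _ (cyc _ _ _ ⟨x, i, rfl, rfl, rfl⟩))
  refine ⟨O, cyc, fun a b c h hc => ⟨asymm a b c, fun hn => (total a b c h hc).resolve_right hn⟩, ?_⟩
  rintro a b c d - - hd hcd hne ⟨x, i, rfl, rfl, rfl⟩
  refine (total _ _ d hd hcd).resolve_left ?_
  rintro ⟨y, j, h1, h2, rfl⟩
  obtain rfl := hF h1
  obtain rfl := inj h2
  exact hne rfl

/-- Each vertex of the torus is responsible for three of its edges and for two of its triangles. -/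
lemma eulerChar_grid {F : Grid m → P} (hF : Function.Injective F) :
    eulerChar (gridComplex F) = 0 := by
  have inj : ∀ {x : Grid m} {i j : Fin 6}, F (x + hex m i) = F (x + hex m j) → i = j :=
    fun h => hex_injective m (add_left_cancel (hF h))
  have hne : ∀ x i, F x ≠ F (x + hex m i) := fun x i h => hex_ne_zero m i (by simpa using hF h)
  have h1 : {s | s ∈ gridComplex F ∧ s.card = 1} = Set.range fun x => ({F x} : Finset P) := by
    ext s
    constructor
    · rintro ⟨hs, hc⟩
      obtain ⟨p, rfl⟩ := Finset.card_eq_one.mp hc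
      obtain ⟨x, rfl⟩ := exists_of_mem_face hs (Finset.mem_singleton_self p)
      exact ⟨x, rfl⟩
    · rintro ⟨x, rfl⟩
      exact ⟨vertex_mem (hexTriangle_mem F x 0) (by simp [hexTriangle]), Finset.card_singleton _⟩
  have h2 : {s | s ∈ gridComplex F ∧ s.card = 2} =
      Set.range fun x : Grid m × Fin 3 =>
        ({F x.1, F (x.1 + hex m (x.2.castLE (by omega)))} : Finset P) := by
    ext s
    constructor
    · rintro ⟨hs, hc⟩
      obtain ⟨p, q, hpq, rfl⟩ := Finset.card_eq_two.mp hc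
      obtain ⟨x, rfl⟩ := exists_of_mem_face hs (p := p) (by simp)
      have : ∃ i, q = F (x + hex m i) := by
        obtain ⟨i, hi⟩ := subset_hexTriangle hF hs (x := x) (by simp)
        have hq : q ∈ hexTriangle F x i := hi (by simp)
        simp only [hexTriangle, Finset.mem_insert, Finset.mem_singleton] at hq
        rcases hq with h | h | h
        · exact absurd h.symm hpq
        · exact ⟨_, h⟩
        · exact ⟨_, h⟩
      obtain ⟨i, rfl⟩ := this
      by_cases hi : i.val < 3
      · exact ⟨(x, ⟨i, hi⟩), rfl⟩
      -- from its other end, the edge is seen in the opposite direction `i - 3`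
      · refine ⟨(x + hex m i, ⟨i - 3, by omega⟩), ?_⟩
        have : Fin.castLE (by omega : 3 ≤ 6) ⟨i.val - 3, by omega⟩ = i + 3 := by
          exact (by decide : ∀ (i : Fin 6) (h : i.val - 3 < 3) (h' : 3 ≤ 6), ¬ i.val < 3 →
            Fin.castLE h' ⟨i.val - 3, h⟩ = i + 3) i _ _ hi
        simp only [this, hex_add_three]
        rw [Finset.pair_comm]
        simp
    · rintro ⟨⟨x, i⟩, rfl⟩
      refine ⟨?_, Finset.card_pair (hne x _)⟩
      exact pair_mem (hexTriangle_mem F x (i.castLE (by omega))) (by simp [hexTriangle])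
        (by simp [hexTriangle])
  have h3 : {s | s ∈ gridComplex F ∧ s.card = 3} =
      Set.range fun x : Grid m × Fin 2 => hexTriangle F x.1 (x.2.castLE (by omega)) := by
    ext s
    constructor
    · rintro ⟨⟨-, x, i, h⟩, hc⟩
      obtain rfl := Finset.eq_of_subset_of_card_le h (by rw [hc, card_hexTriangle hF])
      -- one of the three vertices of the triangle sees it in the direction `0` or `1`
      have : i.val < 2 ∨ (i + 2).val < 2 ∨ (i + 4).val < 2 :=
        (by decide : ∀ i : Fin 6, i.val < 2 ∨ (i + 2).val < 2 ∨ (i + 4).val < 2) i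
      rcases this with h | h | h
      · exact ⟨(x, ⟨i, h⟩), rfl⟩
      · exact ⟨(x + hex m i, ⟨_, h⟩), hexTriangle_rotate F x i⟩
      · exact ⟨(x + hex m (i + 1), ⟨_, h⟩), hexTriangle_rotate' F x i⟩
    · rintro ⟨⟨x, i⟩, rfl⟩
      exact ⟨hexTriangle_mem F x _, card_hexTriangle hF x _⟩
  have same : ∀ x i j, hexTriangle F x i = hexTriangle F x j → i = j := by
    intro x i j h
    have ha : F (x + hex m i) ∈ hexTriangle F x j := by rw [← h]; simp [hexTriangle]
    have hb : F (x + hex m (i + 1)) ∈ hexTriangle F x j := by rw [← h]; simp [hexTriangle]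
    simp only [hexTriangle, Finset.mem_insert, Finset.mem_singleton, (hne x _).symm,
      false_or] at ha hb
    rcases ha with ha | ha
    · exact inj ha
    · have e1 := inj ha
      rcases hb with hb | hb
      · have e2 := inj hb
        subst e1
        exact absurd e2 ((by decide : ∀ j : Fin 6, j + 1 + 1 ≠ j) _)
      · exact add_right_cancel (inj hb)
  have i1 : Function.Injective fun x => ({F x} : Finset P) := fun x y h =>
    hF (Finset.singleton_injective h)
  have i2 : Function.Injective fun x : Grid m × Fin 3 =>
      ({F x.1, F (x.1 + hex m (x.2.castLE (by omega)))} : Finset P) := by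
    rintro ⟨x, i⟩ ⟨y, j⟩ h
    simp only at h
    have ha : F x ∈ ({F y, F (y + hex m (j.castLE (by omega)))} : Finset P) := by rw [← h]; simp
    have hb : F (x + hex m (i.castLE (by omega))) ∈
        ({F y, F (y + hex m (j.castLE (by omega)))} : Finset P) := by rw [← h]; simp
    simp only [Finset.mem_insert, Finset.mem_singleton] at ha hb
    rcases ha with ha | ha
    · obtain rfl := hF ha
      have := inj (hb.resolve_left (hne x _).symm)
      simp only [Fin.castLE_inj] at this
      rw [this]
    · obtain rfl := hF ha
      rcases hb with hb | hb
      · have h0 := hF hb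
        rw [add_assoc, add_eq_left, ← eq_neg_iff_add_eq_zero, ← hex_add_three] at h0
        exact absurd (hex_injective m h0) ((by decide : ∀ i j : Fin 3,
          Fin.castLE (Nat.le_add_left 3 3 : 3 ≤ 6) j ≠ Fin.castLE (Nat.le_add_left 3 3 : 3 ≤ 6) i + 3) i j)
      · exact absurd hb (hne _ _).symm
  have i3 : Function.Injective fun x : Grid m × Fin 2 =>
      hexTriangle F x.1 (x.2.castLE (by omega)) := by
    rintro ⟨x, i⟩ ⟨y, j⟩ h
    simp only at h
    have ha : F x ∈ hexTriangle F y (j.castLE (by omega)) := by rw [← h]; simp [hexTriangle]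
    simp only [hexTriangle, Finset.mem_insert, Finset.mem_singleton] at ha
    rcases ha with ha | ha | ha <;> obtain rfl := hF ha
    · have := same _ _ _ h
      simp only [Fin.castLE_inj] at this
      rw [this]
    · rw [← hexTriangle_rotate F y] at h
      exact absurd (same _ _ _ h) ((by decide : ∀ i j : Fin 2,
        Fin.castLE (Nat.le_add_left 2 4 : 2 ≤ 6) i ≠ Fin.castLE (Nat.le_add_left 2 4 : 2 ≤ 6) j + 2) i j)
    · rw [← hexTriangle_rotate' F y] at h
      exact absurd (same _ _ _ h) ((by decide : ∀ i j : Fin 2,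
        Fin.castLE (Nat.le_add_left 2 4 : 2 ≤ 6) i ≠ Fin.castLE (Nat.le_add_left 2 4 : 2 ≤ 6) j + 4) i j)
  rw [eulerChar, h1, h2, h3, Set.ncard_range_of_injective i1, Set.ncard_range_of_injective i2,
    Set.ncard_range_of_injective i3]
  simp only [Nat.card_eq_fintype_card, Fintype.card_prod, Fintype.card_fin]
  push_cast
  ring

lemma numComponents_bot : numComponents (⊥ : PreAbstractSimplicialComplex P) = 0 := by
  have : IsEmpty {p : P // {p} ∈ (⊥ : PreAbstractSimplicialComplex P)} := ⟨fun p => p.2⟩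
  have : IsEmpty (skeleton (⊥ : PreAbstractSimplicialComplex P)).ConnectedComponent :=
    ⟨fun c => c.ind fun v => isEmptyElim v⟩
  exact Nat.card_of_isEmpty

lemma genus_grid {F : Grid m → P} (hF : Function.Injective F) : genus (gridComplex F) = 1 := by
  rw [genus, if_pos (orientable_grid hF), eulerChar_grid hF, boundary_grid hF, numComponents_bot]
  rfl

end Grid

/-! ### The realization of a triangulated torus -/

section CycleSpace

/-- The realization of the cycle with `m + 3` vertices in barycentric coordinates. -/
def cycleSpace (m : ℕ) : Set (ZMod (m + 3) → ℝ) :=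
  {w | (∀ k, 0 ≤ w k) ∧ ∃ k, (∀ l, l ≠ k → l ≠ k + 1 → w l = 0) ∧ w k + w (k + 1) = 1}

/-- The tent function at the vertex `k` of the subdivided circle of length `m + 3`. -/
noncomputable def tent (m : ℕ) (θ : AddCircle ((m + 3 : ℕ) : ℝ)) (k : ZMod (m + 3)) : ℝ :=
  max 0 (1 - ‖θ - ((k.val : ℝ) : AddCircle ((m + 3 : ℕ) : ℝ))‖)

lemma continuous_tent (m : ℕ) : Continuous (tent m) := by
  unfold tent
  fun_prop

lemma coe_val_add (m : ℕ) (k : ZMod (m + 3)) (j : ℕ) :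
    (((k + (j : ZMod (m + 3))).val : ℝ) : AddCircle ((m + 3 : ℕ) : ℝ)) = ((k.val + j : ℝ)) := by
  obtain ⟨q, hq⟩ : ∃ q : ℕ, k.val + j = (k + (j : ZMod (m + 3))).val + q * (m + 3) := by
    have h := Nat.mod_add_div (k.val + j % (m + 3)) (m + 3)
    have h' := Nat.mod_add_div j (m + 3)
    rw [ZMod.val_add, ZMod.val_natCast]
    exact ⟨(k.val + j % (m + 3)) / (m + 3) + j / (m + 3), by linarith⟩
  have e : (k.val + j : ℝ) = (k + (j : ZMod (m + 3))).val + (q : ℤ) • (((m + 3 : ℕ) : ℝ)) := by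
    rw [zsmul_eq_mul, Int.cast_natCast]
    exact_mod_cast hq
  rw [e, AddCircle.coe_add, AddCircle.coe_zsmul, AddCircle.coe_period, smul_zero, add_zero]

/-- The value of the tent at the vertex `k + j` at a point of the edge between `k` and `k + 1`. -/
lemma tent_eq (m : ℕ) (k : ZMod (m + 3)) {s : ℝ} (h0 : 0 ≤ s) (h1 : s ≤ 1) (j : ℕ)
    (hj : j < m + 3) :
    tent m ((k.val + s : ℝ) : AddCircle ((m + 3 : ℕ) : ℝ)) (k + (j : ZMod (m + 3))) =
      if j = 0 then 1 - s else if j = 1 then s else 0 := by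
  have hm : (3 : ℝ) ≤ ((m + 3 : ℕ) : ℝ) := by push_cast; linarith [(Nat.cast_nonneg m : (0:ℝ) ≤ m)]
  have hpos : ((m + 3 : ℕ) : ℝ) ≠ 0 := by linarith
  rw [tent, coe_val_add, ← AddCircle.coe_sub,
    show (k.val + s : ℝ) - (k.val + j) = s - j by ring]
  by_cases hj0 : j = 0
  · rw [if_pos hj0, hj0, (AddCircle.norm_coe_eq_abs_iff _ hpos).mpr, Nat.cast_zero, sub_zero,
      abs_of_nonneg h0, max_eq_right (by linarith)]
    rw [Nat.cast_zero, sub_zero, abs_of_nonneg h0, abs_of_nonneg (by linarith)]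
    linarith
  rw [if_neg hj0]
  by_cases hj1 : j = 1
  · rw [if_pos hj1, hj1, (AddCircle.norm_coe_eq_abs_iff _ hpos).mpr, Nat.cast_one,
      abs_of_nonpos (by linarith), max_eq_right (by linarith)]
    · ring
    rw [Nat.cast_one, abs_of_nonpos (by linarith), abs_of_nonneg (by linarith)]
    linarith
  rw [if_neg hj1]
  refine max_eq_left ?_
  rw [AddCircle.norm_eq]
  generalize round ((((m + 3 : ℕ) : ℝ))⁻¹ * (s - j)) = z
  have hj2 : (2 : ℝ) ≤ j := by exact_mod_cast (by omega : 2 ≤ j)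
  have hj3 : (j : ℝ) + 1 ≤ ((m + 3 : ℕ) : ℝ) := by exact_mod_cast hj
  suffices 1 ≤ |s - j - z * ((m + 3 : ℕ) : ℝ)| by linarith
  rcases le_or_gt 0 z with hz | hz
  · have : (0 : ℝ) ≤ z := by exact_mod_cast hz
    rw [abs_of_nonpos] <;> nlinarith
  · have : (z : ℝ) ≤ -1 := by exact_mod_cast (by omega : z ≤ -1)
    rw [abs_of_nonneg] <;> nlinarith

lemma tent_left (m : ℕ) (k : ZMod (m + 3)) {s : ℝ} (h0 : 0 ≤ s) (h1 : s ≤ 1) :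
    tent m ((k.val + s : ℝ) : AddCircle ((m + 3 : ℕ) : ℝ)) k = 1 - s := by
  simpa using tent_eq m k h0 h1 0 (by omega)

lemma tent_right (m : ℕ) (k : ZMod (m + 3)) {s : ℝ} (h0 : 0 ≤ s) (h1 : s ≤ 1) :
    tent m ((k.val + s : ℝ) : AddCircle ((m + 3 : ℕ) : ℝ)) (k + 1) = s := by
  simpa using tent_eq m k h0 h1 1 (by omega)

lemma tent_off (m : ℕ) (k : ZMod (m + 3)) {s : ℝ} (h0 : 0 ≤ s) (h1 : s ≤ 1)
    {l : ZMod (m + 3)} (hl : l ≠ k) (hl' : l ≠ k + 1) :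
    tent m ((k.val + s : ℝ) : AddCircle ((m + 3 : ℕ) : ℝ)) l = 0 := by
  have e : l = k + (((l - k).val : ℕ) : ZMod (m + 3)) := by
    rw [ZMod.natCast_zmod_val]; abel
  have := tent_eq m k h0 h1 (l - k).val (ZMod.val_lt _)
  rw [← e, if_neg, if_neg] at this
  · exact this
  · intro h
    rw [h] at e
    exact hl' (by simpa using e)
  · intro h
    rw [h] at e
    exact hl (by simpa using e)

lemma tent_mem (m : ℕ) (k : ZMod (m + 3)) {s : ℝ} (h0 : 0 ≤ s) (h1 : s ≤ 1) :
    tent m ((k.val + s : ℝ) : AddCircle ((m + 3 : ℕ) : ℝ)) ∈ cycleSpace m := by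
  refine ⟨fun l => le_max_left _ _, k, fun l hl hl' => tent_off m k h0 h1 hl hl', ?_⟩
  rw [tent_left m k h0 h1, tent_right m k h0 h1]
  ring

instance (m : ℕ) : Fact (0 < ((m + 3 : ℕ) : ℝ)) := ⟨by positivity⟩

/-- Each point of the circle lies on an edge between consecutive vertices. -/
lemma exists_coordinate (m : ℕ) (θ : AddCircle ((m + 3 : ℕ) : ℝ)) :
    ∃ (k : ZMod (m + 3)) (s : ℝ), 0 ≤ s ∧ s < 1 ∧ θ = ((k.val + s : ℝ)) := by
  obtain ⟨t, ht, rfl⟩ := AddCircle.eq_coe_Ico θ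
  have hf : ⌊t⌋₊ < m + 3 := (Nat.floor_lt ht.1).mpr ht.2
  refine ⟨(⌊t⌋₊ : ZMod (m + 3)), t - ⌊t⌋₊, ?_, ?_, ?_⟩
  · linarith [Nat.floor_le ht.1]
  · linarith [Nat.lt_floor_add_one t]
  · rw [ZMod.val_natCast, Nat.mod_eq_of_lt hf]
    congr 1
    ring

/-- The realization of a cycle is a circle. -/
noncomputable def cycleSpaceHomeomorph (m : ℕ) : Circle ≃ₜ cycleSpace m := by
  have hmem : ∀ θ, tent m θ ∈ cycleSpace m := by
    intro θ
    obtain ⟨k, s, h0, h1, rfl⟩ := exists_coordinate m θ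
    exact tent_mem m k h0 h1.le
  let f : AddCircle ((m + 3 : ℕ) : ℝ) → cycleSpace m := fun θ => ⟨tent m θ, hmem θ⟩
  have hc : Continuous f := (continuous_tent m).subtype_mk hmem
  have hbij : Function.Bijective f := by
    constructor
    · intro θ θ' h
      have h' : tent m θ = tent m θ' := congrArg Subtype.val h
      obtain ⟨k, s, h0, h1, rfl⟩ := exists_coordinate m θ
      obtain ⟨k', s', h0', h1', rfl⟩ := exists_coordinate m θ'
      have e1 := congrFun h' k
      have e2 := congrFun h' (k + 1)
      have e3 := congrFun h' k'
      have e4 := congrFun h' (k' + 1)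
      rw [tent_left m k h0 h1.le] at e1
      rw [tent_right m k h0 h1.le] at e2
      rw [tent_left m k' h0' h1'.le] at e3
      rw [tent_right m k' h0' h1'.le] at e4
      by_cases hk : k = k'
      · subst hk
        rw [tent_left m k h0' h1'.le] at e1
        rw [show s = s' by linarith]
      · exfalso
        have h5 : k = k' + 1 := by
          by_contra h5
          rw [tent_off m k' h0' h1'.le hk h5] at e1
          linarith
        have h6 : k' = k + 1 := by
          by_contra h6
          rw [tent_off m k h0 h1.le (Ne.symm hk) h6] at e3
          linarith
        refine one_add_one_ne_zero_grid m ?_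
        have : k + (1 + 1) = k + 0 := by rw [← add_assoc, ← h6, ← h5, add_zero]
        exact add_left_cancel this
    · rintro ⟨w, hw, k, hoff, hsum⟩
      have h1 : w (k + 1) ≤ 1 := by linarith [hw k]
      refine ⟨((k.val + w (k + 1) : ℝ)), Subtype.ext (funext fun l => ?_)⟩
      change tent m _ l = w l
      by_cases hl : l = k
      · rw [hl, tent_left m k (hw _) h1]; linarith
      by_cases hl' : l = k + 1
      · rw [hl', tent_right m k (hw _) h1]
      rw [tent_off m k (hw _) h1 hl hl', hoff l hl hl']
  exact (AddCircle.homeomorphCircle (Fact.out : 0 < ((m + 3 : ℕ) : ℝ)).ne').symm.trans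
    (Continuous.homeoOfEquivCompactToT2 (f := Equiv.ofBijective f hbij) hc)

end CycleSpace

section Realization

variable {P : Type*}

/-- The realization of a finite complex is compact. -/
lemma isCompact_realization {S : PreAbstractSimplicialComplex P} (hS : S.faces.Finite) :
    IsCompact (realization S) := by
  have heq : realization S = ⋃ s ∈ S.faces,
      {x : P → ℝ | (∀ p, 0 ≤ x p) ∧ (∀ p, p ∉ s → x p = 0) ∧ ∑ p ∈ s, x p = 1} := by
    ext x
    simp only [realization, Set.mem_ofPred_eq, Set.mem_iUnion, exists_prop]
    constructor
    · rintro ⟨h0, s, hs, h1, h2⟩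
      exact ⟨s, hs, h0, h1, h2⟩
    · rintro ⟨s, hs, h0, h1, h2⟩
      exact ⟨h0, s, hs, h1, h2⟩
  rw [heq]
  refine hS.isCompact_biUnion fun s _ => ?_
  refine IsCompact.of_isClosed_subset
    (isCompact_univ_pi fun _ : P => isCompact_Icc (a := (0 : ℝ)) (b := 1)) ?_ ?_
  · simp only [Set.ofPred_and, Set.ofPred_forall]
    refine IsClosed.inter (isClosed_iInter fun p => ?_)
      (IsClosed.inter (isClosed_iInter fun p => isClosed_iInter fun _ => ?_) ?_)
    · exact isClosed_le continuous_const (continuous_apply p)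
    · exact isClosed_eq (continuous_apply p) continuous_const
    · exact isClosed_eq (continuous_finsetSum _ fun p _ => continuous_apply p) continuous_const
  · rintro x ⟨h0, h1, h2⟩ p -
    refine ⟨h0 p, ?_⟩
    by_cases hp : p ∈ s
    · rw [← h2]
      exact Finset.single_le_sum (fun q _ => h0 q) hp
    · rw [h1 p hp]
      exact zero_le_one

variable [DecidableEq P] {m : ℕ}

/-- A point of the realization of the torus lies in a unit square, on one side of its diagonal. -/
lemma mem_realization_grid {F : Grid m → P} (hF : Function.Injective F) (y : P → ℝ) :
    y ∈ realization (gridComplex F) ↔ (∀ p, 0 ≤ y p) ∧ ∃ j i,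
      (∀ p, p ≠ F (j, i) → p ≠ F (j + 1, i) → p ≠ F (j, i + 1) → p ≠ F (j + 1, i + 1) → y p = 0) ∧
      (y (F (j + 1, i)) = 0 ∨ y (F (j, i + 1)) = 0) ∧
      y (F (j, i)) + y (F (j + 1, i)) + y (F (j, i + 1)) + y (F (j + 1, i + 1)) = 1 := by
  have h1 := one_ne_zero_grid m
  have h3 : (1 : ZMod 3) ≠ 0 := one_ne_zero_grid 0
  constructor
  · rintro ⟨h0, s, ⟨-, x, i, hs⟩, hoff, hsum⟩
    refine ⟨h0, ?_⟩
    obtain ⟨x, i, hi, hs⟩ : ∃ x i, (i = 0 ∨ i = 1) ∧ s ⊆ hexTriangle F x i := by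
      have h6 := (by decide : ∀ i : Fin 6, (i = 0 ∨ i = 1) ∨ (i + 2 = 0 ∨ i + 2 = 1) ∨
        (i + 4 = 0 ∨ i + 4 = 1)) i
      rcases h6 with h | h | h
      · exact ⟨x, i, h, hs⟩
      · exact ⟨x + hex m i, i + 2, h, by rwa [hexTriangle_rotate]⟩
      · exact ⟨x + hex m (i + 1), i + 4, h, by rwa [hexTriangle_rotate']⟩
    have hoff' : ∀ p, p ∉ hexTriangle F x i → y p = 0 := fun p hp => hoff p fun h => hp (hs h)
    have hsum' : ∑ p ∈ hexTriangle F x i, y p = 1 := by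
      rw [← hsum]
      exact (Finset.sum_subset hs fun p _ hp => hoff p hp).symm
    obtain ⟨c1, c2, c3⟩ := ne_of_card_triple (card_hexTriangle hF x i)
    rw [hexTriangle, Finset.sum_insert (by
          simp only [Finset.mem_insert, Finset.mem_singleton, not_or]; exact ⟨c1, c2⟩), Finset.sum_pair c3] at hsum'
    obtain ⟨a, b⟩ := x
    rcases hi with rfl | rfl
    · simp only [hexTriangle, hex, Matrix.cons_val_zero, Fin.isValue, zero_add, Matrix.cons_val_one,
        Prod.mk_add_mk, add_zero, Finset.mem_insert, Finset.mem_singleton, not_or] at hoff' hsum'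
      have hz : y (F (a, b + 1)) = 0 := hoff' _
        ⟨fun h => h3 (by simpa using hF h), fun h => h1 (by simpa using hF h),
          fun h => h1 (by simpa using hF h)⟩
      exact ⟨a, b, fun p p1 p2 p3 p4 => hoff' p ⟨p1, p2, p4⟩, Or.inr hz, by rw [hz]; linarith⟩
    · simp only [hexTriangle, hex, Matrix.cons_val_one, Fin.isValue, Fin.reduceAdd, Matrix.cons_val,
        Prod.mk_add_mk, add_zero, Finset.mem_insert, Finset.mem_singleton, not_or] at hoff' hsum'
      have hz : y (F (a + 1, b)) = 0 := hoff' _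
        ⟨fun h => h1 (by simpa using hF h), fun h => h3 (by simpa using hF h),
          fun h => h1 (by simpa using hF h)⟩
      exact ⟨a, b, fun p p1 p2 p3 p4 => hoff' p ⟨p1, p4, p3⟩, Or.inl hz, by rw [hz]; linarith⟩
  · rintro ⟨h0, a, b, hoff, hz, hsum⟩
    refine ⟨h0, ?_⟩
    rcases hz with hz | hz
    · obtain ⟨c1, c2, c3⟩ := ne_of_card_triple (card_hexTriangle hF (a, b) 1)
      refine ⟨_, hexTriangle_mem F (a, b) 1, ?_, ?_⟩
      · intro p hp
        simp only [hexTriangle, hex, Matrix.cons_val_one, Fin.isValue, Fin.reduceAdd,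
          Matrix.cons_val, Prod.mk_add_mk, add_zero, Finset.mem_insert, Finset.mem_singleton,
          not_or] at hp
        by_cases h : p = F (a + 1, b)
        · rw [h, hz]
        · exact hoff p hp.1 h hp.2.2 hp.2.1
      · rw [hexTriangle, Finset.sum_insert (by
          simp only [Finset.mem_insert, Finset.mem_singleton, not_or]; exact ⟨c1, c2⟩), Finset.sum_pair c3]
        simp only [hex, Matrix.cons_val_one, Fin.isValue, Fin.reduceAdd, Matrix.cons_val,
          Prod.mk_add_mk, add_zero]
        linarith
    · obtain ⟨c1, c2, c3⟩ := ne_of_card_triple (card_hexTriangle hF (a, b) 0)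
      refine ⟨_, hexTriangle_mem F (a, b) 0, ?_, ?_⟩
      · intro p hp
        simp only [hexTriangle, hex, Matrix.cons_val_zero, Fin.isValue, zero_add,
          Matrix.cons_val_one, Prod.mk_add_mk, add_zero, Finset.mem_insert, Finset.mem_singleton,
          not_or] at hp
        by_cases h : p = F (a, b + 1)
        · rw [h, hz]
        · exact hoff p hp.1 hp.2.1 h hp.2.2
      · rw [hexTriangle, Finset.sum_insert (by
          simp only [Finset.mem_insert, Finset.mem_singleton, not_or]; exact ⟨c1, c2⟩), Finset.sum_pair c3]
        simp only [hex, Matrix.cons_val_zero, Fin.isValue, zero_add,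
          Matrix.cons_val_one, Prod.mk_add_mk, add_zero]
        linarith

/-- The total weights of the circles `{k} × ZMod 3`. -/
def columnWeight (F : Grid m → P) (y : P → ℝ) : ZMod (m + 3) → ℝ := fun k => ∑ l, y (F (k, l))

/-- The total weights of the circles `ZMod (m + 3) × {l}`. -/
def rowWeight (F : Grid m → P) (y : P → ℝ) : ZMod 3 → ℝ := fun l => ∑ k, y (F (k, l))

/-- The barycentric coordinate at `x` of the point with the given column and row weights. The formula
does not depend on the cell that contains the point. -/
noncomputable def coordinate (w : ZMod (m + 3) → ℝ) (v : ZMod 3 → ℝ) (x : Grid m) : ℝ :=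
  max 0 (min (min (w x.1) (v x.2))
    (1 - |(w (x.1 + 1) - w (x.1 - 1)) - (v (x.2 + 1) - v (x.2 - 1))|))

lemma sub_one_ne_add_one_grid (k : ZMod (m + 3)) : k - 1 ≠ k + 1 := fun h =>
  one_ne_neg_one_grid m (by
    rw [sub_eq_add_neg] at h
    exact (add_left_cancel h).symm)

/-- In a cell with corners of weights `y₀`, …, `y₃`, the formula recovers these four weights. -/
lemma coordinate_cell {w : ZMod (m + 3) → ℝ} {v : ZMod 3 → ℝ} {j : ZMod (m + 3)} {i : ZMod 3}
    {y₀ y₁ y₂ y₃ : ℝ} (h₀ : 0 ≤ y₀) (h₁ : 0 ≤ y₁) (h₂ : 0 ≤ y₂) (h₃ : 0 ≤ y₃)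
    (hz : y₁ = 0 ∨ y₂ = 0) (hsum : y₀ + y₁ + y₂ + y₃ = 1)
    (hw : ∀ k, k ≠ j → k ≠ j + 1 → w k = 0) (hv : ∀ l, l ≠ i → l ≠ i + 1 → v l = 0)
    (hw₀ : w j = y₀ + y₂) (hw₁ : w (j + 1) = y₁ + y₃)
    (hv₀ : v i = y₀ + y₁) (hv₁ : v (i + 1) = y₂ + y₃) :
    coordinate w v (j, i) = y₀ ∧ coordinate w v (j + 1, i) = y₁ ∧
      coordinate w v (j, i + 1) = y₂ ∧ coordinate w v (j + 1, i + 1) = y₃ := by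
  have n1 := one_ne_zero_grid m
  have a1 : w (j - 1) = 0 := hw _ (by simpa using n1) (sub_one_ne_add_one_grid j)
  have a2 : w (j + 1 + 1) = 0 := hw _
    (fun h => sub_one_ne_add_one_grid (m := m) (j + 1) (by rw [add_sub_cancel_right]; exact h.symm))
    (by simpa using n1)
  have b1 : v (i - 1) = 0 := hv _ (by simp) (sub_one_ne_add_one_grid (m := 0) i)
  have b2 : v (i + 1 + 1) = 0 := hv _
    (fun h => sub_one_ne_add_one_grid (m := 0) (i + 1) (by rw [add_sub_cancel_right]; exact h.symm))
    (by simp)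
  simp only [coordinate, add_sub_cancel_right, a1, a2, b1, b2, hw₀, hw₁, hv₀, hv₁, abs_eq_max_neg]
  rcases hz with rfl | rfl <;> refine ⟨?_, ?_, ?_, ?_⟩ <;>
    simp only [max_def, min_def] <;> split_ifs <;> linarith

lemma exists_cell {F : Grid m → P} (hF : Function.Injective F) {y : P → ℝ}
    (hy : y ∈ realization (gridComplex F)) : ∃ j i,
      (∀ k, k ≠ j → k ≠ j + 1 → columnWeight F y k = 0) ∧
      (∀ l, l ≠ i → l ≠ i + 1 → rowWeight F y l = 0) ∧
      columnWeight F y j = y (F (j, i)) + y (F (j, i + 1)) ∧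
      columnWeight F y (j + 1) = y (F (j + 1, i)) + y (F (j + 1, i + 1)) ∧
      rowWeight F y i = y (F (j, i)) + y (F (j + 1, i)) ∧
      rowWeight F y (i + 1) = y (F (j, i + 1)) + y (F (j + 1, i + 1)) ∧
      (y (F (j + 1, i)) = 0 ∨ y (F (j, i + 1)) = 0) ∧
      y (F (j, i)) + y (F (j + 1, i)) + y (F (j, i + 1)) + y (F (j + 1, i + 1)) = 1 := by
  obtain ⟨-, j, i, hoff, hz, hsum⟩ := (mem_realization_grid hF y).mp hy
  have n1 : j ≠ j + 1 := by simpa using one_ne_zero_grid m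
  have n3 : i ≠ i + 1 := by simp
  have hk : ∀ k l, k ≠ j → k ≠ j + 1 → y (F (k, l)) = 0 := fun k l h h' =>
    hoff _ (fun e => h (congrArg Prod.fst (hF e))) (fun e => h' (congrArg Prod.fst (hF e)))
      (fun e => h (congrArg Prod.fst (hF e))) (fun e => h' (congrArg Prod.fst (hF e)))
  have hl : ∀ k l, l ≠ i → l ≠ i + 1 → y (F (k, l)) = 0 := fun k l h h' =>
    hoff _ (fun e => h (congrArg Prod.snd (hF e))) (fun e => h (congrArg Prod.snd (hF e)))
      (fun e => h' (congrArg Prod.snd (hF e))) (fun e => h' (congrArg Prod.snd (hF e)))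
  refine ⟨j, i, fun k h h' => Finset.sum_eq_zero fun l _ => hk k l h h',
    fun l h h' => Finset.sum_eq_zero fun k _ => hl k l h h', ?_, ?_, ?_, ?_, hz, hsum⟩
  · exact Fintype.sum_eq_add _ _ n3 fun l h => hl j l h.1 h.2
  · exact Fintype.sum_eq_add _ _ n3 fun l h => hl _ l h.1 h.2
  · exact Fintype.sum_eq_add _ _ n1 fun k h => hk k i h.1 h.2
  · exact Fintype.sum_eq_add _ _ n1 fun k h => hk k _ h.1 h.2

lemma eq_coordinate {F : Grid m → P} (hF : Function.Injective F) {y : P → ℝ}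
    (hy : y ∈ realization (gridComplex F)) (x : Grid m) :
    y (F x) = coordinate (columnWeight F y) (rowWeight F y) x := by
  obtain ⟨j, i, hw, hv, hw0, hw1, hv0, hv1, hz, hsum⟩ := exists_cell hF hy
  obtain ⟨e0, e1, e2, e3⟩ := coordinate_cell (hy.1 _) (hy.1 _) (hy.1 _) (hy.1 _) hz hsum hw hv
    hw0 hw1 hv0 hv1
  obtain ⟨a, b⟩ := x
  have zero : ∀ c, (columnWeight F y a = 0 ∨ rowWeight F y b = 0) → max 0 (min
      (min (columnWeight F y a) (rowWeight F y b)) c) = 0 := by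
    intro c h
    refine max_eq_left ((min_le_left _ _).trans ?_)
    rcases h with h | h
    · exact (min_le_left _ _).trans h.le
    · exact (min_le_right _ _).trans h.le
  have le1 : y (F (a, b)) ≤ columnWeight F y a :=
    Finset.single_le_sum (f := fun l => y (F (a, l))) (fun l _ => hy.1 _) (Finset.mem_univ b)
  have le2 : y (F (a, b)) ≤ rowWeight F y b :=
    Finset.single_le_sum (f := fun k => y (F (k, b))) (fun l _ => hy.1 _) (Finset.mem_univ a)
  by_cases ha : a = j ∨ a = j + 1
  · by_cases hb : b = i ∨ b = i + 1
    · rcases ha with rfl | rfl <;> rcases hb with rfl | rfl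
      · exact e0.symm
      · exact e2.symm
      · exact e1.symm
      · exact e3.symm
    · push Not at hb
      have h := hv b hb.1 hb.2
      rw [coordinate, zero _ (Or.inr h)]
      exact le_antisymm (by linarith) (hy.1 _)
  · push Not at ha
    have h := hw a ha.1 ha.2
    rw [coordinate, zero _ (Or.inl h)]
    exact le_antisymm (by linarith) (hy.1 _)

lemma eq_zero_of_notMem_range {F : Grid m → P} {y : P → ℝ}
    (hy : y ∈ realization (gridComplex F)) {p : P} (hp : p ∉ Set.range F) : y p = 0 := by
  obtain ⟨-, s, hs, hoff, -⟩ := hy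
  refine hoff p fun h => hp ?_
  obtain ⟨x, rfl⟩ := exists_of_mem_face hs h
  exact ⟨x, rfl⟩

/-- The realization of the triangulated torus is the product of the realizations of two cycles: the
projection that forgets the position in the other direction is bijective. -/
lemma bijective_weights {F : Grid m → P} (hF : Function.Injective F) :
    ∃ f : realization (gridComplex F) → cycleSpace m × cycleSpace 0,
      Continuous f ∧ Function.Bijective f := by
  have hmem : ∀ y : realization (gridComplex F),
      columnWeight F y.1 ∈ cycleSpace m ∧ rowWeight F y.1 ∈ cycleSpace 0 := by
    rintro ⟨y, hy⟩
    obtain ⟨j, i, hw, hv, hw0, hw1, hv0, hv1, hz, hsum⟩ := exists_cell hF hy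
    exact ⟨⟨fun k => Finset.sum_nonneg fun l _ => hy.1 _, j, hw, by
        simp only at hw0 hw1 ⊢; linarith⟩,
      ⟨fun k => Finset.sum_nonneg fun l _ => hy.1 _, i, hv, by
        simp only at hv0 hv1 ⊢; linarith⟩⟩
  refine ⟨fun y => (⟨_, (hmem y).1⟩, ⟨_, (hmem y).2⟩), ?_, ?_, ?_⟩
  · refine Continuous.prodMk (Continuous.subtype_mk (continuous_pi fun k => ?_) _)
      (Continuous.subtype_mk (continuous_pi fun k => ?_) _)
    · exact continuous_finsetSum _ fun l _ => (continuous_apply _).comp continuous_subtype_val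
    · exact continuous_finsetSum _ fun l _ => (continuous_apply _).comp continuous_subtype_val
  · rintro ⟨y, hy⟩ ⟨y', hy'⟩ h
    simp only [Prod.mk.injEq, Subtype.mk.injEq] at h
    refine Subtype.ext (funext fun p => ?_)
    by_cases hp : p ∈ Set.range F
    · obtain ⟨x, rfl⟩ := hp
      change y (F x) = y' (F x)
      rw [eq_coordinate hF hy, eq_coordinate hF hy', h.1, h.2]
    · change y p = y' p
      rw [eq_zero_of_notMem_range hy hp, eq_zero_of_notMem_range hy' hp]
  · rintro ⟨⟨w, hw, j, hwoff, hwsum⟩, ⟨v, hv, i, hvoff, hvsum⟩⟩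
    have n1 : j ≠ j + 1 := by simpa using one_ne_zero_grid m
    have n3 : i ≠ i + 1 := by simp
    -- the weights of the four corners of a cell with the given column and row sums: the two corners
    -- outside the diagonal get as little weight as possible, so that one of them gets none
    let g : Grid m → ℝ := fun x =>
      if x = (j, i) then min (w j) (v i)
      else if x = (j + 1, i) then w (j + 1) - min (w (j + 1)) (v (i + 1))
      else if x = (j, i + 1) then v (i + 1) - min (w (j + 1)) (v (i + 1))
      else if x = (j + 1, i + 1) then min (w (j + 1)) (v (i + 1)) else 0
    have g0 : g (j, i) = min (w j) (v i) := if_pos rfl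
    have g1 : g (j + 1, i) = w (j + 1) - min (w (j + 1)) (v (i + 1)) := by
      simp [g, n1.symm]
    have g2 : g (j, i + 1) = v (i + 1) - min (w (j + 1)) (v (i + 1)) := by
      simp [g, n1, n3.symm]
    have g3 : g (j + 1, i + 1) = min (w (j + 1)) (v (i + 1)) := by
      simp [g, n1.symm, n3.symm]
    have gnn : ∀ x, 0 ≤ g x := by
      intro x
      simp only [g]
      split_ifs
      · exact le_min (hw _) (hv _)
      · exact sub_nonneg.mpr (min_le_left _ _)
      · exact sub_nonneg.mpr (min_le_right _ _)
      · exact le_min (hw _) (hv _)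
      · exact le_rfl
    let y : P → ℝ := Function.extend F g 0
    have hyF : ∀ x, y (F x) = g x := fun x => hF.extend_apply g 0 x
    have hmin : min (w j) (v i) = 1 - max (w (j + 1)) (v (i + 1)) := by
      rw [show w j = 1 - w (j + 1) by linarith, show v i = 1 - v (i + 1) by linarith, min_sub_sub_left]
    have hmm := min_add_max (w (j + 1)) (v (i + 1))
    have hy : y ∈ realization (gridComplex F) := by
      refine (mem_realization_grid hF y).mpr ⟨fun p => ?_, j, i, fun p p0 p1 p2 p3 => ?_, ?_, ?_⟩
      · by_cases hp : p ∈ Set.range F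
        · obtain ⟨x, rfl⟩ := hp
          rw [hyF]; exact gnn x
        · exact (Function.extend_apply' g (0 : P → ℝ) p hp).ge
      · by_cases hp : p ∈ Set.range F
        · obtain ⟨x, rfl⟩ := hp
          rw [hyF]
          simp only [g]
          rw [if_neg (fun h => p0 (by rw [h])), if_neg (fun h => p1 (by rw [h])),
            if_neg (fun h => p2 (by rw [h])), if_neg (fun h => p3 (by rw [h]))]
        · exact Function.extend_apply' g (0 : P → ℝ) p hp
      · rw [hyF, hyF, g1, g2]
        rcases min_choice (w (j + 1)) (v (i + 1)) with h | h
        · left; linarith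
        · right; linarith
      · rw [hyF, hyF, hyF, hyF, g0, g1, g2, g3, hmin]
        linarith
    have goff : ∀ k l, (k ≠ j ∧ k ≠ j + 1) ∨ (l ≠ i ∧ l ≠ i + 1) → g (k, l) = 0 := by
      intro k l h
      simp only [g, Prod.mk.injEq]
      rw [if_neg (by tauto), if_neg (by tauto), if_neg (by tauto), if_neg (by tauto)]
    refine ⟨⟨y, hy⟩, Prod.ext (Subtype.ext (funext fun k => ?_)) (Subtype.ext (funext fun l => ?_))⟩
    · change columnWeight F y k = w k
      rw [columnWeight]
      simp only [hyF]
      by_cases hk : k = j ∨ k = j + 1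
      · have e := Fintype.sum_eq_add (f := fun l => g (k, l)) _ _ n3
          fun l h => goff k l (Or.inr h)
        rw [e]
        rcases hk with rfl | rfl
        · rw [g0, g2, hmin]; linarith
        · rw [g1, g3]; linarith
      · push Not at hk
        rw [hwoff k hk.1 hk.2]
        exact Finset.sum_eq_zero fun l _ => goff k l (Or.inl hk)
    · change rowWeight F y l = v l
      rw [rowWeight]
      simp only [hyF]
      by_cases hl : l = i ∨ l = i + 1
      · have e := Fintype.sum_eq_add (f := fun k => g (k, l)) _ _ n1
          fun k h => goff k l (Or.inl h)
        rw [e]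
        rcases hl with rfl | rfl
        · rw [g0, g1, hmin]; linarith
        · rw [g2, g3]; linarith
      · push Not at hl
        rw [hvoff l hl.1 hl.2]
        exact Finset.sum_eq_zero fun k _ => goff k l (Or.inr hl)

lemma isTorus_grid {F : Grid m → P} (hF : Function.Injective F) : IsTorus (gridComplex F) := by
  obtain ⟨f, hf, hbij⟩ := bijective_weights hF
  have := isCompact_iff_compactSpace.mp (isCompact_realization (isSurface_grid hF).finite)
  exact ⟨(Continuous.homeoOfEquivCompactToT2 (f := Equiv.ofBijective f hbij) hf).trans
    ((cycleSpaceHomeomorph m).symm.prodCongr (cycleSpaceHomeomorph 0).symm)⟩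

end Realization

/-! ### Connected components and disjoint unions -/

section Components

variable {P : Type*} [DecidableEq P] {S : PreAbstractSimplicialComplex P}

lemma component_le (c : (skeleton S).ConnectedComponent) : component S c ≤ S := fun _ h => h.1

lemma mem_component_of_mem {s : Finset P} (hs : s ∈ S) {p : P} (hp : p ∈ s) (h : {p} ∈ S) :
    s ∈ component S ((skeleton S).connectedComponentMk ⟨p, h⟩) := by
  refine ⟨hs, fun q hq => ⟨vertex_mem hs hq, ?_⟩⟩
  by_cases hpq : p = q
  · subst hpq; rfl
  · have hadj : (skeleton S).Adj ⟨p, h⟩ ⟨q, vertex_mem hs hq⟩ :=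
      ⟨fun h => hpq (congrArg Subtype.val h), pair_mem hs hp hq⟩
    exact (SimpleGraph.ConnectedComponent.sound hadj.reachable).symm

lemma component_unique {c d : (skeleton S).ConnectedComponent} {s t : Finset P} {p : P}
    (hs : s ∈ component S c) (ht : t ∈ component S d) (hps : p ∈ s) (hpt : p ∈ t) : c = d := by
  obtain ⟨h, rfl⟩ := hs.2 p hps
  obtain ⟨h', rfl⟩ := ht.2 p hpt
  rfl

lemma mem_component_iff_of_common {c : (skeleton S).ConnectedComponent} {s t : Finset P} {p : P}
    (hs : s ∈ component S c) (hps : p ∈ s) (hpt : p ∈ t) : t ∈ component S c ↔ t ∈ S := by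
  refine ⟨fun h => h.1, fun h => ?_⟩
  obtain ⟨hp, rfl⟩ := hs.2 p hps
  exact mem_component_of_mem h hpt hp

lemma exists_component {s : Finset P} (hs : s ∈ S) : ∃ c, s ∈ component S c := by
  obtain ⟨p, hp⟩ := face_nonempty hs
  exact ⟨_, mem_component_of_mem hs hp (vertex_mem hs hp)⟩

lemma exists_vertex_mem_component (c : (skeleton S).ConnectedComponent) :
    ∃ p, {p} ∈ component S c := by
  induction c using SimpleGraph.ConnectedComponent.ind with
  | h v => exact ⟨v.1, mem_component_of_mem v.2 (Finset.mem_singleton_self _) v.2⟩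

lemma vertexLink_component {c : (skeleton S).ConnectedComponent} {p : P}
    (hp : {p} ∈ component S c) : vertexLink (component S c) p = vertexLink S p := by
  ext t
  rw [mem_vertexLink, mem_vertexLink, mem_component_iff_of_common hp
    (Finset.mem_singleton_self p) (Finset.mem_insert_self p t)]

lemma isClosedSurface_component (hS : IsSurface S) (hb : boundary S = ⊥)
    (c : (skeleton S).ConnectedComponent) : IsClosedSurface (component S c) where
  isSurface :=
    { finite := hS.finite.subset fun _ h => h.1
      dim_le := fun s hs => hS.dim_le s hs.1
      pure := by
        intro s hs
        obtain ⟨t, ht, hst, hc⟩ := hS.pure s hs.1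
        obtain ⟨p, hp⟩ := face_nonempty hs.1
        exact ⟨t, (mem_component_iff_of_common hs hp (hst hp)).mpr ht, hst, hc⟩
      link := by
        intro p hp
        rw [vertexLink_component hp]
        exact hS.link p hp.1 }
  boundary_eq := by
    refine boundary_eq_bot_of_link fun p hp => ?_
    rw [vertexLink_component hp]
    exact isSimpleCycle_link hS hb hp.1
  ne_bot h := by
    obtain ⟨p, hp⟩ := exists_vertex_mem_component c
    rw [h] at hp
    exact hp

lemma isConnected_component (c : (skeleton S).ConnectedComponent) :
    IsConnected (component S c) := by
  have key : ∀ (u v : {p : P // {p} ∈ S}) (_ : (skeleton S).Walk u v)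
      (hu : {u.1} ∈ component S c), ∃ hv : {v.1} ∈ component S c,
      (skeleton (component S c)).Reachable ⟨u.1, hu⟩ ⟨v.1, hv⟩ := by
    intro u v w
    induction w with
    | nil => exact fun hu => ⟨hu, SimpleGraph.Reachable.refl _⟩
    | @cons a b d hab w ih =>
      intro ha
      have hpair : {a.1, b.1} ∈ component S c :=
        (mem_component_iff_of_common ha (Finset.mem_singleton_self _) (by simp)).mpr hab.2
      have hb := vertex_mem hpair (p := b.1) (by simp)
      obtain ⟨hd, hr⟩ := ih hb
      exact ⟨hd, SimpleGraph.Reachable.trans (SimpleGraph.Adj.reachable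
        ⟨fun h => hab.1 (Subtype.ext (Subtype.mk.inj h)), hpair⟩) hr⟩
  obtain ⟨p₀, hp₀⟩ := exists_vertex_mem_component c
  refine { preconnected := ?_, nonempty := ⟨⟨p₀, hp₀⟩⟩ }
  rintro ⟨p, hp⟩ ⟨q, hq⟩
  obtain ⟨h, e⟩ := hp.2 p (Finset.mem_singleton_self p)
  obtain ⟨h', e'⟩ := hq.2 q (Finset.mem_singleton_self q)
  obtain ⟨w⟩ := SimpleGraph.ConnectedComponent.exact (e.trans e'.symm)
  exact (key _ _ w hp).2

/-- A set of vertices of a connected complex that is closed under adjacency contains all vertices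
as soon as it contains one. -/
lemma IsConnected.mem_of_closed (hS : IsConnected S) (A : Set P) {p₀ : P} (h₀ : {p₀} ∈ S)
    (hp₀ : p₀ ∈ A) (hA : ∀ p q, p ∈ A → {p, q} ∈ S → q ∈ A) {q : P} (hq : {q} ∈ S) : q ∈ A := by
  obtain ⟨w⟩ := hS.preconnected ⟨p₀, h₀⟩ ⟨q, hq⟩
  have key : ∀ (u v : {p : P // {p} ∈ S}) (_ : (skeleton S).Walk u v), u.1 ∈ A → v.1 ∈ A := by
    intro u v w
    induction w with
    | nil => exact id
    | cons hab w ih => exact fun h => ih (hA _ _ h hab.2)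
  exact key _ _ w hp₀

lemma finite_components (hS : S.faces.Finite) : Finite (skeleton S).ConnectedComponent := by
  have : Finite {p : P // {p} ∈ S} := by
    have : Function.Injective fun p : {p : P // {p} ∈ S} => (⟨{p.1}, p.2⟩ : S.faces) :=
      fun p q h => Subtype.ext (Finset.singleton_injective (congrArg Subtype.val h))
    have := hS.to_subtype
    exact Finite.of_injective _ ‹Function.Injective _›
  exact Quot.finite _

variable {ι : Type*}

omit [DecidableEq P] in
lemma mem_iSup_complex {T : ι → PreAbstractSimplicialComplex P} {s : Finset P} :
    s ∈ ⨆ i, T i ↔ ∃ i, s ∈ T i := by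
  change s ∈ ⋃ K ∈ Set.range T, K.faces ↔ _
  simp only [Set.mem_iUnion, Set.mem_range, exists_prop, exists_exists_eq_and]
  rfl

omit [DecidableEq P] in
lemma eq_of_common_vertex {T : ι → PreAbstractSimplicialComplex P}
    (hT : Pairwise fun i j => Disjoint (T i).faces (T j).faces) {i j : ι} {s t : Finset P} {p : P}
    (hs : s ∈ T i) (ht : t ∈ T j) (hps : p ∈ s) (hpt : p ∈ t) : i = j := by
  by_contra h
  exact Set.disjoint_left.mp (hT h) (vertex_mem hs hps) (vertex_mem ht hpt)

lemma isSurface_iSup [Finite ι] {T : ι → PreAbstractSimplicialComplex P}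
    (hT : Pairwise fun i j => Disjoint (T i).faces (T j).faces)
    (hS : ∀ i, IsClosedSurface (T i)) : IsSurface (⨆ i, T i) ∧ boundary (⨆ i, T i) = ⊥ := by
  have hlink : ∀ p, {p} ∈ ⨆ i, T i → IsSimpleCycle (vertexLink (⨆ i, T i) p) := by
    intro p hp
    obtain ⟨i, hi⟩ := mem_iSup_complex.mp hp
    have e : vertexLink (⨆ i, T i) p = vertexLink (T i) p := by
      ext t
      rw [mem_vertexLink, mem_vertexLink, mem_iSup_complex]
      refine and_congr_right fun _ => and_congr_right fun _ => ⟨?_, fun h => ⟨i, h⟩⟩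
      rintro ⟨j, hj⟩
      rwa [eq_of_common_vertex hT hi hj (Finset.mem_singleton_self p) (Finset.mem_insert_self p t)]
    rw [e]
    exact isSimpleCycle_link (hS i).isSurface (hS i).boundary_eq hi
  refine ⟨⟨?_, ?_, ?_, fun p hp => Or.inr (hlink p hp)⟩, boundary_eq_bot_of_link hlink⟩
  · refine (Set.finite_iUnion fun i => (hS i).isSurface.finite).subset fun s hs => ?_
    exact Set.mem_iUnion.mpr (mem_iSup_complex.mp hs)
  · intro s hs
    obtain ⟨i, hi⟩ := mem_iSup_complex.mp hs
    exact (hS i).isSurface.dim_le s hi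
  · intro s hs
    obtain ⟨i, hi⟩ := mem_iSup_complex.mp hs
    obtain ⟨t, ht, h⟩ := (hS i).isSurface.pure s hi
    exact ⟨t, mem_iSup_complex.mpr ⟨i, ht⟩, h⟩

lemma numComponents_iSup {T : ι → PreAbstractSimplicialComplex P}
    (hT : Pairwise fun i j => Disjoint (T i).faces (T j).faces)
    (hS : ∀ i, IsConnected (T i)) : numComponents (⨆ i, T i) = Nat.card ι := by
  have hv : ∀ p : {p : P // {p} ∈ ⨆ i, T i}, ∃ i, {p.1} ∈ T i := fun p => mem_iSup_complex.mp p.2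
  choose f hf using hv
  have hadj : ∀ p q, (skeleton (⨆ i, T i)).Adj p q → f p = f q := by
    rintro p q ⟨-, h⟩
    obtain ⟨j, hj⟩ := mem_iSup_complex.mp h
    rw [eq_of_common_vertex hT (hf p) hj (Finset.mem_singleton_self _) (by simp),
      eq_of_common_vertex hT (hf q) hj (Finset.mem_singleton_self _) (by simp)]
  have hwalk : ∀ p q (_ : (skeleton (⨆ i, T i)).Walk p q), f p = f q := by
    intro p q w
    induction w with
    | nil => rfl
    | cons h _ ih => exact (hadj _ _ h).trans ih
  let g : (skeleton (⨆ i, T i)).ConnectedComponent → ι :=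
    SimpleGraph.ConnectedComponent.lift f fun p q w _ => hwalk p q w
  refine Nat.card_congr (Equiv.ofBijective g ⟨?_, ?_⟩)
  · intro c d
    induction c using SimpleGraph.ConnectedComponent.ind with | h p => ?_
    induction d using SimpleGraph.ConnectedComponent.ind with | h q => ?_
    intro h
    change f p = f q at h
    have hq := hf q
    rw [← h] at hq
    refine SimpleGraph.ConnectedComponent.sound ?_
    let hom : skeleton (T (f p)) →g skeleton (⨆ i, T i) :=
      { toFun := fun v => ⟨v.1, mem_iSup_complex.mpr ⟨_, v.2⟩⟩
        map_rel' := fun {a b} hab => ⟨fun h => hab.1 (Subtype.ext (Subtype.mk.inj h)),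
          mem_iSup_complex.mpr ⟨_, hab.2⟩⟩ }
    exact ((hS (f p)).preconnected ⟨p.1, hf p⟩ ⟨q.1, hq⟩).map hom
  · intro i
    obtain ⟨v⟩ := (hS i).nonempty
    refine ⟨(skeleton _).connectedComponentMk ⟨v.1, mem_iSup_complex.mpr ⟨i, v.2⟩⟩, ?_⟩
    exact eq_of_common_vertex hT (hf _) v.2 (Finset.mem_singleton_self _)
      (Finset.mem_singleton_self _)

lemma totalGenus_eq (hS : S.faces.Finite) (ho : ∀ c, Orientable (component S c))
    (hg : ∀ c, genus (component S c) = 1) : totalGenus S = numComponents S := by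
  have := finite_components hS
  have := Fintype.ofFinite (skeleton S).ConnectedComponent
  have hne : ¬ ∃ d, ¬ Orientable (component S d) := fun ⟨d, hd⟩ => hd (ho d)
  simp only [totalGenus, hne, and_false, if_false, hg, numComponents]
  rw [finsum_eq_sum_of_fintype]
  simp

/-- The realization is the disjoint union of the realizations of the components. -/
lemma realization_homeomorph (hS : S.faces.Finite) (ht : ∀ c, IsTorus (component S c)) :
    Nonempty (realization S ≃ₜ Fin (numComponents S) × Torus) := by
  have := finite_components hS
  let e : (skeleton S).ConnectedComponent ≃ Fin (numComponents S) := Finite.equivFin _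
  let h := fun c => (ht c).some
  have hle : ∀ c, realization (component S c) ⊆ realization S := by
    rintro c x ⟨h0, s, hs, hx⟩
    exact ⟨h0, s, hs.1, hx⟩
  let f : Fin (numComponents S) × Torus → realization S :=
    fun x => ⟨((h (e.symm x.1)).symm x.2).1, hle _ ((h (e.symm x.1)).symm x.2).2⟩
  have hc : Continuous f := by
    refine Continuous.subtype_mk (continuous_prod_of_discrete_left.mpr fun i => ?_) _
    exact continuous_subtype_val.comp (h (e.symm i)).symm.continuous
  have hbij : Function.Bijective f := by
    constructor
    · rintro ⟨i, x⟩ ⟨j, y⟩ hxy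
      have hxy' : ((h (e.symm i)).symm x).1 = ((h (e.symm j)).symm y).1 := congrArg Subtype.val hxy
      obtain ⟨s, hs, hs1, hs2⟩ := ((h (e.symm i)).symm x).2.2
      obtain ⟨t, ht, ht1, -⟩ := ((h (e.symm j)).symm y).2.2
      obtain ⟨p, hp, hp0⟩ : ∃ p ∈ s, ((h (e.symm i)).symm x).1 p ≠ 0 := by
        by_contra! hall
        rw [Finset.sum_eq_zero hall] at hs2
        exact zero_ne_one hs2
      have hpt : p ∈ t := by
        by_contra hpt
        exact hp0 (by rw [hxy']; exact ht1 p hpt)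
      have hij : i = j := e.symm.injective (component_unique hs ht hp hpt)
      subst hij
      have := (h (e.symm i)).symm.injective (Subtype.ext hxy')
      rw [this]
    · rintro ⟨x, h0, s, hs, hx⟩
      obtain ⟨c, hc⟩ := exists_component hs
      refine ⟨(e c, h (e.symm (e c)) ⟨x, ?_⟩), ?_⟩
      · rw [e.symm_apply_apply]
        exact ⟨h0, s, hc, hx⟩
      · simp [f]
  exact ⟨(Continuous.homeoOfEquivCompactToT2 (f := Equiv.ofBijective f hbij) hc).symm⟩

lemma card_le_of_homeomorph {k l : ℕ} (h : Fin k × Torus ≃ₜ Fin l × Torus) : k ≤ l := by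
  have hinj : Function.Injective fun i : Fin k => (h (i, 1)).1 := by
    intro i j hij
    have hc : Continuous fun τ : Torus => (h.symm ((h (i, 1)).1, τ)).1 := by fun_prop
    have := PreconnectedSpace.constant (α := Torus) inferInstance hc
      (x := (h (i, 1)).2) (y := (h (j, 1)).2)
    have hij' : (h (i, 1)).1 = (h (j, 1)).1 := hij
    nth_rewrite 2 [hij'] at this
    simpa using this
  simpa using Fintype.card_le_of_injective _ hinj

end Components

/-! ### Systems of hoops -/

section Orbits

variable {H : Type*}

/-- A self-map of a finite set has a periodic point. -/
lemma exists_periodic {U : Set H} (hU : U.Finite) {σ : H → H} (hσ : Set.MapsTo σ U U)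
    {c : H} (hc : c ∈ U) : ∃ y ∈ U, y ∈ Function.periodicPts σ := by
  have hit : ∀ k, σ^[k] c ∈ U := fun k => hσ.iterate k hc
  have := hU.to_subtype
  obtain ⟨a, b, hab, h⟩ := Finite.exists_ne_map_eq_of_infinite
    fun k : ℕ => (⟨σ^[k] c, hit k⟩ : U)
  wlog hlt : a < b generalizing a b
  · exact this b a hab.symm h.symm (lt_of_le_of_ne (not_lt.mp hlt) hab.symm)
  have h' : σ^[a] c = σ^[b] c := congrArg Subtype.val h
  refine ⟨σ^[a] c, hit a, Function.mk_mem_periodicPts (n := b - a) (by omega) ?_⟩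
  rw [Function.IsPeriodicPt, Function.IsFixedPt, ← Function.iterate_add_apply,
    Nat.sub_add_cancel hlt.le, h']

/-- The orbit of a periodic point, enumerated cyclically. -/
lemma exists_cyclic_enumeration {σ : H → H} {y : H} (hy : y ∈ Function.periodicPts σ) :
    ∃ (n : ℕ) (h : Fin (n + 1) → H), Function.Injective h ∧ h 0 = y ∧
      ∀ j, h (j + 1) = σ (h j) := by
  obtain ⟨n, hn⟩ := Nat.exists_eq_add_one.mpr (Function.minimalPeriod_pos_of_mem_periodicPts hy)
  refine ⟨n, fun j => σ^[j.val] y, ?_, rfl, fun j => ?_⟩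
  · intro i j hij
    refine Fin.ext ((Function.iterate_eq_iterate_iff_of_lt_minimalPeriod ?_ ?_).mp hij)
    · rw [hn]; exact i.2
    · rw [hn]; exact j.2
  · simp only
    have := Function.iterate_mod_minimalPeriod_eq (f := σ) (x := y) (n := j.val + 1)
    rw [hn] at this
    rw [← Function.iterate_succ_apply' σ, Fin.val_add, Fin.val_one', Nat.add_mod_mod]
    exact this

lemma exists_cyclic_enumeration_of_ne {σ : H → H} {y : H} (hy : y ∈ Function.periodicPts σ)
    (h₁ : σ y ≠ y) (h₂ : σ (σ y) ≠ y) :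
    ∃ (m : ℕ) (h : ZMod (m + 3) → H), Function.Injective h ∧ h 0 = y ∧
      ∀ j, h (j + 1) = σ (h j) := by
  obtain ⟨n, h, hinj, h0, hstep⟩ := exists_cyclic_enumeration hy
  obtain _ | _ | m := n
  · exact absurd (by rw [← h0, ← hstep]; rfl) h₁
  · exact absurd (by rw [← h0, ← hstep, ← hstep]; rfl) h₂
  · exact ⟨m, h, hinj, h0, hstep⟩

end Orbits

/-- Circles with three vertices that are joined by cylinders. The circles may have vertices in
common, but there is no edge that lies in two cylinders unless it lies on a common hoop. -/
structure HoopSystem (H : Type*) (P : Type*) where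
  /-- There is a cylinder from the first hoop to the second one. -/
  Next : H → H → Prop
  /-- The vertices of a hoop. -/
  circ : H → Fin 3 → P
  next_ne : ∀ {c d}, Next c d → c ≠ d
  next_asymm : ∀ {c d}, Next c d → ¬ Next d c
  edge_injective : ∀ {a b a' b' c d c' d' : H} {i j i' j' : Fin 3},
    Next a b → (c = a ∨ c = b) → (d = a ∨ d = b) →
    Next a' b' → (c' = a' ∨ c' = b') → (d' = a' ∨ d' = b') →
    (c, i) ≠ (d, j) → circ c i = circ c' i' → circ d j = circ d' j' →
    (c, i) = (c', i') ∧ (d, j) = (d', j')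

namespace HoopSystem

variable {H P : Type*} [DecidableEq P] (X : HoopSystem H P)

/-- Two hoops are the ends of a common cylinder, or they coincide. -/
def Near (c d : H) : Prop := ∃ a b, X.Next a b ∧ (c = a ∨ c = b) ∧ (d = a ∨ d = b)

/-- The triangle of a cylinder with an edge on the first circle. -/
def upper (c d : H) (i : Fin 3) : Finset P := {X.circ c i, X.circ c (i + 1), X.circ d (i + 1)}

/-- The triangle of a cylinder with an edge on the second circle. -/
def lower (c d : H) (i : Fin 3) : Finset P := {X.circ c i, X.circ d i, X.circ d (i + 1)}

/-- The union of all cylinders. -/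
def complex : PreAbstractSimplicialComplex P where
  faces := {s | s.Nonempty ∧ ∃ c d i, X.Next c d ∧ (s ⊆ X.upper c d i ∨ s ⊆ X.lower c d i)}
  isRelLowerSet_faces := by
    rintro s ⟨hs, c, d, i, h, h'⟩
    exact ⟨hs, fun r hr hr' => ⟨hr', c, d, i, h, h'.imp hr.trans hr.trans⟩⟩

variable {X}

omit [DecidableEq P] in
lemma Near.symm {c d : H} (h : X.Near c d) : X.Near d c := by
  obtain ⟨a, b, h1, h2, h3⟩ := h
  exact ⟨a, b, h1, h3, h2⟩

omit [DecidableEq P] in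
lemma near_of_next {c d : H} (h : X.Next c d) : X.Near c d := ⟨c, d, h, Or.inl rfl, Or.inr rfl⟩

omit [DecidableEq P] in
lemma Near.edge_injective {c d c' d' : H} {i j i' j' : Fin 3} (h : X.Near c d)
    (h' : X.Near c' d') (hne : (c, i) ≠ (d, j)) (h1 : X.circ c i = X.circ c' i')
    (h2 : X.circ d j = X.circ d' j') : (c, i) = (c', i') ∧ (d, j) = (d', j') := by
  obtain ⟨a, b, g1, g2, g3⟩ := h
  obtain ⟨a', b', g1', g2', g3'⟩ := h'
  exact X.edge_injective g1 g2 g3 g1' g2' g3' hne h1 h2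

omit [DecidableEq P] in
lemma Near.circ_injective {c d : H} {i j : Fin 3} (h : X.Near c d)
    (h1 : X.circ c i = X.circ d j) : (c, i) = (d, j) := by
  by_contra hne
  exact hne (h.edge_injective h.symm hne h1 h1.symm).1

lemma card_upper {c d : H} (h : X.Next c d) (i : Fin 3) : (X.upper c d i).card = 3 := by
  have hcc : X.Near c c := ⟨c, d, h, Or.inl rfl, Or.inl rfl⟩
  refine Finset.card_eq_three.mpr ⟨_, _, _, ?_, ?_, ?_, rfl⟩
  · intro e; simpa using hcc.circ_injective e
  · intro e; exact X.next_ne h (congrArg Prod.fst ((near_of_next h).circ_injective e))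
  · intro e; exact X.next_ne h (congrArg Prod.fst ((near_of_next h).circ_injective e))

lemma card_lower {c d : H} (h : X.Next c d) (i : Fin 3) : (X.lower c d i).card = 3 := by
  have hdd : X.Near d d := ⟨c, d, h, Or.inr rfl, Or.inr rfl⟩
  refine Finset.card_eq_three.mpr ⟨_, _, _, ?_, ?_, ?_, rfl⟩
  · intro e; exact X.next_ne h (congrArg Prod.fst ((near_of_next h).circ_injective e))
  · intro e; exact X.next_ne h (congrArg Prod.fst ((near_of_next h).circ_injective e))
  · intro e; simpa using hdd.circ_injective e

/-- `T` consists of the vertices of the upper or of the lower triangle number `k` between `a` and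
`b`, regarded as vertices of the disjoint union of all hoops. -/
def IsFormalTriangle (a b : H) (k : Fin 3) (T : Set (H × Fin 3)) : Prop :=
  T = {(a, k), (a, k + 1), (b, k + 1)} ∨ T = {(a, k), (b, k), (b, k + 1)}

omit [DecidableEq P] in
lemma IsFormalTriangle.near {a b : H} (hab : X.Next a b) {k : Fin 3} {T : Set (H × Fin 3)}
    (hT : IsFormalTriangle a b k T) {x y : H × Fin 3} (hx : x ∈ T) (hy : y ∈ T) :
    X.Near x.1 y.1 := by
  have key : ∀ z ∈ T, z.1 = a ∨ z.1 = b := by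
    intro z hz
    rcases hT with rfl | rfl <;> rcases hz with rfl | rfl | rfl <;> simp
  exact ⟨a, b, hab, key x hx, key y hy⟩

/-- A triangle that contains a given edge comes from a triangle of the disjoint union of the hoops
that contains this edge. -/
lemma exists_formalTriangle {c d : H} {i j : Fin 3} (hcd : X.Near c d) (hne : (c, i) ≠ (d, j))
    {z : P} (h : {X.circ c i, X.circ d j, z} ∈ X.complex) :
    ∃ a b k T, X.Next a b ∧ IsFormalTriangle a b k T ∧ (c, i) ∈ T ∧ (d, j) ∈ T ∧
      ∃ x ∈ T, z = X.circ x.1 x.2 := by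
  obtain ⟨-, a, b, k, hab, hsub⟩ := h
  obtain ⟨T, hT, hpt⟩ : ∃ T, IsFormalTriangle a b k T ∧
      ∀ p ∈ ({X.circ c i, X.circ d j, z} : Finset P), ∃ x ∈ T, p = X.circ x.1 x.2 := by
    rcases hsub with hsub | hsub
    · refine ⟨_, Or.inl rfl, fun p hp => ?_⟩
      have := hsub hp
      simp only [upper, Finset.mem_insert, Finset.mem_singleton] at this
      rcases this with rfl | rfl | rfl
      · exact ⟨(a, k), by simp, rfl⟩
      · exact ⟨(a, k + 1), by simp, rfl⟩
      · exact ⟨(b, k + 1), by simp, rfl⟩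
    · refine ⟨_, Or.inr rfl, fun p hp => ?_⟩
      have := hsub hp
      simp only [lower, Finset.mem_insert, Finset.mem_singleton] at this
      rcases this with rfl | rfl | rfl
      · exact ⟨(a, k), by simp, rfl⟩
      · exact ⟨(b, k), by simp, rfl⟩
      · exact ⟨(b, k + 1), by simp, rfl⟩
  obtain ⟨x, hx, ex⟩ := hpt (X.circ c i) (by simp)
  obtain ⟨y, hy, ey⟩ := hpt (X.circ d j) (by simp)
  obtain ⟨w, hw, ew⟩ := hpt z (by simp)
  obtain ⟨e1, e2⟩ := hcd.edge_injective (hT.near hab hx hy) hne ex ey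
  exact ⟨a, b, k, T, hab, hT, e1 ▸ hx, e2 ▸ hy, w, hw, ew⟩

/-- The triangles at a diagonal of a cylinder. -/
lemma eq_of_diagonal {c d : H} (hcd : X.Next c d) {i : Fin 3} {z : P}
    (hz : z ≠ X.circ c i) (hz' : z ≠ X.circ d (i + 1))
    (h : {X.circ c i, X.circ d (i + 1), z} ∈ X.complex) :
    z = X.circ c (i + 1) ∨ z = X.circ d i := by
  have hne := X.next_ne hcd
  obtain ⟨a, b, k, T, hab, hT, h1, h2, x, h3, rfl⟩ := exists_formalTriangle (near_of_next hcd)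
    (fun e => hne (congrArg Prod.fst e)) h
  have has := X.next_asymm hab
  have hne' := X.next_ne hab
  have hcd' := hcd
  obtain ⟨x, l⟩ := x
  simp only at hz hz' ⊢
  rcases hT with rfl | rfl <;>
    simp only [Set.mem_insert_iff, Set.mem_singleton_iff, Prod.mk.injEq] at h1 h2 h3 <;>
    grind

/-- The triangles at an edge of a cylinder that joins corresponding vertices. -/
lemma eq_of_vertical {c d : H} (hcd : X.Next c d) {i : Fin 3} {z : P}
    (hz : z ≠ X.circ c (i + 1)) (hz' : z ≠ X.circ d (i + 1))
    (h : {X.circ c (i + 1), X.circ d (i + 1), z} ∈ X.complex) :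
    z = X.circ c i ∨ z = X.circ d (i + 1 + 1) := by
  have hne := X.next_ne hcd
  obtain ⟨a, b, k, T, hab, hT, h1, h2, x, h3, rfl⟩ := exists_formalTriangle (near_of_next hcd)
    (fun e => hne (congrArg Prod.fst e)) h
  have has := X.next_asymm hab
  have hne' := X.next_ne hab
  obtain ⟨x, l⟩ := x
  simp only at hz hz' ⊢
  rcases hT with rfl | rfl <;>
    simp only [Set.mem_insert_iff, Set.mem_singleton_iff, Prod.mk.injEq] at h1 h2 h3 <;>
    grind

/-- The triangles at an edge of a hoop. -/
lemma exists_of_hoop_edge {c : H} (hc : X.Near c c) {i : Fin 3} {z : P}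
    (hz : z ≠ X.circ c i) (hz' : z ≠ X.circ c (i + 1))
    (h : {X.circ c i, X.circ c (i + 1), z} ∈ X.complex) :
    (∃ d, X.Next c d ∧ z = X.circ d (i + 1)) ∨ ∃ b, X.Next b c ∧ z = X.circ b i := by
  obtain ⟨a, b, k, T, hab, hT, h1, h2, x, h3, rfl⟩ := exists_formalTriangle hc
    (fun e => by simpa using congrArg Prod.snd e) h
  have hne' := X.next_ne hab
  obtain ⟨x, l⟩ := x
  simp only at hz hz' ⊢
  rcases hT with rfl | rfl <;>
    simp only [Set.mem_insert_iff, Set.mem_singleton_iff, Prod.mk.injEq] at h1 h2 h3 <;>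
    grind

end HoopSystem

namespace HoopSystem

variable {H P : Type*} [DecidableEq P] {X : HoopSystem H P} {S : PreAbstractSimplicialComplex P}

lemma upper_eq_diagonal (c d : H) (i : Fin 3) :
    X.upper c d i = {X.circ c i, X.circ d (i + 1), X.circ c (i + 1)} := by
  rw [upper, Finset.pair_comm]

lemma lower_eq_diagonal (c d : H) (i : Fin 3) :
    X.lower c d i = {X.circ c i, X.circ d (i + 1), X.circ d i} := by
  rw [lower, Finset.pair_comm]

lemma upper_eq_vertical (c d : H) (i : Fin 3) :
    X.upper c d i = {X.circ c (i + 1), X.circ d (i + 1), X.circ c i} := by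
  rw [upper, Finset.insert_comm, Finset.pair_comm (X.circ c i)]

lemma lower_eq_hoop (c d : H) (i : Fin 3) :
    X.lower c d i = {X.circ d i, X.circ d (i + 1), X.circ c i} := by
  rw [lower, Finset.insert_comm, Finset.pair_comm (X.circ c i)]

section Closed

variable (hS : IsSurface S) (hb : boundary S = ⊥) (hle : S ≤ X.complex)
include hS hb hle

lemma upper_iff_lower {c d : H} (hcd : X.Next c d) (i : Fin 3) :
    X.upper c d i ∈ S ↔ X.lower c d i ∈ S := by
  constructor
  · intro h
    have hc := card_upper hcd i
    rw [upper_eq_diagonal] at h hc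
    obtain ⟨z, hz, hz1, hz2, hzS⟩ := exists_other_coface hS hb h hc
    have := (eq_of_diagonal hcd hz1 hz2 (hle hzS)).resolve_left hz
    rwa [this, ← lower_eq_diagonal] at hzS
  · intro h
    have hc := card_lower hcd i
    rw [lower_eq_diagonal] at h hc
    obtain ⟨z, hz, hz1, hz2, hzS⟩ := exists_other_coface hS hb h hc
    have := (eq_of_diagonal hcd hz1 hz2 (hle hzS)).resolve_right hz
    rwa [this, ← upper_eq_diagonal] at hzS

lemma upper_imp_lower_succ {c d : H} (hcd : X.Next c d) (i : Fin 3) (h : X.upper c d i ∈ S) :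
    X.lower c d (i + 1) ∈ S := by
  have hc := card_upper hcd i
  rw [upper_eq_vertical] at h hc
  obtain ⟨z, hz, hz1, hz2, hzS⟩ := exists_other_coface hS hb h hc
  have := (eq_of_vertical hcd hz1 hz2 (hle hzS)).resolve_left hz
  rwa [this] at hzS

/-- A closed surface contains all triangles of a cylinder or none. -/
lemma upper_mem_of_upper_mem {c d : H} (hcd : X.Next c d) {i : Fin 3} (h : X.upper c d i ∈ S)
    (j : Fin 3) : X.upper c d j ∈ S := by
  have step : ∀ k, X.upper c d k ∈ S → X.upper c d (k + 1) ∈ S := fun k hk =>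
    (upper_iff_lower hS hb hle hcd _).mpr (upper_imp_lower_succ hS hb hle hcd k hk)
  have hj : j = i ∨ j = i + 1 ∨ j = i + 1 + 1 := (by decide : ∀ i j : Fin 3,
    j = i ∨ j = i + 1 ∨ j = i + 1 + 1) i j
  rcases hj with rfl | rfl | rfl
  · exact h
  · exact step _ h
  · exact step _ (step _ h)

end Closed

/-- The cylinder between `c` and `d` is contained in `S`. -/
def Used (X : HoopSystem H P) (S : PreAbstractSimplicialComplex P) (c d : H) : Prop :=
  X.Next c d ∧ ∀ i, X.upper c d i ∈ S ∧ X.lower c d i ∈ S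

/-- The hoop `c` bounds a cylinder that is contained in `S`. -/
def UsedHoop (X : HoopSystem H P) (S : PreAbstractSimplicialComplex P) (c : H) : Prop :=
  (∃ d, X.Used S c d) ∨ ∃ b, X.Used S b c

lemma UsedHoop.near {c : H} (h : X.UsedHoop S c) : X.Near c c := by
  rcases h with ⟨d, h⟩ | ⟨d, h⟩
  · exact ⟨c, d, h.1, Or.inl rfl, Or.inl rfl⟩
  · exact ⟨d, c, h.1, Or.inr rfl, Or.inr rfl⟩

lemma UsedHoop.edge_mem {c : H} (h : X.UsedHoop S c) (i : Fin 3) :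
    {X.circ c i, X.circ c (i + 1)} ∈ S := by
  rcases h with ⟨d, h⟩ | ⟨d, h⟩
  · exact pair_mem (h.2 i).1 (by simp [upper]) (by simp [upper])
  · exact pair_mem (h.2 i).2 (by simp [lower]) (by simp [lower])

lemma Used.subset {c d : H} (h : X.Used S c d) {s : Finset P} (hn : s.Nonempty) {i : Fin 3}
    (hs : s ⊆ X.upper c d i ∨ s ⊆ X.lower c d i) : s ∈ S :=
  hs.elim (fun hs => face_mono (h.2 i).1 hs hn) fun hs => face_mono (h.2 i).2 hs hn

section Closed

variable (hS : IsSurface S) (hb : boundary S = ⊥) (hle : S ≤ X.complex)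
include hS hb hle

lemma used_of_upper {c d : H} (hcd : X.Next c d) {i : Fin 3} (h : X.upper c d i ∈ S) :
    X.Used S c d :=
  ⟨hcd, fun j => ⟨upper_mem_of_upper_mem hS hb hle hcd h j,
    (upper_iff_lower hS hb hle hcd j).mp (upper_mem_of_upper_mem hS hb hle hcd h j)⟩⟩

lemma used_of_lower {c d : H} (hcd : X.Next c d) {i : Fin 3} (h : X.lower c d i ∈ S) :
    X.Used S c d :=
  used_of_upper hS hb hle hcd ((upper_iff_lower hS hb hle hcd i).mpr h)

/-- A closed surface is the union of the cylinders contained in it. -/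
lemma exists_used_of_mem {s : Finset P} (hs : s ∈ S) :
    ∃ c d i, X.Used S c d ∧ (s ⊆ X.upper c d i ∨ s ⊆ X.lower c d i) := by
  obtain ⟨t, ht, hst, hc⟩ := hS.pure s hs
  obtain ⟨-, c, d, i, hcd, h⟩ := hle ht
  rcases h with h | h
  · obtain rfl := Finset.eq_of_subset_of_card_le h (by rw [hc, card_upper hcd])
    exact ⟨c, d, i, used_of_upper hS hb hle hcd ht, Or.inl hst⟩
  · obtain rfl := Finset.eq_of_subset_of_card_le h (by rw [hc, card_lower hcd])
    exact ⟨c, d, i, used_of_lower hS hb hle hcd ht, Or.inr hst⟩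

/-- The cylinders of a closed surface continue beyond their ends. -/
lemma exists_used_of_used_left {c d : H} (h : X.Used S c d) :
    (∃ d', d' ≠ d ∧ X.Used S c d') ∨ ∃ b, X.Used S b c := by
  have hcc : X.Near c c := UsedHoop.near (Or.inl ⟨d, h⟩)
  obtain ⟨z, hz, hz1, hz2, hzS⟩ := exists_other_coface hS hb (h.2 0).1 (card_upper h.1 0)
  rcases exists_of_hoop_edge hcc hz1 hz2 (hle hzS) with ⟨d', hd', rfl⟩ | ⟨b, hb', rfl⟩
  · exact Or.inl ⟨d', fun e => hz (by rw [e]), used_of_upper hS hb hle hd' hzS⟩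
  · rw [← lower_eq_hoop] at hzS
    exact Or.inr ⟨b, used_of_lower hS hb hle hb' hzS⟩

lemma exists_used_of_used_right {b c : H} (h : X.Used S b c) :
    (∃ b', b' ≠ b ∧ X.Used S b' c) ∨ ∃ d, X.Used S c d := by
  have hcc : X.Near c c := UsedHoop.near (Or.inr ⟨b, h⟩)
  have h0 := (h.2 0).2
  have hc := card_lower h.1 0
  rw [lower_eq_hoop] at h0 hc
  obtain ⟨z, hz, hz1, hz2, hzS⟩ := exists_other_coface hS hb h0 hc
  rcases exists_of_hoop_edge hcc hz1 hz2 (hle hzS) with ⟨d', hd', rfl⟩ | ⟨b', hb', rfl⟩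
  · exact Or.inr ⟨d', used_of_upper hS hb hle hd' hzS⟩
  · rw [← lower_eq_hoop] at hzS
    exact Or.inl ⟨b', fun e => hz (by rw [e]), used_of_lower hS hb hle hb' hzS⟩

/-- The hoops of a closed surface do not touch: at a common vertex of two of them, the link would be
disconnected. -/
lemma UsedHoop.circ_injective {c c' : H} (hc : X.UsedHoop S c) (hc' : X.UsedHoop S c')
    {i i' : Fin 3} (h : X.circ c i = X.circ c' i') : (c, i) = (c', i') := by
  have hne1 : ∀ k : Fin 3, k + 1 ≠ k := by decide
  have hq : X.circ c (i + 1) ≠ X.circ c i := fun e =>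
    hne1 i (congrArg Prod.snd (hc.near.circ_injective e))
  have hq' : X.circ c' (i' + 1) ≠ X.circ c' i' := fun e =>
    hne1 i' (congrArg Prod.snd (hc'.near.circ_injective e))
  have hmem : X.circ c' (i' + 1) ∈ {q | ∃ d j, X.Near c d ∧ q = X.circ d j} := by
    refine link_connected hS hb (p := X.circ c i) (q₀ := X.circ c (i + 1))
      {q | ∃ d j, X.Near c d ∧ q = X.circ d j} ⟨c, i + 1, hc.near, rfl⟩ hq (hc.edge_mem i)
      ?_ (h ▸ hq') (h ▸ hc'.edge_mem i')
    rintro q q' ⟨d, j, hd, rfl⟩ - hqp - hS'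
    obtain ⟨a, b, k, T, hab, hT, h1, h2, x, h3, rfl⟩ := exists_formalTriangle hd
      (fun e => hqp (by rw [Prod.mk.injEq] at e; rw [← e.1, ← e.2])) (hle hS')
    exact ⟨x.1, x.2, hT.near hab h1 h3, rfl⟩
  obtain ⟨d, j, hd, hdj⟩ := hmem
  refine (hd.edge_injective hc'.near (fun e => ?_) h hdj.symm).1
  rw [Prod.mk.injEq] at e
  exact hq' (by rw [hdj, ← h, ← e.1, ← e.2])

lemma finite_usedHoop : {c | X.UsedHoop S c}.Finite := by
  refine Set.Finite.of_finite_image (f := fun c => ({X.circ c 0} : Finset P))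
    (hS.finite.subset ?_) ?_
  · rintro _ ⟨c, hc, rfl⟩
    exact vertex_mem (hc.edge_mem 0) (by simp)
  · intro c hc c' hc' h
    exact congrArg Prod.fst
      (hc.circ_injective hS hb hle hc' (Finset.singleton_injective h))

end Closed

/-- The vertices of the cylinders between consecutive hoops of a cyclic sequence. -/
def gridOf (X : HoopSystem H P) {m : ℕ} (h : ZMod (m + 3) → H) : Grid m → P :=
  fun x => X.circ (h x.1) x.2

lemma mem_gridOf {m : ℕ} {h : ZMod (m + 3) → H} {s : Finset P} :
    s ∈ gridComplex (X.gridOf h) ↔ s.Nonempty ∧ ∃ j i,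
      s ⊆ X.upper (h j) (h (j + 1)) i ∨ s ⊆ X.lower (h j) (h (j + 1)) i := by
  have e0 : ∀ j i, hexTriangle (X.gridOf h) (j, i) 0 = X.lower (h j) (h (j + 1)) i := by
    intro j i
    simp only [hexTriangle, gridOf, lower, hex, Matrix.cons_val_zero, Fin.isValue, zero_add,
      Matrix.cons_val_one, Prod.mk_add_mk, add_zero]
    rfl
  have e1 : ∀ j i, hexTriangle (X.gridOf h) (j, i) 1 = X.upper (h j) (h (j + 1)) i := by
    intro j i
    simp only [hexTriangle, gridOf, hex, Matrix.cons_val_one, Fin.isValue, Fin.reduceAdd,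
      Matrix.cons_val, Prod.mk_add_mk, add_zero]
    exact (upper_eq_diagonal _ _ _).symm
  rw [mem_gridComplex]
  refine and_congr_right fun _ => ⟨?_, ?_⟩
  · rintro ⟨x, i, hs⟩
    have h6 := (by decide : ∀ i : Fin 6, (i = 0 ∨ i = 1) ∨ (i + 2 = 0 ∨ i + 2 = 1) ∨
      (i + 4 = 0 ∨ i + 4 = 1)) i
    obtain ⟨x, i, hi, hs⟩ : ∃ x i, (i = 0 ∨ i = 1) ∧ s ⊆ hexTriangle (X.gridOf h) x i := by
      rcases h6 with h | h | h
      · exact ⟨x, i, h, hs⟩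
      · exact ⟨x + hex m i, i + 2, h, by rwa [hexTriangle_rotate]⟩
      · exact ⟨x + hex m (i + 1), i + 4, h, by rwa [hexTriangle_rotate']⟩
    rcases hi with rfl | rfl
    · exact ⟨x.1, x.2, Or.inr (by rwa [← e0])⟩
    · exact ⟨x.1, x.2, Or.inl (by rwa [← e1])⟩
  · rintro ⟨j, i, hs | hs⟩
    · exact ⟨(j, i), 1, hs.trans (e1 j i).ge⟩
    · exact ⟨(j, i), 0, hs.trans (e0 j i).ge⟩

/-- A connected closed surface is a torus, if each of its hoops bounds at most one of its cylinders on
each side. -/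
lemma exists_eq_gridComplex (hS : IsSurface S) (hb : boundary S = ⊥) (hle : S ≤ X.complex)
    (hconn : IsConnected S)
    (hout : ∀ {c d d'}, X.Used S c d → X.Used S c d' → d = d')
    (hin : ∀ {b b' c}, X.Used S b c → X.Used S b' c → b = b') :
    ∃ (m : ℕ) (F : Grid m → P), Function.Injective F ∧ S = gridComplex F := by
  classical
  have hnext : ∀ c, X.UsedHoop S c → ∃ d, X.Used S c d := by
    rintro c (h | ⟨b, h⟩)
    · exact h
    · rcases exists_used_of_used_right hS hb hle h with ⟨b', hne, h'⟩ | h'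
      · exact absurd (hin h' h) hne
      · exact h'
  let σ : H → H := fun c => if h : X.UsedHoop S c then (hnext c h).choose else c
  have hσ : ∀ c, X.UsedHoop S c → X.Used S c (σ c) := by
    intro c h
    simp only [σ, dif_pos h]
    exact (hnext c h).choose_spec
  have hσm : Set.MapsTo σ {c | X.UsedHoop S c} {c | X.UsedHoop S c} :=
    fun c h => Or.inr ⟨c, hσ c h⟩
  obtain ⟨⟨p, hp⟩⟩ := hconn.nonempty
  obtain ⟨c, d, i, hcd, -⟩ := exists_used_of_mem hS hb hle hp
  obtain ⟨y, hyU, hy⟩ := exists_periodic (finite_usedHoop hS hb hle) hσm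
    (show c ∈ {c | X.UsedHoop S c} from Or.inl ⟨d, hcd⟩)
  have hy1 := hσ y hyU
  have hy2 := hσ _ (hσm hyU)
  obtain ⟨m, h, hinj, h0, hstep⟩ := exists_cyclic_enumeration_of_ne hy
    (fun e => X.next_ne hy1.1 e.symm) (fun e => X.next_asymm hy1.1 (by rw [e] at hy2; exact hy2.1))
  have hU : ∀ j : ℕ, X.UsedHoop S (h (j : ZMod (m + 3))) := by
    intro j
    induction j with
    | zero => rw [Nat.cast_zero, h0]; exact hyU
    | succ j ih => rw [Nat.cast_succ, hstep]; exact hσm ih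
  have hU : ∀ j, X.UsedHoop S (h j) := fun j => by
    have := hU j.val
    rwa [ZMod.natCast_zmod_val] at this
  have hused : ∀ j, X.Used S (h j) (h (j + 1)) := fun j => by rw [hstep]; exact hσ _ (hU j)
  have hF : Function.Injective (X.gridOf h) := by
    rintro ⟨j, i⟩ ⟨j', i'⟩ e
    have := (hU j).circ_injective hS hb hle (hU j') e
    obtain ⟨e1, e2⟩ := Prod.ext_iff.mp this
    exact Prod.ext (hinj e1) e2
  have hleft : ∀ {j d}, X.Used S (h j) d → d = h (j + 1) := fun h => hout h (hused _)
  have hright : ∀ {j b}, X.Used S b (h j) → b = h (j - 1) := fun {j b} hb' => by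
    have := hused (j - 1)
    rw [sub_add_cancel] at this
    exact hin hb' this
  have hmemv : ∀ {c d : H} {i : Fin 3} {s : Finset P} {p : P},
      (s ⊆ X.upper c d i ∨ s ⊆ X.lower c d i) → p ∈ s →
      (∃ l, p = X.circ c l) ∨ ∃ l, p = X.circ d l := by
    rintro c d i s p (hs | hs) hp <;> have := hs hp <;>
      simp only [upper, lower, Finset.mem_insert, Finset.mem_singleton] at this
    · rcases this with h | h | h
      exacts [Or.inl ⟨_, h⟩, Or.inl ⟨_, h⟩, Or.inr ⟨_, h⟩]
    · rcases this with h | h | h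
      exacts [Or.inl ⟨_, h⟩, Or.inr ⟨_, h⟩, Or.inr ⟨_, h⟩]
  -- the cylinders of `S` that meet the torus belong to it
  have key : ∀ {c d : H} {i : Fin 3} {s : Finset P} {x : Grid m}, X.Used S c d →
      (s ⊆ X.upper c d i ∨ s ⊆ X.lower c d i) → X.gridOf h x ∈ s →
      ∃ j, c = h j ∧ d = h (j + 1) := by
    rintro c d i s ⟨j, l⟩ hcd hs hx
    rcases hmemv hs hx with ⟨l', e⟩ | ⟨l', e⟩
    · have := congrArg Prod.fst ((hU j).circ_injective hS hb hle (Or.inl ⟨d, hcd⟩) e)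
      simp only at this
      subst this
      exact ⟨j, rfl, hleft hcd⟩
    · have := congrArg Prod.fst ((hU j).circ_injective hS hb hle (Or.inr ⟨c, hcd⟩) e)
      simp only at this
      subst this
      exact ⟨j - 1, hright hcd, by rw [sub_add_cancel]⟩
  have hall : ∀ q, {q} ∈ S → q ∈ Set.range (X.gridOf h) := by
    intro q hq
    refine hconn.mem_of_closed (Set.range (X.gridOf h)) (p₀ := X.gridOf h (0, 0)) ?_ ⟨_, rfl⟩ ?_ hq
    · exact vertex_mem ((hU 0).edge_mem 0) (Finset.mem_insert_self _ _)
    · rintro _ q ⟨x, rfl⟩ hpq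
      obtain ⟨c, d, i, hcd, hs⟩ := exists_used_of_mem hS hb hle hpq
      obtain ⟨j, rfl, rfl⟩ := key hcd hs (Finset.mem_insert_self (X.gridOf h x) {q})
      rcases hmemv hs (p := q) (by simp) with ⟨l, rfl⟩ | ⟨l, rfl⟩
      · exact ⟨(j, l), rfl⟩
      · exact ⟨(j + 1, l), rfl⟩
  refine ⟨m, X.gridOf h, hF, SetLike.ext fun s => ⟨fun hs => ?_, fun hs => ?_⟩⟩
  · obtain ⟨p, hp⟩ := face_nonempty hs
    obtain ⟨x, rfl⟩ := hall p (vertex_mem hs hp)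
    obtain ⟨c, d, i, hcd, hs'⟩ := exists_used_of_mem hS hb hle hs
    obtain ⟨j, rfl, rfl⟩ := key hcd hs' hp
    exact mem_gridOf.mpr ⟨face_nonempty hs, j, i, hs'⟩
  · obtain ⟨hn, j, i, hs⟩ := mem_gridOf.mp hs
    exact (hused j).subset hn hs

/-- A cyclic sequence of hoops that do not touch yields a torus. -/
lemma exists_gridComplex_le {U : Set H} (hU : U.Finite) (hne : U.Nonempty) {σ : H → H}
    (hσ : Set.MapsTo σ U U) (hnext : ∀ c ∈ U, X.Next c (σ c))
    (hinj : ∀ c ∈ U, ∀ c' ∈ U, ∀ i i', X.circ c i = X.circ c' i' → (c, i) = (c', i')) :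
    ∃ (m : ℕ) (F : Grid m → P), Function.Injective F ∧ gridComplex F ≤ X.complex ∧
      ∀ x, ∃ c ∈ U, ∃ i, F x = X.circ c i := by
  obtain ⟨c, hc⟩ := hne
  obtain ⟨y, hyU, hy⟩ := exists_periodic hU hσ hc
  have hy1 := hnext y hyU
  have hy2 := hnext _ (hσ hyU)
  obtain ⟨m, h, hhinj, h0, hstep⟩ := exists_cyclic_enumeration_of_ne hy
    (fun e => X.next_ne hy1 e.symm) (fun e => X.next_asymm hy1 (by rwa [e] at hy2))
  have hhU : ∀ j : ℕ, h (j : ZMod (m + 3)) ∈ U := by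
    intro j
    induction j with
    | zero => rw [Nat.cast_zero, h0]; exact hyU
    | succ j ih => rw [Nat.cast_succ, hstep]; exact hσ ih
  have hhU : ∀ j, h j ∈ U := fun j => by
    have := hhU j.val
    rwa [ZMod.natCast_zmod_val] at this
  refine ⟨m, X.gridOf h, ?_, ?_, fun x => ⟨h x.1, hhU _, x.2, rfl⟩⟩
  · rintro ⟨j, i⟩ ⟨j', i'⟩ e
    have := hinj _ (hhU j) _ (hhU j') _ _ e
    obtain ⟨e1, e2⟩ := Prod.ext_iff.mp this
    exact Prod.ext (hhinj e1) e2
  · intro s hs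
    obtain ⟨hn, j, i, hs⟩ := mem_gridOf.mp hs
    exact ⟨hn, h j, h (j + 1), i, by rw [hstep]; exact hnext _ (hhU j), hs⟩

end HoopSystem

/-! ### Layouts -/

section Layouts

variable {V : Type}

/-- The positions of the gadgets in a part of the construction. The hoops `inc v` and `out v` with
numbers from `start` to `finish` form chains, the edges `uv` with `Edge u v` have gadgets attached at
the hoops `out u (emit u v)` and `inc v (recv u v)` and the three hoops above them, and the two parts
of the gadget of `v` are joined if `Joined v`. Gadgets attached to the same chain do not overlap. -/
structure Layout (V : Type) where
  start : Tops V
  finish : Tops V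
  Edge : V → V → Prop
  Joined : V → Prop
  emit : V → V → ℕ
  recv : V → V → ℕ
  inc_le : ∀ v, start.inc v ≤ finish.inc v
  out_le : ∀ v, start.out v ≤ finish.out v
  le_emit : ∀ {u v}, Edge u v → start.out u ≤ emit u v
  emit_le : ∀ {u v}, Edge u v → emit u v + 4 ≤ finish.out u
  le_recv : ∀ {u v}, Edge u v → start.inc v ≤ recv u v
  recv_le : ∀ {u v}, Edge u v → recv u v + 4 ≤ finish.inc v
  emit_gap : ∀ {u v v'}, Edge u v → Edge u v' → v ≠ v' →
    emit u v + 4 ≤ emit u v' ∨ emit u v' + 4 ≤ emit u v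
  recv_gap : ∀ {u u' v}, Edge u v → Edge u' v → u ≠ u' →
    recv u v + 4 ≤ recv u' v ∨ recv u' v + 4 ≤ recv u v

namespace Layout

/-- The cylinders of a layout. -/
inductive Arc (L : Layout V) : Hoop V → Hoop V → Prop
  | inc (v : V) (k : ℕ) : L.start.inc v ≤ k → k < L.finish.inc v → L.Arc (.inc v k) (.inc v (k + 1))
  | out (v : V) (k : ℕ) : L.start.out v ≤ k → k < L.finish.out v → L.Arc (.out v (k + 1)) (.out v k)
  | inc_mid (v : V) : L.Joined v → L.Arc (.inc v (L.finish.inc v)) (.mid v)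
  | mid_out (v : V) : L.Joined v → L.Arc (.mid v) (.out v (L.finish.out v))
  | out_edge (u v : V) : L.Edge u v → L.Arc (.out u (L.emit u v + 3)) (.edge u v 0)
  | edge (u v : V) (j j' : Fin 6) : L.Edge u v → j'.val = j.val + 1 →
    L.Arc (.edge u v j) (.edge u v j')
  | edge_inc (u v : V) : L.Edge u v → L.Arc (.edge u v 5) (.inc v (L.recv u v + 3))

/-- The hoop that carries the vertex number `0` of a hoop. -/
def pin (L : Layout V) : Hoop V → Hoop V
  | .edge u v j =>
    if j = 1 then .out u (L.emit u v + 1)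
    else if j = 4 then .inc v (L.recv u v + 1) else .edge u v j
  | c => c

/-- The vertices of a hoop, after the identifications at the touching points. -/
def circ (L : Layout V) (c : Hoop V) : Fin 3 → Point V :=
  fun i => if i = 0 then (L.pin c, 0) else (c, i)

variable {L : Layout V}

lemma Arc.ne {c d : Hoop V} (h : L.Arc c d) : c ≠ d := by
  cases h <;> simp
  rintro rfl
  omega

lemma Arc.asymm {c d : Hoop V} (h : L.Arc c d) (h' : L.Arc d c) : False := by
  have aux : ∀ {c d c' d' : Hoop V}, L.Arc c d → L.Arc c' d' → c = d' → d = c' → False := by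
    intro c d c' d' h h' e1 e2
    cases h <;> cases h' <;>
      simp only [reduceCtorEq, Hoop.inc.injEq, Hoop.out.injEq, Hoop.edge.injEq] at e1 e2 <;> grind
  exact aux h h' rfl rfl

/-- The two hoops touch in a vertex. -/
inductive Pinch (L : Layout V) : Hoop V → Hoop V → Prop
  | out (u v : V) : L.Edge u v → L.Pinch (.edge u v 1) (.out u (L.emit u v + 1))
  | inc (u v : V) : L.Edge u v → L.Pinch (.edge u v 4) (.inc v (L.recv u v + 1))

/-- The hoop bounds a cylinder. -/
def OnArc (L : Layout V) (c : Hoop V) : Prop := ∃ d, L.Arc c d ∨ L.Arc d c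

lemma OnArc.edge {u v : V} {j : Fin 6} (h : L.OnArc (.edge u v j)) : L.Edge u v := by
  obtain ⟨d, h | h⟩ := h <;> cases h <;> assumption

lemma pin_eq_pin {c c' : Hoop V} (hc : L.OnArc c) (hc' : L.OnArc c') (h : L.pin c = L.pin c') :
    c = c' ∨ L.Pinch c c' ∨ L.Pinch c' c := by
  have aux : ∀ {c c' : Hoop V}, L.OnArc c → L.OnArc c' → L.pin c = L.pin c' →
      (∀ u v j, c' ≠ .edge u v j) → c = c' ∨ L.Pinch c c' := by
    intro c c' hc hc' h hne
    have h' : L.pin c' = c' := by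
      cases c' <;> first | rfl | exact absurd rfl (hne _ _ _)
    rw [h'] at h
    cases c with
    | edge u v j =>
      simp only [pin] at h
      split_ifs at h with h1 h4
      · subst h h1; exact Or.inr (.out _ _ hc.edge)
      · subst h h4; exact Or.inr (.inc _ _ hc.edge)
      · exact Or.inl h
    | _ => exact Or.inl h
  by_cases he' : ∀ u v j, c' ≠ .edge u v j
  · exact (aux hc hc' h he').imp_right Or.inl
  by_cases he : ∀ u v j, c ≠ .edge u v j
  · exact (aux hc' hc h.symm he).imp Eq.symm Or.inr
  push Not at he he'
  obtain ⟨u, v, j, rfl⟩ := he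
  obtain ⟨u', v', j', rfl⟩ := he'
  left
  have hE := hc.edge
  have hE' := hc'.edge
  simp only [pin] at h
  split_ifs at h with h1 h2 h3 h4 h5 h6 h7
  all_goals try simp only [Hoop.out.injEq, Hoop.inc.injEq] at h
  · obtain ⟨rfl, h⟩ := h
    subst h1 h2
    by_cases hv : v = v'
    · rw [hv]
    · rcases L.emit_gap hE hE' hv with h' | h' <;> omega
  · obtain ⟨rfl, h⟩ := h
    subst h4 h6
    by_cases hv : u = u'
    · rw [hv]
    · rcases L.recv_gap hE hE' hv with h' | h' <;> omega
  · exact h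

/-- The hoops in the neighborhood of a touching point. -/
lemma Pinch.neighbor_left {c c' d : Hoop V} (h : L.Pinch c c') (hd : L.Arc c d ∨ L.Arc d c) :
    ∃ u v j, d = .edge u v j ∧ j ≠ 1 ∧ j ≠ 4 := by
  obtain ⟨u, v, hE⟩ | ⟨u, v, hE⟩ := h
  · generalize hc : Hoop.edge u v 1 = c at hd
    rcases hd with hd | hd <;> cases hd <;> simp only [Hoop.edge.injEq, reduceCtorEq] at hc
    · obtain ⟨rfl, rfl, rfl⟩ := hc
      exact ⟨_, _, _, rfl, by grind, by grind⟩
    · exact absurd hc.2.2 (by decide)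
    · exact absurd hc.2.2 (by decide)
    · obtain ⟨rfl, rfl, rfl⟩ := hc
      exact ⟨_, _, _, rfl, by grind, by grind⟩
  · generalize hc : Hoop.edge u v 4 = c at hd
    rcases hd with hd | hd <;> cases hd <;> simp only [Hoop.edge.injEq, reduceCtorEq] at hc
    · obtain ⟨rfl, rfl, rfl⟩ := hc
      exact ⟨_, _, _, rfl, by grind, by grind⟩
    · exact absurd hc.2.2 (by decide)
    · exact absurd hc.2.2 (by decide)
    · obtain ⟨rfl, rfl, rfl⟩ := hc
      exact ⟨_, _, _, rfl, by grind, by grind⟩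

lemma Pinch.neighbor_right {c c' d : Hoop V} (h : L.Pinch c c') (hd : L.Arc c' d ∨ L.Arc d c') :
    (∀ u v j, d ≠ .edge u v j) ∧ ∀ b, ¬ L.Pinch b d := by
  obtain ⟨u, v, hE⟩ | ⟨u, v, hE⟩ := h
  · have hs := L.emit_le hE
    have key : d = .out u (L.emit u v) ∨ d = .out u (L.emit u v + 2) := by
      generalize hc : Hoop.out u (L.emit u v + 1) = c at hd
      rcases hd with hd | hd <;> cases hd <;> simp only [Hoop.out.injEq, reduceCtorEq] at hc
      · left; grind
      · rename_i w hE'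
        obtain ⟨rfl, hc⟩ := hc
        by_cases hv : v = w
        · subst hv; omega
        · rcases L.emit_gap hE hE' hv with h' | h' <;> omega
      · right; grind
      · obtain ⟨rfl, hc⟩ := hc
        omega
    refine ⟨by rcases key with rfl | rfl <;> simp, fun b hb => ?_⟩
    obtain ⟨k, hk, rfl⟩ : ∃ k, (k = L.emit u v ∨ k = L.emit u v + 2) ∧ d = .out u k := by
      rcases key with rfl | rfl
      · exact ⟨_, Or.inl rfl, rfl⟩
      · exact ⟨_, Or.inr rfl, rfl⟩
    generalize hc : Hoop.out u k = c at hb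
    cases hb with
    | inc => simp at hc
    | out u' w hE' =>
      simp only [Hoop.out.injEq] at hc
      obtain ⟨rfl, hc⟩ := hc
      by_cases hv : v = w
      · subst hv; omega
      · rcases L.emit_gap hE hE' hv with h' | h' <;> omega
  · have hs := L.recv_le hE
    have key : d = .inc v (L.recv u v) ∨ d = .inc v (L.recv u v + 2) := by
      generalize hc : Hoop.inc v (L.recv u v + 1) = c at hd
      rcases hd with hd | hd <;> cases hd <;> simp only [Hoop.inc.injEq, reduceCtorEq] at hc
      · right; grind
      · obtain ⟨rfl, hc⟩ := hc
        omega
      · left; grind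
      · rename_i w v' hE'
        obtain ⟨rfl, hc⟩ := hc
        by_cases hv : u = w
        · subst hv; omega
        · rcases L.recv_gap hE hE' hv with h' | h' <;> omega
    refine ⟨by rcases key with rfl | rfl <;> simp, fun b hb => ?_⟩
    obtain ⟨k, hk, rfl⟩ : ∃ k, (k = L.recv u v ∨ k = L.recv u v + 2) ∧ d = .inc v k := by
      rcases key with rfl | rfl
      · exact ⟨_, Or.inl rfl, rfl⟩
      · exact ⟨_, Or.inr rfl, rfl⟩
    generalize hc : Hoop.inc v k = c at hb
    cases hb with
    | out => simp at hc
    | inc u' w hE' =>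
      simp only [Hoop.inc.injEq] at hc
      obtain ⟨rfl, hc⟩ := hc
      by_cases hv : u = u'
      · subst hv; omega
      · rcases L.recv_gap hE hE' hv with h' | h' <;> omega

lemma circ_eq_circ {c c' : Hoop V} {i i' : Fin 3} (hc : L.OnArc c) (hc' : L.OnArc c')
    (h : L.circ c i = L.circ c' i') :
    i = i' ∧ (c = c' ∨ i = 0 ∧ (L.Pinch c c' ∨ L.Pinch c' c)) := by
  have hi : i = i' := by
    have := congrArg Prod.snd h
    simp only [circ] at this
    split_ifs at this with h1 h2 h2
    · rw [h1, h2]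
    · exact absurd this.symm h2
    · exact absurd this h1
    · exact this
  subst hi
  refine ⟨rfl, ?_⟩
  have := congrArg Prod.fst h
  simp only [circ] at this
  split_ifs at this with h1
  · exact (pin_eq_pin hc hc' this).imp_right fun h => ⟨h1, h⟩
  · exact Or.inl this

lemma Pinch.edge_left {c c' : Hoop V} (h : L.Pinch c c') :
    ∃ u v j, c = .edge u v j ∧ (j = 1 ∨ j = 4) := by
  cases h
  · exact ⟨_, _, _, rfl, Or.inl rfl⟩
  · exact ⟨_, _, _, rfl, Or.inr rfl⟩

lemma Pinch.ne_edge_right {c c' : Hoop V} (h : L.Pinch c c') (u v : V) (j : Fin 6) :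
    c' ≠ .edge u v j := by
  cases h <;> simp

/-- Touching hoops are far apart. -/
lemma Pinch.not_common {c c' d : Hoop V} (h : L.Pinch c c')
    (hd : d = c ∨ L.Arc c d ∨ L.Arc d c) (hd' : d = c' ∨ L.Arc c' d ∨ L.Arc d c') : False := by
  rcases hd' with rfl | hd'
  · rcases hd with rfl | hd
    · obtain ⟨u, v, j, rfl, -⟩ := h.edge_left
      exact h.ne_edge_right _ _ _ rfl
    · obtain ⟨u, v, j, rfl, -⟩ := h.neighbor_left hd
      exact h.ne_edge_right _ _ _ rfl
  · have h1 := (h.neighbor_right hd').1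
    rcases hd with rfl | hd
    · obtain ⟨u, v, j, rfl, -⟩ := h.edge_left
      exact h1 _ _ _ rfl
    · obtain ⟨u, v, j, rfl, -⟩ := h.neighbor_left hd
      exact h1 _ _ _ rfl

/-- The two ends of a cylinder do not both touch other hoops. -/
lemma not_pinch_of_adjacent {c c' d d' : Hoop V} (hc : L.Pinch c c' ∨ L.Pinch c' c)
    (hd : L.Pinch d d' ∨ L.Pinch d' d) (h : L.Arc c d ∨ L.Arc d c) : False := by
  rcases hc with hc | hc
  · obtain ⟨u, v, j, rfl, h1, h4⟩ := hc.neighbor_left h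
    rcases hd with hd | hd
    · obtain ⟨_, _, _, e, h'⟩ := hd.edge_left
      simp only [Hoop.edge.injEq] at e
      obtain ⟨-, -, rfl⟩ := e
      tauto
    · exact hd.ne_edge_right _ _ _ rfl
  · obtain ⟨h1, h2⟩ := hc.neighbor_right h
    rcases hd with hd | hd
    · obtain ⟨u, v, j, rfl, -⟩ := hd.edge_left
      exact h1 _ _ _ rfl
    · exact h2 _ hd

/-- The hoops of a layout form a hoop system. -/
def hoopSystem (L : Layout V) : HoopSystem (Hoop V) (Point V) where
  Next := L.Arc
  circ := L.circ
  next_ne := Arc.ne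
  next_asymm h h' := h.asymm h'
  edge_injective := by
    intro a b a' b' c d c' d' i j i' j' hab hc hd hab' hc' hd' hne e1 e2
    have near : ∀ {a b c d : Hoop V}, L.Arc a b → (c = a ∨ c = b) → (d = a ∨ d = b) →
        d = c ∨ L.Arc c d ∨ L.Arc d c := by
      rintro a b c d h (rfl | rfl) (rfl | rfl)
      exacts [Or.inl rfl, Or.inr (Or.inl h), Or.inr (Or.inr h), Or.inl rfl]
    have on : ∀ {a b c : Hoop V}, L.Arc a b → (c = a ∨ c = b) → L.OnArc c := by
      rintro a b c h (rfl | rfl)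
      exacts [⟨_, Or.inl h⟩, ⟨_, Or.inr h⟩]
    have hcd := near hab hc hd
    have hdc := near hab hd hc
    have hcd' := near hab' hc' hd'
    have hdc' := near hab' hd' hc'
    obtain ⟨rfl, h1⟩ := circ_eq_circ (on hab hc) (on hab' hc') e1
    obtain ⟨rfl, h2⟩ := circ_eq_circ (on hab hd) (on hab' hd') e2
    rcases h1 with rfl | ⟨hi, h1⟩
    · rcases h2 with rfl | ⟨-, h2⟩
      · exact ⟨rfl, rfl⟩
      · exfalso
        rcases h2 with h2 | h2
        · exact h2.not_common hdc hdc'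
        · exact h2.not_common hdc' hdc
    · exfalso
      rcases h2 with rfl | ⟨hj, h2⟩
      · rcases h1 with h1 | h1
        · exact h1.not_common hcd hcd'
        · exact h1.not_common hcd' hcd
      · rcases hcd with rfl | hcd
        · exact hne (by rw [hi, hj])
        · exact not_pinch_of_adjacent h1 h2 hcd

end Layout

end Layouts

/-! ### Closed surfaces in layouts -/

section ClosedSurfaces

variable {V : Type}

namespace Layout

variable {L : Layout V}

/-- Only at the hoop where an edge gadget is emitted there is a choice how to continue. -/
lemma Arc.right_cases {c d d' : Hoop V} (h : L.Arc c d) (h' : L.Arc c d') :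
    d = d' ∨ ∃ u v, L.Edge u v ∧ c = .out u (L.emit u v + 3) ∧
      ((d = .edge u v 0 ∧ d' = .out u (L.emit u v + 2)) ∨
        (d' = .edge u v 0 ∧ d = .out u (L.emit u v + 2))) := by
  have aux : ∀ {c d c' d' : Hoop V}, L.Arc c d → L.Arc c' d' → c = c' → d = d' ∨
      ∃ u v, L.Edge u v ∧ c = .out u (L.emit u v + 3) ∧
      ((d = .edge u v 0 ∧ d' = .out u (L.emit u v + 2)) ∨
        (d' = .edge u v 0 ∧ d = .out u (L.emit u v + 2))) := by
    intro c d c' d' h h' e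
    cases h <;> cases h' <;>
      simp only [reduceCtorEq, Hoop.inc.injEq, Hoop.out.injEq, Hoop.edge.injEq, Hoop.mid.injEq] at e
    case out_edge.out_edge u v hE u' v' hE' =>
      obtain ⟨rfl, e⟩ := e
      by_cases hv : v = v'
      · subst hv; exact Or.inl rfl
      · rcases L.emit_gap hE hE' hv with h' | h' <;> omega
    all_goals grind
  exact aux h h' rfl

/-- Only at the hoop where an edge gadget is received there is a choice how to go back. -/
lemma Arc.left_cases {b b' c : Hoop V} (h : L.Arc b c) (h' : L.Arc b' c) :
    b = b' ∨ ∃ u v, L.Edge u v ∧ c = .inc v (L.recv u v + 3) ∧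
      ((b = .edge u v 5 ∧ b' = .inc v (L.recv u v + 2)) ∨
        (b' = .edge u v 5 ∧ b = .inc v (L.recv u v + 2))) := by
  have aux : ∀ {b c b' c' : Hoop V}, L.Arc b c → L.Arc b' c' → c = c' → b = b' ∨
      ∃ u v, L.Edge u v ∧ c = .inc v (L.recv u v + 3) ∧
      ((b = .edge u v 5 ∧ b' = .inc v (L.recv u v + 2)) ∨
        (b' = .edge u v 5 ∧ b = .inc v (L.recv u v + 2))) := by
    intro b c b' c' h h' e
    cases h <;> cases h' <;>
      simp only [reduceCtorEq, Hoop.inc.injEq, Hoop.out.injEq, Hoop.edge.injEq, Hoop.mid.injEq] at e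
    case edge_inc.edge_inc u v hE u' v' hE' =>
      obtain ⟨rfl, e⟩ := e
      by_cases hv : u = u'
      · subst hv; exact Or.inl rfl
      · rcases L.recv_gap hE hE' hv with h' | h' <;> omega
    all_goals grind
  exact aux h h' rfl

variable [DecidableEq V] {S : PreAbstractSimplicialComplex (Point V)}

section

variable (hS : IsSurface S) (hb : boundary S = ⊥) (hle : S ≤ L.hoopSystem.complex)
include hS hb hle

/-- Two hoops that touch are not both part of a closed surface. -/
lemma not_used_pinch {c c' : Hoop V} (h : L.Pinch c c') (hc : L.hoopSystem.UsedHoop S c)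
    (hc' : L.hoopSystem.UsedHoop S c') : False := by
  have e : L.circ c 0 = L.circ c' 0 := by
    cases h <;> simp [circ, pin]
  have e' : L.hoopSystem.circ c 0 = L.hoopSystem.circ c' 0 := e
  have := congrArg Prod.fst (hc.circ_injective hS hb hle hc' e')
  cases h <;> simp at this

/-- At most one of the two ways out of a hoop is used: both of them together would lead to the two
hoops that touch each other. -/
lemma used_right_unique {c d d' : Hoop V} (h : L.hoopSystem.Used S c d)
    (h' : L.hoopSystem.Used S c d') : d = d' := by
  have key : ∀ u v, L.Edge u v →
      L.hoopSystem.Used S (.out u (L.emit u v + 3)) (.edge u v 0) →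
      L.hoopSystem.Used S (.out u (L.emit u v + 3)) (.out u (L.emit u v + 2)) → False := by
    intro u v hE h1 h2
    have hs := L.emit_le hE
    refine not_used_pinch hS hb hle (.out u v hE) ?_ ?_
    · have inv1 : ∀ {b c}, L.Arc b c → c = .edge u v 0 → b = .out u (L.emit u v + 3) := by
        intro b c h hc
        cases h <;> simp only [reduceCtorEq, Hoop.edge.injEq] at hc <;> grind
      have inv2 : ∀ {c d}, L.Arc c d → c = .edge u v 0 → d = .edge u v 1 := by
        intro c d h hc
        cases h <;> simp only [reduceCtorEq, Hoop.edge.injEq] at hc <;> grind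
      rcases HoopSystem.exists_used_of_used_right hS hb hle h1 with ⟨b, hb', h3⟩ | ⟨d, h3⟩
      · exact absurd (inv1 h3.1 rfl) hb'
      · exact Or.inr ⟨_, inv2 h3.1 rfl ▸ h3⟩
    · have inv1 : ∀ {b c}, L.Arc b c → c = .out u (L.emit u v + 2) →
          b = .out u (L.emit u v + 3) := by
        intro b c h hc
        cases h <;> simp only [reduceCtorEq, Hoop.out.injEq] at hc <;> grind
      have inv2 : ∀ {c d}, L.Arc c d → c = .out u (L.emit u v + 2) →
          d = .out u (L.emit u v + 1) := by
        intro c d h hc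
        cases h <;> simp only [reduceCtorEq, Hoop.out.injEq] at hc
        · grind
        · rename_i w hE'
          obtain ⟨rfl, hc⟩ := hc
          by_cases hv : v = w
          · subst hv; omega
          · rcases L.emit_gap hE hE' hv with h' | h' <;> omega
      rcases HoopSystem.exists_used_of_used_right hS hb hle h2 with ⟨b, hb', h3⟩ | ⟨d, h3⟩
      · exact absurd (inv1 h3.1 rfl) hb'
      · exact Or.inr ⟨_, inv2 h3.1 rfl ▸ h3⟩
  rcases Arc.right_cases h.1 h'.1 with e | ⟨u, v, hE, rfl, ⟨rfl, rfl⟩ | ⟨rfl, rfl⟩⟩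
  · exact e
  · exact (key u v hE h h').elim
  · exact (key u v hE h' h).elim

lemma used_left_unique {b b' c : Hoop V} (h : L.hoopSystem.Used S b c)
    (h' : L.hoopSystem.Used S b' c) : b = b' := by
  have key : ∀ u v, L.Edge u v →
      L.hoopSystem.Used S (.edge u v 5) (.inc v (L.recv u v + 3)) →
      L.hoopSystem.Used S (.inc v (L.recv u v + 2)) (.inc v (L.recv u v + 3)) → False := by
    intro u v hE h1 h2
    have hs := L.recv_le hE
    refine not_used_pinch hS hb hle (.inc u v hE) ?_ ?_
    · have inv1 : ∀ {b c}, L.Arc b c → b = .edge u v 5 → c = .inc v (L.recv u v + 3) := by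
        intro b c h hc
        cases h <;> simp only [reduceCtorEq, Hoop.edge.injEq] at hc <;> grind
      have inv2 : ∀ {c d}, L.Arc c d → d = .edge u v 5 → c = .edge u v 4 := by
        intro c d h hc
        cases h <;> simp only [reduceCtorEq, Hoop.edge.injEq] at hc <;> grind
      rcases HoopSystem.exists_used_of_used_left hS hb hle h1 with ⟨d, hd', h3⟩ | ⟨b, h3⟩
      · exact absurd (inv1 h3.1 rfl) hd'
      · exact Or.inl ⟨_, inv2 h3.1 rfl ▸ h3⟩
    · have inv1 : ∀ {b c}, L.Arc b c → b = .inc v (L.recv u v + 2) →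
          c = .inc v (L.recv u v + 3) := by
        intro b c h hc
        cases h <;> simp only [reduceCtorEq, Hoop.inc.injEq] at hc <;> grind
      have inv2 : ∀ {c d}, L.Arc c d → d = .inc v (L.recv u v + 2) →
          c = .inc v (L.recv u v + 1) := by
        intro c d h hc
        cases h <;> simp only [reduceCtorEq, Hoop.inc.injEq] at hc
        · grind
        · rename_i w v' hE'
          obtain ⟨rfl, hc⟩ := hc
          by_cases hv : u = w
          · subst hv; omega
          · rcases L.recv_gap hE hE' hv with h' | h' <;> omega
      rcases HoopSystem.exists_used_of_used_left hS hb hle h2 with ⟨d, hd', h3⟩ | ⟨b, h3⟩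
      · exact absurd (inv1 h3.1 rfl) hd'
      · exact Or.inl ⟨_, inv2 h3.1 rfl ▸ h3⟩
  rcases Arc.left_cases h.1 h'.1 with e | ⟨u, v, hE, rfl, ⟨rfl, rfl⟩ | ⟨rfl, rfl⟩⟩
  · exact e
  · exact (key u v hE h h').elim
  · exact (key u v hE h' h).elim

/-- Every connected closed surface is a triangulated torus. -/
lemma exists_eq_gridComplex (hconn : IsConnected S) :
    ∃ (m : ℕ) (F : Grid m → Point V), Function.Injective F ∧ S = gridComplex F :=
  HoopSystem.exists_eq_gridComplex hS hb hle hconn (used_right_unique hS hb hle)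
    (used_left_unique hS hb hle)

lemma exists_used_right {c : Hoop V} (h : L.hoopSystem.UsedHoop S c) :
    ∃ d, L.hoopSystem.Used S c d := by
  rcases h with h | ⟨b, h⟩
  · exact h
  · rcases HoopSystem.exists_used_of_used_right hS hb hle h with ⟨b', hne, h'⟩ | h'
    · exact absurd (used_left_unique hS hb hle h' h) hne
    · exact h'

lemma usedHoop_mid_of_inc {v : V} (n k : ℕ) (hn : L.finish.inc v ≤ n + k)
    (h : L.hoopSystem.UsedHoop S (.inc v k)) : L.hoopSystem.UsedHoop S (.mid v) := by
  induction n generalizing k with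
  | zero =>
    obtain ⟨d, hd⟩ := exists_used_right hS hb hle h
    have inv : ∀ {c d}, L.Arc c d → c = .inc v k → d = .mid v := by
      intro c d h hc
      cases h <;> simp only [reduceCtorEq, Hoop.inc.injEq] at hc <;> grind
    exact Or.inr ⟨_, inv hd.1 rfl ▸ hd⟩
  | succ n ih =>
    obtain ⟨d, hd⟩ := exists_used_right hS hb hle h
    have inv : ∀ {c d}, L.Arc c d → c = .inc v k → d = .mid v ∨ d = .inc v (k + 1) := by
      intro c d h hc
      cases h <;> simp only [reduceCtorEq, Hoop.inc.injEq] at hc <;> grind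
    rcases inv hd.1 rfl with rfl | rfl
    · exact Or.inr ⟨_, hd⟩
    · exact ih (k + 1) (by omega) (Or.inr ⟨_, hd⟩)

lemma usedHoop_mid_of_edge {u v : V} {j : Fin 6} (n : ℕ) (hn : 5 = n + j.val)
    (h : L.hoopSystem.UsedHoop S (.edge u v j)) :
    L.Edge u v ∧ L.hoopSystem.UsedHoop S (.mid v) := by
  induction n generalizing j with
  | zero =>
    obtain ⟨d, hd⟩ := exists_used_right hS hb hle h
    have inv : ∀ {c d}, L.Arc c d → c = .edge u v j →
        L.Edge u v ∧ d = .inc v (L.recv u v + 3) := by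
      intro c d h hc
      cases h <;> simp only [reduceCtorEq, Hoop.edge.injEq] at hc <;> grind
    obtain ⟨hE, rfl⟩ := inv hd.1 rfl
    exact ⟨hE, usedHoop_mid_of_inc hS hb hle _ _ le_self_add (Or.inr ⟨_, hd⟩)⟩
  | succ n ih =>
    obtain ⟨d, hd⟩ := exists_used_right hS hb hle h
    have inv : ∀ {c d}, L.Arc c d → c = .edge u v j →
        ∃ j' : Fin 6, d = .edge u v j' ∧ j'.val = j.val + 1 := by
      intro c d h hc
      cases h <;> simp only [reduceCtorEq, Hoop.edge.injEq] at hc <;> grind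
    obtain ⟨j', rfl, hj'⟩ := inv hd.1 rfl
    exact ih (by omega) (Or.inr ⟨_, hd⟩)

lemma exists_edge_of_out {v : V} (k : ℕ) (h : L.hoopSystem.UsedHoop S (.out v k)) :
    ∃ w, L.Edge v w ∧ L.hoopSystem.UsedHoop S (.mid w) := by
  induction k with
  | zero =>
    obtain ⟨d, hd⟩ := exists_used_right hS hb hle h
    have inv : ∀ {c d}, L.Arc c d → c = .out v 0 → False := by
      intro c d h hc
      cases h <;> simp only [reduceCtorEq, Hoop.out.injEq] at hc <;> grind
    exact (inv hd.1 rfl).elim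
  | succ k ih =>
    obtain ⟨d, hd⟩ := exists_used_right hS hb hle h
    have inv : ∀ {c d}, L.Arc c d → c = .out v (k + 1) →
        (∃ w, d = .edge v w 0) ∨ d = .out v k := by
      intro c d h hc
      cases h <;> simp only [reduceCtorEq, Hoop.out.injEq] at hc
      · obtain ⟨rfl, hc⟩ := hc
        exact Or.inr (by grind)
      · obtain ⟨rfl, -⟩ := hc
        exact Or.inl ⟨_, rfl⟩
    rcases inv hd.1 rfl with ⟨w, rfl⟩ | rfl
    · exact ⟨w, usedHoop_mid_of_edge hS hb hle 5 rfl (Or.inr ⟨_, hd⟩)⟩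
    · exact ih (Or.inr ⟨_, hd⟩)

lemma exists_edge_of_mid {v : V} (h : L.hoopSystem.UsedHoop S (.mid v)) :
    ∃ w, L.Edge v w ∧ L.hoopSystem.UsedHoop S (.mid w) := by
  obtain ⟨d, hd⟩ := exists_used_right hS hb hle h
  have inv : ∀ {c d}, L.Arc c d → c = .mid v → d = .out v (L.finish.out v) := by
    intro c d h hc
    cases h <;> simp only [reduceCtorEq, Hoop.mid.injEq] at hc
    grind
  obtain rfl := inv hd.1 rfl
  exact exists_edge_of_out hS hb hle _ (Or.inr ⟨_, hd⟩)

/-- Going along the cylinders of a closed surface, one passes the gadgets of the vertices of a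
directed cycle. -/
lemma exists_directedCycle [Finite V] {D : Digraph V} (hE : L.Edge = D.Adj) (hne : S ≠ ⊥) :
    ∃ C : DirectedCycle D, ∀ v ∈ Set.range C.vert, {((Hoop.mid v, 0) : Point V)} ∈ S := by
  classical
  let A : Set V := {v | L.hoopSystem.UsedHoop S (.mid v)}
  have hA : A.Nonempty := by
    obtain ⟨s, hs⟩ : ∃ s, s ∈ S := by
      by_contra! h
      exact hne (PreAbstractSimplicialComplex.ext (Set.eq_empty_of_forall_notMem h))
    obtain ⟨c, d, i, hcd, -⟩ := HoopSystem.exists_used_of_mem hS hb hle hs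
    have hc : L.hoopSystem.UsedHoop S c := Or.inl ⟨d, hcd⟩
    cases c with
    | inc v k => exact ⟨v, usedHoop_mid_of_inc hS hb hle _ _ le_self_add hc⟩
    | out v k =>
      obtain ⟨w, -, hw⟩ := exists_edge_of_out hS hb hle _ hc
      exact ⟨w, hw⟩
    | mid v => exact ⟨v, hc⟩
    | edge u v j => exact ⟨v, (usedHoop_mid_of_edge hS hb hle (5 - j.val) (by omega) hc).2⟩
  have hnext : ∀ v : V, ∃ w, v ∈ A → L.Edge v w ∧ w ∈ A := by
    intro v
    by_cases hv : v ∈ A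
    · obtain ⟨w, hw⟩ := exists_edge_of_mid hS hb hle hv
      exact ⟨w, fun _ => hw⟩
    · exact ⟨v, fun h => absurd h hv⟩
  -- `τ` maps a vertex to the next vertex whose gadget is passed
  choose τ hτ using hnext
  have hmaps : Set.MapsTo τ A A := fun v hv => (hτ v hv).2
  obtain ⟨v, hv⟩ := hA
  obtain ⟨y, hyA, hy⟩ := exists_periodic (Set.toFinite A) hmaps hv
  obtain ⟨n, h, hinj, h0, hstep⟩ := exists_cyclic_enumeration hy
  have hhA : ∀ j, h j ∈ A := by
    intro j
    induction j using Fin.induction with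
    | zero => rw [h0]; exact hyA
    | succ j ih =>
      have := hstep j.castSucc
      rw [Fin.coeSucc_eq_succ] at this
      rw [this]
      exact hmaps ih
  refine ⟨⟨n, h, hinj, fun j => ?_⟩, ?_⟩
  · rw [hstep, ← hE]
    exact (hτ _ (hhA j)).1
  · rintro _ ⟨j, rfl⟩
    have hu : L.hoopSystem.UsedHoop S (.mid (h j)) := hhA j
    exact vertex_mem (hu.edge_mem 0) (by simp [hoopSystem, circ, pin])

end

/-- The vertex whose gadget is responsible for a hoop. -/
def owner : Hoop V → V
  | .inc v _ => v
  | .out v _ => v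
  | .mid v => v
  | .edge u _ _ => u

/-- The hoops along a directed cycle. -/
inductive CycleHoop (L : Layout V) {D : Digraph V} (C : DirectedCycle D) : Hoop V → Prop
  | inc (i : Fin (C.len + 1)) (k : ℕ) : L.recv (C.vert i) (C.vert (i + 1)) + 3 ≤ k →
      k ≤ L.finish.inc (C.vert (i + 1)) → L.CycleHoop C (.inc (C.vert (i + 1)) k)
  | mid (i : Fin (C.len + 1)) : L.CycleHoop C (.mid (C.vert i))
  | out (i : Fin (C.len + 1)) (k : ℕ) : L.emit (C.vert i) (C.vert (i + 1)) + 3 ≤ k →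
      k ≤ L.finish.out (C.vert i) → L.CycleHoop C (.out (C.vert i) k)
  | edge (i : Fin (C.len + 1)) (j : Fin 6) :
      L.CycleHoop C (.edge (C.vert i) (C.vert (i + 1)) j)

omit [DecidableEq V] in
lemma finite_cycleHoop {D : Digraph V} (C : DirectedCycle D) : {c | L.CycleHoop C c}.Finite := by
  refine (Set.finite_iUnion (ι := Fin (C.len + 1)) (f := fun i =>
    (Hoop.inc (C.vert (i + 1)) '' Set.Iic (L.finish.inc (C.vert (i + 1)))) ∪
    ({.mid (C.vert i)} ∪ ((Hoop.out (C.vert i) '' Set.Iic (L.finish.out (C.vert i))) ∪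
    Set.range (Hoop.edge (C.vert i) (C.vert (i + 1)))))) fun i => ?_).subset ?_
  · exact ((Set.finite_Iic _).image _).union ((Set.finite_singleton _).union
      (((Set.finite_Iic _).image _).union (Set.finite_range _)))
  · rintro _ (⟨i, k, -, h⟩ | ⟨i⟩ | ⟨i, k, -, h⟩ | ⟨i, j⟩) <;>
      refine Set.mem_iUnion.mpr ⟨i, ?_⟩
    · exact Or.inl ⟨k, h, rfl⟩
    · exact Or.inr (Or.inl rfl)
    · exact Or.inr (Or.inr (Or.inl ⟨k, h, rfl⟩))
    · exact Or.inr (Or.inr (Or.inr ⟨j, rfl⟩))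

/-- The hoops along a directed cycle form a torus. -/
lemma exists_gridComplex_le {D : Digraph V} (hE : L.Edge = D.Adj) (hJ : ∀ v, L.Joined v)
    (C : DirectedCycle D) :
    ∃ (m : ℕ) (F : Grid m → Point V), Function.Injective F ∧
      gridComplex F ≤ L.hoopSystem.complex ∧ ∀ x, owner (F x).1 ∈ Set.range C.vert := by
  classical
  have hEC : ∀ i, L.Edge (C.vert i) (C.vert (i + 1)) := fun i => by rw [hE]; exact C.adj i
  have hstart : ∀ i, ∃ d, L.CycleHoop C d ∧ L.Arc (.mid (C.vert i)) d := fun i =>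
    ⟨_, .out i _ (by have := L.emit_le (hEC i); omega) le_rfl, .mid_out _ (hJ _)⟩
  have hnext : ∀ c, ∃ d, L.CycleHoop C c → L.CycleHoop C d ∧ L.Arc c d := by
    intro c
    by_cases hc : L.CycleHoop C c
    swap
    · exact ⟨c, fun h => absurd h hc⟩
    suffices h : ∃ d, L.CycleHoop C d ∧ L.Arc c d by
      obtain ⟨d, hd⟩ := h
      exact ⟨d, fun _ => hd⟩
    obtain ⟨i, k, h1, h2⟩ | ⟨i⟩ | ⟨i, k, h1, h2⟩ | ⟨i, j⟩ := hc
    · have := L.le_recv (hEC i)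
      rcases h2.lt_or_eq with h2 | rfl
      · exact ⟨_, .inc i (k + 1) (by omega) h2, .inc _ _ (by omega) h2⟩
      · exact ⟨_, .mid _, .inc_mid _ (hJ _)⟩
    · exact hstart i
    · have := L.le_emit (hEC i)
      rcases h1.lt_or_eq with h1 | rfl
      · obtain ⟨k, rfl⟩ : ∃ k', k = k' + 1 := ⟨k - 1, by omega⟩
        exact ⟨_, .out i k (by omega) (by omega), .out _ _ (by omega) h2⟩
      · exact ⟨_, .edge i 0, .out_edge _ _ (hEC i)⟩
    · by_cases hj : j = 5
      · subst hj
        exact ⟨_, .inc i _ le_rfl (by have := L.recv_le (hEC i); omega), .edge_inc _ _ (hEC i)⟩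
      · have hlt : j.val + 1 < 6 := by omega
        exact ⟨_, .edge i ⟨j.val + 1, hlt⟩, .edge _ _ _ _ (hEC i) rfl⟩
  choose σ hσ using hnext
  have hinj : ∀ c, L.CycleHoop C c → ∀ c', L.CycleHoop C c' → ¬ L.Pinch c c' := by
    intro c hc c' hc' hp
    obtain ⟨u, v, hE'⟩ | ⟨u, v, hE'⟩ := hp
    · generalize e : Hoop.edge u v 1 = c at hc
      generalize e' : Hoop.out u (L.emit u v + 1) = c' at hc'
      cases hc with
      | edge i j =>
        cases hc' with
        | out i' k h1 h2 =>
          simp only [Hoop.edge.injEq, Hoop.out.injEq] at e e'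
          obtain ⟨rfl, rfl, -⟩ := e
          obtain ⟨e1, rfl⟩ := e'
          obtain rfl := C.injective e1
          omega
        | _ => simp at e'
      | _ => simp at e
    · generalize e : Hoop.edge u v 4 = c at hc
      generalize e' : Hoop.inc v (L.recv u v + 1) = c' at hc'
      cases hc with
      | edge i j =>
        cases hc' with
        | inc i' k h1 h2 =>
          simp only [Hoop.edge.injEq, Hoop.inc.injEq] at e e'
          obtain ⟨rfl, rfl, -⟩ := e
          obtain ⟨e1, rfl⟩ := e'
          obtain rfl := add_right_cancel (C.injective e1)
          omega
        | _ => simp at e'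
      | _ => simp at e
  obtain ⟨m, F, hF, hle, hU⟩ := HoopSystem.exists_gridComplex_le (X := L.hoopSystem)
    (U := {c | L.CycleHoop C c}) (σ := σ) (finite_cycleHoop C) ⟨_, .mid 0⟩
    (fun c hc => (hσ c hc).1) (fun c hc => (hσ c hc).2) (by
      intro c hc c' hc' i i' e
      obtain ⟨rfl, h | ⟨-, h | h⟩⟩ := circ_eq_circ ⟨_, Or.inl (hσ c hc).2⟩
        ⟨_, Or.inl (hσ c' hc').2⟩ e
      · rw [h]
      · exact absurd h (hinj c hc c' hc')
      · exact absurd h (hinj c' hc' c hc))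
  refine ⟨m, F, hF, hle, fun x => ?_⟩
  obtain ⟨c, hc, i, e⟩ := hU x
  rw [e]
  change owner (L.circ c i).1 ∈ _
  obtain ⟨i', k, h1, h2⟩ | ⟨i'⟩ | ⟨i', k, h1, h2⟩ | ⟨i', j⟩ := hc
  · rw [circ]; split_ifs <;> exact ⟨_, rfl⟩
  · rw [circ]; split_ifs <;> exact ⟨_, rfl⟩
  · rw [circ]; split_ifs <;> exact ⟨_, rfl⟩
  · simp only [circ, pin]; split_ifs <;> exact ⟨_, rfl⟩

end Layout

end ClosedSurfaces

/-! ### The triangles of the construction -/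

section Triangles

variable {V : Type}

lemma mem_tube [DecidableEq V] {f g : Fin 3 → Point V} {t : Finset (Point V)} :
    t ∈ tube f g ↔ ∃ i, t = {f i, f (i + 1), g (i + 1)} ∨ t = {f i, g i, g (i + 1)} := by
  simp [tube, Fin.exists_fin_succ, or_assoc]

lemma Layout.circ_inc (L : Layout V) (v : V) (k : ℕ) : L.circ (.inc v k) = ring (.inc v k) := by
  ext i <;> simp only [circ, pin, ring] <;> split_ifs with h <;> simp [h]

lemma Layout.circ_out (L : Layout V) (v : V) (k : ℕ) : L.circ (.out v k) = ring (.out v k) := by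
  ext i <;> simp only [circ, pin, ring] <;> split_ifs with h <;> simp [h]

lemma Layout.circ_mid (L : Layout V) (v : V) : L.circ (.mid v) = ring (.mid v) := by
  ext i <;> simp only [circ, pin, ring] <;> split_ifs with h <;> simp [h]

lemma Layout.circ_edge (L : Layout V) (u v : V) {j : Fin 6} (h1 : j ≠ 1) (h4 : j ≠ 4) :
    L.circ (.edge u v j) = ring (.edge u v j) := by
  ext i <;> simp only [circ, pin, ring, if_neg h1, if_neg h4] <;> split_ifs with h <;> simp [h]

lemma Layout.circ_edge_one (L : Layout V) (u v : V) :
    L.circ (.edge u v 1) = pinched (.edge u v 1) (.out u (L.emit u v + 1)) := by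
  funext i
  by_cases h : i = 0
  · subst h; simp [circ, pin, pinched]
  · simp [circ, pinched, ring, h]

lemma Layout.circ_edge_four (L : Layout V) (u v : V) :
    L.circ (.edge u v 4) = pinched (.edge u v 4) (.inc v (L.recv u v + 1)) := by
  funext i
  by_cases h : i = 0
  · subst h; simp [circ, pin, pinched]
  · simp [circ, pinched, ring, h]

variable [DecidableEq V]

/-- The list `Φ` consists of the triangles of the layout. -/
def Layout.Draws (L : Layout V) (Φ : List (Finset (Point V))) : Prop :=
  ∀ t, t ∈ Φ ↔ ∃ c d, L.Arc c d ∧ t ∈ tube (L.circ c) (L.circ d)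

lemma Layout.Draws.generated_eq {L : Layout V} {Φ : List (Finset (Point V))} (h : L.Draws Φ) :
    generated Φ = L.hoopSystem.complex := by
  refine PreAbstractSimplicialComplex.ext (Set.ext fun s => ?_)
  change s ∈ closure Φ ↔ s.Nonempty ∧ ∃ c d i, L.Arc c d ∧ _
  simp only [closure, Finset.mem_biUnion, List.mem_toFinset, Finset.mem_erase,
    Finset.mem_powerset, Finset.nonempty_iff_ne_empty, h _, mem_tube]
  constructor
  · rintro ⟨t, ⟨c, d, hcd, i, ht⟩, hs, hst⟩
    exact ⟨hs, c, d, i, hcd, ht.imp (fun e => hst.trans_eq e) (fun e => hst.trans_eq e)⟩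
  · rintro ⟨hs, c, d, i, hcd, h | h⟩
    · exact ⟨_, ⟨c, d, hcd, i, Or.inl rfl⟩, hs, h⟩
    · exact ⟨_, ⟨c, d, hcd, i, Or.inr rfl⟩, hs, h⟩

/-- The list `Φ` consists of the triangles of a layout with the given data: the last hoops change from
`s` to `s'`, the gadgets of the edges in `E` are attached, and the gadgets of the vertices in `J` are
completed. The positions of the edge gadgets do not matter. -/
def Drawn (s s' : Tops V) (E : V → V → Prop) (J : V → Prop) (Φ : List (Finset (Point V))) : Prop :=
  ∃ L : Layout V, L.start = s ∧ L.finish = s' ∧ L.Edge = E ∧ L.Joined = J ∧ L.Draws Φ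

namespace Drawn

variable {s s' s'' : Tops V} {E E' : V → V → Prop} {J J' : V → Prop}
  {Φ Φ' : List (Finset (Point V))}

lemma congr (h : Drawn s s' E J Φ) (hE : ∀ u v, E u v ↔ E' u v) (hJ : ∀ v, J v ↔ J' v)
    (hΦ : ∀ t, t ∈ Φ ↔ t ∈ Φ') : Drawn s s' E' J' Φ' := by
  obtain ⟨L, h1, h2, h3, h4, h5⟩ := h
  exact ⟨L, h1, h2, h3.trans (by ext; exact hE _ _), h4.trans (by ext; exact hJ _),
    fun t => (hΦ t).symm.trans (h5 t)⟩

lemma nil (s : Tops V) : Drawn s s (fun _ _ => False) (fun _ => False) [] := by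
  refine ⟨⟨s, s, _, _, fun _ _ => 0, fun _ _ => 0, fun _ => le_rfl, fun _ => le_rfl,
    False.elim, False.elim, False.elim, False.elim, False.elim, False.elim⟩, rfl, rfl, rfl, rfl,
    fun t => ?_⟩
  simp only [List.not_mem_nil, false_iff]
  rintro ⟨c, d, h, -⟩
  cases h <;> first | contradiction | exact absurd (lt_of_le_of_lt ‹_› ‹_›) (lt_irrefl _)

/-- A layout can be continued by another one, provided that no edge is attached twice and that
nothing is added to gadgets that are complete. -/
lemma comp (h : Drawn s s' E J Φ) (h' : Drawn s' s'' E' J' Φ') (hE : ∀ u v, E u v → ¬ E' u v)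
    (hJ : ∀ v, J v → s''.inc v = s'.inc v ∧ s''.out v = s'.out v) :
    Drawn s s'' (fun u v => E u v ∨ E' u v) (fun v => J v ∨ J' v) (Φ ++ Φ') := by
  classical
  obtain ⟨L, rfl, rfl, rfl, rfl, hL⟩ := h
  obtain ⟨L', hs, rfl, rfl, rfl, hL'⟩ := h'
  have hinc : ∀ v, L'.start.inc v = L.finish.inc v := fun v => by rw [hs]
  have hout : ∀ v, L'.start.out v = L.finish.out v := fun v => by rw [hs]
  have hE' : ∀ {u v}, L'.Edge u v → ¬ L.Edge u v := fun h' h => hE _ _ h h'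
  let M : Layout V :=
    { start := L.start
      finish := L'.finish
      Edge := fun u v => L.Edge u v ∨ L'.Edge u v
      Joined := fun v => L.Joined v ∨ L'.Joined v
      emit := fun u v => if L.Edge u v then L.emit u v else L'.emit u v
      recv := fun u v => if L.Edge u v then L.recv u v else L'.recv u v
      inc_le := fun v => (L.inc_le v).trans ((hinc v).symm.le.trans (L'.inc_le v))
      out_le := fun v => (L.out_le v).trans ((hout v).symm.le.trans (L'.out_le v))
      le_emit := by
        rintro u v (h | h)
        · simp only [h, if_true]; exact L.le_emit h
        · simp only [hE' h, if_false]
          have := L'.le_emit h; have := L.out_le u; have := hout u; omega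
      emit_le := by
        rintro u v (h | h)
        · simp only [h, if_true]
          have := L.emit_le h; have := L'.out_le u; have := hout u; omega
        · simp only [hE' h, if_false]; exact L'.emit_le h
      le_recv := by
        rintro u v (h | h)
        · simp only [h, if_true]; exact L.le_recv h
        · simp only [hE' h, if_false]
          have := L'.le_recv h; have := L.inc_le v; have := hinc v; omega
      recv_le := by
        rintro u v (h | h)
        · simp only [h, if_true]
          have := L.recv_le h; have := L'.inc_le v; have := hinc v; omega
        · simp only [hE' h, if_false]; exact L'.recv_le h
      emit_gap := by
        rintro u v v' (h | h) (h' | h') hne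
        · simp only [h, h', if_true]; exact L.emit_gap h h' hne
        · simp only [h, hE' h', if_true, if_false]
          have := L.emit_le h; have := L'.le_emit h'; have := hout u; omega
        · simp only [hE' h, h', if_true, if_false]
          have := L.emit_le h'; have := L'.le_emit h; have := hout u; omega
        · simp only [hE' h, hE' h', if_false]; exact L'.emit_gap h h' hne
      recv_gap := by
        rintro u u' v (h | h) (h' | h') hne
        · simp only [h, h', if_true]; exact L.recv_gap h h' hne
        · simp only [h, hE' h', if_true, if_false]
          have := L.recv_le h; have := L'.le_recv h'; have := hinc v; omega
        · simp only [hE' h, h', if_true, if_false]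
          have := L.recv_le h'; have := L'.le_recv h; have := hinc v; omega
        · simp only [hE' h, hE' h', if_false]; exact L'.recv_gap h h' hne }
  -- the touching points in the two parts do not change
  have hcirc : ∀ {c}, L.OnArc c → M.circ c = L.circ c := by
    intro c hc
    cases c with
    | edge u v j =>
      have he : M.emit u v = L.emit u v := if_pos hc.edge
      have hr : M.recv u v = L.recv u v := if_pos hc.edge
      ext i <;> simp only [Layout.circ, Layout.pin, he, hr]
    | _ => rfl
  have hcirc' : ∀ {c}, L'.OnArc c → M.circ c = L'.circ c := by
    intro c hc
    cases c with
    | edge u v j =>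
      have he : M.emit u v = L'.emit u v := if_neg (hE' hc.edge)
      have hr : M.recv u v = L'.recv u v := if_neg (hE' hc.edge)
      ext i <;> simp only [Layout.circ, Layout.pin, he, hr]
    | _ => rfl
  have hemit : ∀ {u v}, L.Edge u v → M.emit u v = L.emit u v := fun h => if_pos h
  have hrecv : ∀ {u v}, L.Edge u v → M.recv u v = L.recv u v := fun h => if_pos h
  have hemit' : ∀ {u v}, L'.Edge u v → M.emit u v = L'.emit u v := fun h => if_neg (hE' h)
  have hrecv' : ∀ {u v}, L'.Edge u v → M.recv u v = L'.recv u v := fun h => if_neg (hE' h)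
  have harc : ∀ c d, M.Arc c d ↔ L.Arc c d ∨ L'.Arc c d := by
    intro c d
    constructor
    · intro h
      cases h with
      | inc v k h1 h2 =>
        by_cases hk : k < L.finish.inc v
        · exact Or.inl (.inc v k h1 hk)
        · exact Or.inr (.inc v k (by rw [hinc]; omega) h2)
      | out v k h1 h2 =>
        by_cases hk : k < L.finish.out v
        · exact Or.inl (.out v k h1 hk)
        · exact Or.inr (.out v k (by rw [hout]; omega) h2)
      | inc_mid v h =>
        rcases h with h | h
        · left
          change L.Arc (.inc v (L'.finish.inc v)) _
          rw [(hJ v h).1]; exact .inc_mid v h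
        · exact Or.inr (.inc_mid v h)
      | mid_out v h =>
        rcases h with h | h
        · left
          change L.Arc _ (.out v (L'.finish.out v))
          rw [(hJ v h).2]; exact .mid_out v h
        · exact Or.inr (.mid_out v h)
      | out_edge u v h =>
        rcases h with h | h
        · rw [hemit h]; exact Or.inl (.out_edge u v h)
        · rw [hemit' h]; exact Or.inr (.out_edge u v h)
      | edge u v j j' h hj =>
        exact h.imp (fun h => .edge u v j j' h hj) (fun h => .edge u v j j' h hj)
      | edge_inc u v h =>
        rcases h with h | h
        · rw [hrecv h]; exact Or.inl (.edge_inc u v h)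
        · rw [hrecv' h]; exact Or.inr (.edge_inc u v h)
    · rintro (h | h)
      · cases h with
        | inc v k h1 h2 =>
          exact .inc v k h1 (h2.trans_le ((hinc v).symm.le.trans (L'.inc_le v)))
        | out v k h1 h2 =>
          exact .out v k h1 (h2.trans_le ((hout v).symm.le.trans (L'.out_le v)))
        | inc_mid v h => rw [← (hJ v h).1]; exact .inc_mid (L := M) v (Or.inl h)
        | mid_out v h => rw [← (hJ v h).2]; exact .mid_out (L := M) v (Or.inl h)
        | out_edge u v h => rw [← hemit h]; exact .out_edge (L := M) u v (Or.inl h)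
        | edge u v j j' h hj => exact .edge (L := M) u v j j' (Or.inl h) hj
        | edge_inc u v h => rw [← hrecv h]; exact .edge_inc (L := M) u v (Or.inl h)
      · cases h with
        | inc v k h1 h2 => exact .inc (L := M) v k ((L.inc_le v).trans ((hinc v).symm.le.trans h1)) h2
        | out v k h1 h2 => exact .out (L := M) v k ((L.out_le v).trans ((hout v).symm.le.trans h1)) h2
        | inc_mid v h => exact .inc_mid (L := M) v (Or.inr h)
        | mid_out v h => exact .mid_out (L := M) v (Or.inr h)
        | out_edge u v h => rw [← hemit' h]; exact .out_edge (L := M) u v (Or.inr h)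
        | edge u v j j' h hj => exact .edge (L := M) u v j j' (Or.inr h) hj
        | edge_inc u v h => rw [← hrecv' h]; exact .edge_inc (L := M) u v (Or.inr h)
  refine ⟨M, rfl, rfl, rfl, rfl, fun t => ?_⟩
  rw [List.mem_append, hL t, hL' t]
  constructor
  · rintro (⟨c, d, h, ht⟩ | ⟨c, d, h, ht⟩)
    · exact ⟨c, d, (harc c d).mpr (Or.inl h), by
        rwa [hcirc ⟨d, Or.inl h⟩, hcirc ⟨c, Or.inr h⟩]⟩
    · exact ⟨c, d, (harc c d).mpr (Or.inr h), by
        rwa [hcirc' ⟨d, Or.inl h⟩, hcirc' ⟨c, Or.inr h⟩]⟩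
  · rintro ⟨c, d, h, ht⟩
    refine ((harc c d).mp h).imp (fun h => ⟨c, d, h, ?_⟩) (fun h => ⟨c, d, h, ?_⟩)
    · rwa [hcirc ⟨d, Or.inl h⟩, hcirc ⟨c, Or.inr h⟩] at ht
    · rwa [hcirc' ⟨d, Or.inl h⟩, hcirc' ⟨c, Or.inr h⟩] at ht

end Drawn

lemma tubes_pair (f g : Fin 3 → Point V) : tubes [f, g] = tube f g := by
  simp [tubes]

lemma drawn_pad (x : V) (s : Tops V) :
    Drawn s (pad x s).val.tops (fun _ _ => False) (fun _ => False) (pad x s).val.facets := by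
  let M : Layout V := ⟨s, (pad x s).val.tops, fun _ _ => False, fun _ => False, fun _ _ => 0,
    fun _ _ => 0, ?_, ?_, False.elim, False.elim, False.elim, False.elim, False.elim, False.elim⟩
  · refine ⟨M, rfl, rfl, rfl, rfl, fun t => ?_⟩
    change t ∈ tubes _ ++ tubes _ ↔ _
    rw [tubes_pair, tubes_pair, List.mem_append]
    constructor
    · rintro (h | h)
      · exact ⟨_, _, .inc x (s.inc x) le_rfl (by simp [M, pad, bind, pure, Timed.look, Timed.store]),
          by rwa [M.circ_inc, M.circ_inc]⟩
      · exact ⟨_, _, .out x (s.out x) le_rfl (by simp [M, pad, bind, pure, Timed.look, Timed.store]),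
          by rwa [M.circ_out, M.circ_out]⟩
    · rintro ⟨c, d, h, ht⟩
      cases h with
      | inc v k h1 h2 =>
        change s.inc v ≤ k at h1
        change k < Function.update s.inc x _ v at h2
        rw [M.circ_inc, M.circ_inc] at ht
        by_cases hv : v = x
        · subst hv
          rw [Function.update_self] at h2
          change k < s.inc v + 1 at h2
          obtain rfl : k = s.inc v := by omega
          exact Or.inl ht
        · rw [Function.update_of_ne hv] at h2; omega
      | out v k h1 h2 =>
        change s.out v ≤ k at h1
        change k < Function.update s.out x _ v at h2
        rw [M.circ_out, M.circ_out] at ht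
        by_cases hv : v = x
        · subst hv
          rw [Function.update_self] at h2
          change k < s.out v + 1 at h2
          obtain rfl : k = s.out v := by omega
          exact Or.inr ht
        · rw [Function.update_of_ne hv] at h2; omega
      | _ => contradiction
  · intro v
    change _ ≤ Function.update s.inc x (s.inc x + 1) v
    by_cases h : v = x
    · subst h; simp
    · simp [h]
  · intro v
    change _ ≤ Function.update s.out x (s.out x + 1) v
    by_cases h : v = x
    · subst h; simp
    · simp [h]

lemma mem_attach_facets {u v : V} {s : Tops V} {t : Finset (Point V)} :
    t ∈ (attach u v s).val.facets ↔
      (∃ j < 4, t ∈ tube (ring (.out u (s.out u + j + 1))) (ring (.out u (s.out u + j)))) ∨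
      (t ∈ tube (ring (.out u (s.out u + 3))) (ring (.edge u v 0)) ∨
        t ∈ tube (ring (.edge u v 0)) (pinched (.edge u v 1) (.out u (s.out u + 1))) ∨
        t ∈ tube (pinched (.edge u v 1) (.out u (s.out u + 1))) (ring (.edge u v 2)) ∨
        t ∈ tube (ring (.edge u v 2)) (ring (.edge u v 3)) ∨
        t ∈ tube (ring (.edge u v 3)) (pinched (.edge u v 4) (.inc v (s.inc v + 1))) ∨
        t ∈ tube (pinched (.edge u v 4) (.inc v (s.inc v + 1))) (ring (.edge u v 5)) ∨
        t ∈ tube (ring (.edge u v 5)) (ring (.inc v (s.inc v + 3)))) ∨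
      ∃ j < 4, t ∈ tube (ring (.inc v (s.inc v + j))) (ring (.inc v (s.inc v + j + 1))) := by
  have four : ∀ p : ℕ → Prop, (∃ j < 4, p j) ↔ p 0 ∨ p 1 ∨ p 2 ∨ p 3 := by
    intro p
    constructor
    · rintro ⟨j, hj, h⟩
      interval_cases j <;> simp [h]
    · rintro (h | h | h | h)
      exacts [⟨0, by omega, h⟩, ⟨1, by omega, h⟩, ⟨2, by omega, h⟩, ⟨3, by omega, h⟩]
  have four' : ∀ p : ℕ → Prop, (∃ j < 4, p j) ↔ p 3 ∨ p 2 ∨ p 1 ∨ p 0 := by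
    intro p
    rw [four]
    tauto
  change t ∈ (tubes _ ++ tubes _) ++ tubes _ ↔ _
  rw [List.mem_append, List.mem_append, or_assoc, four', four]
  simp only [tubes, List.mem_append, List.not_mem_nil, or_false]
  rfl

lemma drawn_attach (u v : V) (s : Tops V) :
    Drawn s (attach u v s).val.tops (fun a b => a = u ∧ b = v) (fun _ => False)
      (attach u v s).val.facets := by
  have hi : ∀ x, (attach u v s).val.tops.inc x = Function.update s.inc v (s.inc v + 4) x :=
    fun x => rfl
  have ho : ∀ x, (attach u v s).val.tops.out x = Function.update s.out u (s.out u + 4) x :=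
    fun x => rfl
  let M : Layout V := ⟨s, (attach u v s).val.tops, fun a b => a = u ∧ b = v, fun _ => False,
    fun _ _ => s.out u, fun _ _ => s.inc v, ?_, ?_, ?_, ?_, ?_, ?_, ?_, ?_⟩
  rotate_left
  · intro x; rw [hi]; by_cases h : x = v
    · subst h; simp
    · simp [h]
  · intro x; rw [ho]; by_cases h : x = u
    · subst h; simp
    · simp [h]
  · rintro a b ⟨rfl, rfl⟩; exact le_rfl
  · rintro a b ⟨rfl, rfl⟩; rw [ho]; simp
  · rintro a b ⟨rfl, rfl⟩; exact le_rfl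
  · rintro a b ⟨rfl, rfl⟩; rw [hi]; simp
  · rintro a b b' ⟨rfl, rfl⟩ ⟨-, rfl⟩ h; exact absurd rfl h
  · rintro a b b' ⟨rfl, rfl⟩ ⟨rfl, -⟩ h; exact absurd rfl h
  refine ⟨M, rfl, rfl, rfl, rfl, fun t => ?_⟩
  have c1 := M.circ_edge_one u v
  have c4 := M.circ_edge_four u v
  change M.circ (.edge u v 1) = pinched _ (.out u (s.out u + 1)) at c1
  change M.circ (.edge u v 4) = pinched _ (.inc v (s.inc v + 1)) at c4
  rw [mem_attach_facets, ← c1, ← c4]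
  have hE : M.Edge u v := ⟨rfl, rfl⟩
  have e : ∀ {j j' : Fin 6}, j'.val = j.val + 1 → M.Arc (.edge u v j) (.edge u v j') :=
    fun h => .edge u v _ _ hE h
  have c0 := M.circ_edge u v (j := 0) (by decide) (by decide)
  have c2 := M.circ_edge u v (j := 2) (by decide) (by decide)
  have c3 := M.circ_edge u v (j := 3) (by decide) (by decide)
  have c5 := M.circ_edge u v (j := 5) (by decide) (by decide)
  constructor
  · rintro (⟨j, hj, h⟩ | (h | h | h | h | h | h | h) | ⟨j, hj, h⟩)
    · exact ⟨_, _, .out u (s.out u + j) (Nat.le_add_right _ _) (by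
        change _ < (attach u v s).val.tops.out u
        rw [ho, Function.update_self]; omega), by rwa [M.circ_out, M.circ_out]⟩
    · exact ⟨_, _, .out_edge u v hE, by rwa [M.circ_out, c0]⟩
    · exact ⟨_, _, e (j := 0) (j' := 1) rfl, by rwa [c0]⟩
    · exact ⟨_, _, e (j := 1) (j' := 2) rfl, by rwa [c2]⟩
    · exact ⟨_, _, e (j := 2) (j' := 3) rfl, by rwa [c2, c3]⟩
    · exact ⟨_, _, e (j := 3) (j' := 4) rfl, by rwa [c3]⟩
    · exact ⟨_, _, e (j := 4) (j' := 5) rfl, by rwa [c5]⟩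
    · exact ⟨_, _, .edge_inc u v hE, by rwa [c5, M.circ_inc]⟩
    · exact ⟨_, _, .inc v (s.inc v + j) (Nat.le_add_right _ _) (by
        change _ < (attach u v s).val.tops.inc v
        rw [hi, Function.update_self]; omega), by rwa [M.circ_inc, M.circ_inc]⟩
  · rintro ⟨c, d, h, ht⟩
    cases h with
    | inc x k h1 h2 =>
      change s.inc x ≤ k at h1
      change k < (attach u v s).val.tops.inc x at h2
      rw [hi] at h2
      rw [M.circ_inc, M.circ_inc] at ht
      by_cases hx : x = v
      · subst hx
        rw [Function.update_self] at h2
        obtain ⟨j, rfl⟩ := Nat.exists_eq_add_of_le h1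
        exact Or.inr (Or.inr ⟨j, by omega, ht⟩)
      · rw [Function.update_of_ne hx] at h2; omega
    | out x k h1 h2 =>
      change s.out x ≤ k at h1
      change k < (attach u v s).val.tops.out x at h2
      rw [ho] at h2
      rw [M.circ_out, M.circ_out] at ht
      by_cases hx : x = u
      · subst hx
        rw [Function.update_self] at h2
        obtain ⟨j, rfl⟩ := Nat.exists_eq_add_of_le h1
        exact Or.inl ⟨j, by omega, ht⟩
      · rw [Function.update_of_ne hx] at h2; omega
    | inc_mid _ h => exact h.elim
    | mid_out _ h => exact h.elim
    | out_edge a b h =>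
      obtain ⟨rfl, rfl⟩ := h
      rw [M.circ_out, c0] at ht
      exact Or.inr (Or.inl (Or.inl ht))
    | edge a b j j' h hj =>
      obtain ⟨rfl, rfl⟩ := h
      refine Or.inr (Or.inl (Or.inr ?_))
      have hj' : j' = j + 1 := by ext; simp only [Fin.val_add]; omega
      subst hj'
      fin_cases j
      · rw [show M.circ (.edge a b ⟨0, _⟩) = _ from c0] at ht; exact Or.inl ht
      · rw [show M.circ (.edge a b (⟨1, _⟩ + 1)) = _ from c2] at ht; exact Or.inr (Or.inl ht)
      · rw [show M.circ (.edge a b (⟨2, _⟩ + 1)) = _ from c3,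
          show M.circ (.edge a b ⟨2, _⟩) = _ from c2] at ht
        exact Or.inr (Or.inr (Or.inl ht))
      · rw [show M.circ (.edge a b ⟨3, _⟩) = _ from c3] at ht
        exact Or.inr (Or.inr (Or.inr (Or.inl ht)))
      · rw [show M.circ (.edge a b (⟨4, _⟩ + 1)) = _ from c5] at ht
        exact Or.inr (Or.inr (Or.inr (Or.inr (Or.inl ht))))
      · simp at hj
    | edge_inc a b h =>
      obtain ⟨rfl, rfl⟩ := h
      rw [M.circ_inc, c5] at ht
      exact Or.inr (Or.inl (Or.inr (Or.inr (Or.inr (Or.inr (Or.inr (Or.inr ht)))))))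

lemma drawn_join (w : V) (s : Tops V) :
    Drawn s s (fun _ _ => False) (fun v => v = w) (join w s).val := by
  let M : Layout V := ⟨s, s, fun _ _ => False, fun v => v = w, fun _ _ => 0,
    fun _ _ => 0, fun _ => le_rfl, fun _ => le_rfl, False.elim, False.elim, False.elim,
    False.elim, False.elim, False.elim⟩
  refine ⟨M, rfl, rfl, rfl, rfl, fun t => ?_⟩
  change t ∈ tubes _ ↔ _
  simp only [tubes, List.mem_append, List.not_mem_nil, or_false]
  constructor
  · rintro (h | h)
    · exact ⟨_, _, .inc_mid w rfl, by rwa [M.circ_inc, M.circ_mid]⟩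
    · exact ⟨_, _, .mid_out w rfl, by rwa [M.circ_out, M.circ_mid]⟩
  · rintro ⟨c, d, h, ht⟩
    cases h with
    | inc v k h1 h2 => exact absurd (h1.trans_lt h2) (lt_irrefl _)
    | out v k h1 h2 => exact absurd (h1.trans_lt h2) (lt_irrefl _)
    | inc_mid v h =>
      change v = w at h
      rw [M.circ_inc, M.circ_mid, h] at ht
      exact Or.inl ht
    | mid_out v h =>
      change v = w at h
      rw [M.circ_out, M.circ_mid, h] at ht
      exact Or.inr ht
    | _ => contradiction

end Triangles

/-! ### The induction along the path decomposition -/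

section Induction

variable {V : Type} [DecidableEq V]

/-- Each element occurs in a contiguous part of the list of bags. -/
def IsConvex {α : Type*} (bags : List (Finset α)) : Prop :=
  ∀ a i j k, i ≤ j → j ≤ k → a ∈ bags.getD i ∅ → a ∈ bags.getD k ∅ → a ∈ bags.getD j ∅

lemma exists_mem_getD {α : Type*} {bags : List (Finset α)} {a : α} :
    (∃ i, a ∈ bags.getD i ∅) ↔ ∃ B ∈ bags, a ∈ B := by
  constructor
  · rintro ⟨i, hi⟩
    by_cases h : i < bags.length
    · rw [List.getD_eq_getElem _ _ h] at hi
      exact ⟨_, List.getElem_mem h, hi⟩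
    · rw [List.getD_eq_default _ _ (not_lt.mp h)] at hi
      simp at hi
  · rintro ⟨B, hB, ha⟩
    obtain ⟨i, h, rfl⟩ := List.getElem_of_mem hB
    exact ⟨i, by rwa [List.getD_eq_getElem _ _ h]⟩

lemma isConvex_cons {α : Type*} {x y : Finset α} {bags : List (Finset α)} :
    IsConvex (x :: y :: bags) ↔
      IsConvex (y :: bags) ∧ ∀ a ∈ x, (∃ B ∈ y :: bags, a ∈ B) → a ∈ y := by
  constructor
  · intro h
    refine ⟨fun a i j k hij hjk hi hk => h a (i + 1) (j + 1) (k + 1) (by omega) (by omega) hi hk,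
      fun a ha hB => ?_⟩
    obtain ⟨k, hk⟩ := exists_mem_getD.mpr hB
    exact h a 0 1 (k + 1) (by omega) (by omega) ha hk
  · rintro ⟨h1, h2⟩ a i j k hij hjk hi hk
    rcases j with - | j
    · obtain rfl : i = 0 := by omega
      exact hi
    obtain ⟨k, rfl⟩ : ∃ k', k = k' + 1 := ⟨k - 1, by omega⟩
    rcases i with - | i
    · exact h1 a 0 j k (by omega) (by omega) (h2 a hi (exists_mem_getD.mp ⟨k, hk⟩)) hk
    · exact h1 a i j k (by omega) (by omega) hi hk

lemma isConvex_singleton {α : Type*} (x : Finset α) : IsConvex [x] := by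
  intro a i j k hij hjk hi hk
  obtain rfl : k = 0 := by
    by_contra h
    rw [List.getD_eq_default _ _ (by simp; omega)] at hk
    simp at hk
  obtain rfl : j = 0 := by omega
  exact hk

variable {D : Digraph V}

/-- The vertex lies in the current bag or in a later one. -/
def Alive (bag : List V) (ms : List (Move V)) (v : V) : Prop :=
  ∃ B ∈ bagsFrom bag ms, v ∈ B

lemma alive_of_mem {bag : List V} {ms : List (Move V)} {v : V} (h : v ∈ bag) :
    Alive bag ms v := by
  cases ms <;> exact ⟨bag, by simp [bagsFrom], h⟩

lemma alive_cons {bag : List V} {m : Move V} {ms : List (Move V)} {v : V} :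
    Alive bag (m :: ms) v ↔ v ∈ bag ∨ Alive (m.apply bag) ms v := by
  simp [Alive, bagsFrom]

/-- The list `ms` is the part of a nice path decomposition that remains from the bag `bag` on. Edges
that have lost an end are not covered any more. -/
structure Good (D : Digraph V) (bag : List V) (ms : List (Move V)) : Prop where
  legal : Legal bag ms
  nodup : bag.Nodup
  convex : IsConvex ((bagsFrom bag ms).map List.toFinset)
  cover : ∀ u v, Alive bag ms u → Alive bag ms v → D.Adj u v →
    ∃ B ∈ bagsFrom bag ms, u ∈ B ∧ v ∈ B

lemma NicePathDecomposition.good (P : NicePathDecomposition D) : Good D [] P.moves where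
  legal := P.legal
  nodup := List.nodup_nil
  convex := P.isPathDecomposition.connected
  cover u v _ _ h := by
    obtain ⟨B, hB, hu, hv⟩ := P.isPathDecomposition.edges u v h
    obtain ⟨B, hB', rfl⟩ := List.mem_map.mp hB
    exact ⟨B, hB', List.mem_toFinset.mp hu, List.mem_toFinset.mp hv⟩

lemma NicePathDecomposition.alive (P : NicePathDecomposition D) (v : V) :
    Alive [] P.moves v := by
  obtain ⟨B, hB, hv⟩ := (P.isPathDecomposition.vertices v).mp (Set.mem_univ v)
  obtain ⟨B, hB', rfl⟩ := List.mem_map.mp hB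
  exact ⟨B, hB', List.mem_toFinset.mp hv⟩

namespace Good

variable {bag : List V} {ms : List (Move V)}

lemma convex_tail {m : Move V} (h : Good D bag (m :: ms)) :
    IsConvex ((bagsFrom (m.apply bag) ms).map List.toFinset) ∧
      ∀ v ∈ bag, Alive (m.apply bag) ms v → v ∈ m.apply bag := by
  have := h.convex
  obtain ⟨L, hL⟩ : ∃ L, bagsFrom (m.apply bag) ms = m.apply bag :: L := by
    cases ms <;> exact ⟨_, rfl⟩
  rw [bagsFrom, hL, List.map_cons, List.map_cons, isConvex_cons] at this
  refine ⟨by rw [hL]; exact this.1, fun v hv ⟨B, hB, hvB⟩ => ?_⟩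
  rw [hL] at hB
  have := this.2 v (List.mem_toFinset.mpr hv)
    ⟨B.toFinset, by rw [← List.map_cons]; exact List.mem_map_of_mem hB, List.mem_toFinset.mpr hvB⟩
  exact List.mem_toFinset.mp this

lemma introduce {w : V} (h : Good D bag (.introduce w :: ms)) : Good D (w :: bag) ms where
  legal := h.legal.2
  nodup := List.nodup_cons.mpr ⟨h.legal.1, h.nodup⟩
  convex := h.convex_tail.1
  cover u v hu hv huv := by
    obtain ⟨B, hB, huB, hvB⟩ := h.cover u v (alive_cons.mpr (Or.inr hu))
      (alive_cons.mpr (Or.inr hv)) huv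
    rcases List.mem_cons.mp hB with rfl | hB
    · obtain ⟨L, hL⟩ : ∃ L, bagsFrom (w :: B) ms = (w :: B) :: L := by
        cases ms <;> exact ⟨_, rfl⟩
      exact ⟨w :: B, by rw [hL]; exact List.mem_cons_self,
        List.mem_cons_of_mem _ huB, List.mem_cons_of_mem _ hvB⟩
    · exact ⟨B, hB, huB, hvB⟩

lemma not_alive_of_forget {w : V} (h : Good D bag (.forget w :: ms)) :
    ¬ Alive (bag.erase w) ms w := fun h' =>
  h.nodup.not_mem_erase (h.convex_tail.2 w h.legal.1 h')

lemma forget {w : V} (h : Good D bag (.forget w :: ms)) : Good D (bag.erase w) ms where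
  legal := h.legal.2
  nodup := h.nodup.erase w
  convex := h.convex_tail.1
  cover u v hu hv huv := by
    obtain ⟨B, hB, huB, hvB⟩ := h.cover u v (alive_cons.mpr (Or.inr hu))
      (alive_cons.mpr (Or.inr hv)) huv
    rcases List.mem_cons.mp hB with rfl | hB
    · obtain ⟨L, hL⟩ : ∃ L, bagsFrom (B.erase w) ms = (B.erase w) :: L := by
        cases ms <;> exact ⟨_, rfl⟩
      exact ⟨B.erase w, by rw [hL]; exact List.mem_cons_self,
        h.convex_tail.2 u huB hu, h.convex_tail.2 v hvB hv⟩
    · exact ⟨B, hB, huB, hvB⟩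

lemma alive_introduce {w : V} {v : V} :
    Alive bag (.introduce w :: ms) v ↔ Alive (w :: bag) ms v := by
  rw [alive_cons]
  exact or_iff_right_of_imp fun h => alive_of_mem (List.mem_cons_of_mem _ h)

lemma alive_forget {w : V} (h : Good D bag (.forget w :: ms)) {v : V} :
    Alive bag (.forget w :: ms) v ↔ v = w ∨ Alive (bag.erase w) ms v := by
  rw [alive_cons]
  constructor
  · rintro (hv | hv)
    · by_cases e : v = w
      · exact Or.inl e
      · exact Or.inr (alive_of_mem ((List.mem_erase_of_ne e).mpr hv))
    · exact Or.inr hv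
  · rintro (rfl | hv)
    · exact Or.inl h.legal.1
    · exact Or.inr hv

/-- All neighbors of a forgotten vertex that have not been forgotten before are in the bag. -/
lemma mem_of_adj {w v : V} (h : Good D bag (.forget w :: ms))
    (hv : Alive bag (.forget w :: ms) v) (hadj : D.Adj w v ∨ D.Adj v w) : v ∈ bag := by
  have hw : Alive bag (.forget w :: ms) w := alive_of_mem h.legal.1
  obtain ⟨B, hB, hwB, hvB⟩ : ∃ B ∈ bagsFrom bag (.forget w :: ms), w ∈ B ∧ v ∈ B := by
    rcases hadj with hadj | hadj
    · exact h.cover w v hw hv hadj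
    · obtain ⟨B, hB, h1, h2⟩ := h.cover v w hv hw hadj
      exact ⟨B, hB, h2, h1⟩
  rcases List.mem_cons.mp hB with rfl | hB
  · exact hvB
  · exact absurd ⟨B, hB, hwB⟩ h.not_alive_of_forget

end Good

lemma Drawn.inc_le {s s' : Tops V} {E : V → V → Prop} {J : V → Prop}
    {Φ : List (Finset (Point V))} (h : Drawn s s' E J Φ) (v : V) : s.inc v ≤ s'.inc v := by
  obtain ⟨L, rfl, rfl, -⟩ := h
  exact L.inc_le v

lemma Drawn.out_le {s s' : Tops V} {E : V → V → Prop} {J : V → Prop}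
    {Φ : List (Finset (Point V))} (h : Drawn s s' E J Φ) (v : V) : s.out v ≤ s'.out v := by
  obtain ⟨L, rfl, rfl, -⟩ := h
  exact L.out_le v

lemma drawn_padAll (xs : List V) (s : Tops V) :
    Drawn s (padAll xs s).val.tops (fun _ _ => False) (fun _ => False)
      (padAll xs s).val.facets := by
  induction xs generalizing s with
  | nil => exact .nil s
  | cons x xs ih =>
    exact ((drawn_pad x s).comp (ih _) (fun _ _ => False.elim) (fun _ => False.elim)).congr
      (by simp) (by simp) fun _ => Iff.rfl

lemma pad_tops_of_ne {x v : V} (h : v ≠ x) (s : Tops V) :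
    (pad x s).val.tops.inc v = s.inc v ∧ (pad x s).val.tops.out v = s.out v :=
  ⟨Function.update_of_ne h _ _, Function.update_of_ne h _ _⟩

lemma padAll_tops_of_notMem {xs : List V} {v : V} (h : v ∉ xs) (s : Tops V) :
    (padAll xs s).val.tops.inc v = s.inc v ∧ (padAll xs s).val.tops.out v = s.out v := by
  induction xs generalizing s with
  | nil => exact ⟨rfl, rfl⟩
  | cons x xs ih =>
    rw [List.mem_cons, not_or] at h
    have h1 := ih h.2 (pad x s).val.tops
    have h2 := pad_tops_of_ne h.1 s
    exact ⟨h1.1.trans h2.1, h1.2.trans h2.2⟩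

lemma lt_padAll_tops {xs : List V} {v : V} (h : v ∈ xs) (s : Tops V) :
    s.inc v < (padAll xs s).val.tops.inc v ∧ s.out v < (padAll xs s).val.tops.out v := by
  induction xs generalizing s with
  | nil => simp at h
  | cons x xs ih =>
    change _ < (padAll xs (pad x s).val.tops).val.tops.inc v ∧
      _ < (padAll xs (pad x s).val.tops).val.tops.out v
    have h1 := (drawn_padAll xs (pad x s).val.tops).inc_le v
    have h2 := (drawn_padAll xs (pad x s).val.tops).out_le v
    have h3 := (drawn_pad x s).inc_le v
    have h4 := (drawn_pad x s).out_le v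
    by_cases hv : v = x
    · subst hv
      have e1 : (pad v s).val.tops.inc v = s.inc v + 1 := Function.update_self ..
      have e2 : (pad v s).val.tops.out v = s.out v + 1 := Function.update_self ..
      omega
    · have := ih ((List.mem_cons.mp h).resolve_left hv) (pad x s).val.tops
      omega

lemma drawn_attachIf (b : Bool) (u v : V) (s : Tops V) :
    Drawn s (attachIf b u v s).val.tops (fun x y => b ∧ x = u ∧ y = v) (fun _ => False)
      (attachIf b u v s).val.facets := by
  cases b with
  | false => exact (Drawn.nil s).congr (by simp) (by simp) fun _ => Iff.rfl
  | true => exact (drawn_attach u v s).congr (by simp) (by simp) fun _ => Iff.rfl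

lemma attachIf_tops_of_ne {b : Bool} {u v x : V} (hu : x ≠ u) (hv : x ≠ v) (s : Tops V) :
    (attachIf b u v s).val.tops.inc x = s.inc x ∧
      (attachIf b u v s).val.tops.out x = s.out x := by
  cases b with
  | false => exact ⟨rfl, rfl⟩
  | true => exact ⟨Function.update_of_ne hv _ _, Function.update_of_ne hu _ _⟩

variable (D) [DecidableRel D.Adj]

lemma drawn_attachAll (w : V) {xs : List V} (hxs : xs.Nodup) (s : Tops V) :
    Drawn s (attachAll D w xs s).val.tops
      (fun u v => D.Adj u v ∧ (v = w ∧ u ∈ xs ∨ u = w ∧ v ∈ xs)) (fun _ => False)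
      (attachAll D w xs s).val.facets := by
  induction xs generalizing s with
  | nil => exact (Drawn.nil s).congr (by simp) (by simp) fun _ => Iff.rfl
  | cons x xs ih =>
    rw [List.nodup_cons] at hxs
    have h1 := drawn_attachIf (decide (D.Adj x w)) x w s
    have h2 := drawn_attachIf (decide (D.Adj w x) && !decide (x = w)) w x
      (attachIf (decide (D.Adj x w)) x w s).val.tops
    have h3 := ih hxs.2 (attachIf (decide (D.Adj w x) && !decide (x = w)) w x
      (attachIf (decide (D.Adj x w)) x w s).val.tops).val.tops
    refine (h1.comp (h2.comp h3 ?_ fun _ => False.elim) ?_ fun _ => False.elim).congr ?_ (by simp)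
      fun _ => Iff.rfl
    · grind
    · grind
    · grind

lemma attachAll_tops_of_notMem {w v : V} {xs : List V} (h : v ∉ xs) (hw : v ≠ w) (s : Tops V) :
    (attachAll D w xs s).val.tops.inc v = s.inc v ∧
      (attachAll D w xs s).val.tops.out v = s.out v := by
  induction xs generalizing s with
  | nil => exact ⟨rfl, rfl⟩
  | cons x xs ih =>
    rw [List.mem_cons, not_or] at h
    have h1 := attachIf_tops_of_ne (b := decide (D.Adj x w)) h.1 hw s
    have h2 := attachIf_tops_of_ne (b := decide (D.Adj w x) && !decide (x = w)) hw h.1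
      (attachIf (decide (D.Adj x w)) x w s).val.tops
    have h3 := ih h.2 (attachIf (decide (D.Adj w x) && !decide (x = w)) w x
      (attachIf (decide (D.Adj x w)) x w s).val.tops).val.tops
    exact ⟨h3.1.trans (h2.1.trans h1.1), h3.2.trans (h2.2.trans h1.2)⟩

variable {D}

/-- The edges whose gadgets are attached in a step. -/
def stageEdge (D : Digraph V) (bag : List V) : Move V → V → V → Prop
  | .introduce _, _, _ => False
  | .forget w, u, v => D.Adj u v ∧ (v = w ∧ u ∈ bag ∨ u = w ∧ v ∈ bag)

/-- The vertices whose gadgets are completed in a step. -/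
def stageJoined : Move V → V → Prop
  | .introduce _, _ => False
  | .forget w, v => v = w

/-- The numbers of the last hoops after a step. -/
def stageTops (D : Digraph V) [DecidableRel D.Adj] (bag : List V) (s : Tops V) (m : Move V) :
    Tops V :=
  (stage D bag s m).val.2.tops

/-- The triangles added in a step. -/
def stageFacets (D : Digraph V) [DecidableRel D.Adj] (bag : List V) (s : Tops V) (m : Move V) :
    List (Finset (Point V)) :=
  (stage D bag s m).val.2.facets

lemma stage_bag (bag : List V) (s : Tops V) (m : Move V) :
    (stage D bag s m).val.1 = m.apply bag := by
  cases m <;> rfl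

lemma drawn_stage {bag : List V} (hbag : bag.Nodup) (s : Tops V) (m : Move V) :
    Drawn s (stageTops D bag s m) (stageEdge D bag m) (stageJoined m) (stageFacets D bag s m) := by
  cases m with
  | introduce w => exact drawn_padAll (w :: bag) s
  | forget w =>
    refine ((drawn_attachAll D w hbag s).comp (drawn_join w _) (fun _ _ _ => id)
      fun _ => False.elim).congr (by simp [stageEdge]) (by simp [stageJoined]) fun t => ?_
    change t ∈ _ ↔ t ∈ (join w (attachAll D w bag s).val.tops).val ++
      (attachAll D w bag s).val.facets
    rw [List.mem_append, List.mem_append, or_comm]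

lemma stageTops_of_notMem {bag : List V} {s : Tops V} {m : Move V} {v : V} (h : v ∉ bag)
    (h' : v ∉ m.apply bag) (hJ : ¬ stageJoined m v) :
    (stageTops D bag s m).inc v = s.inc v ∧ (stageTops D bag s m).out v = s.out v := by
  cases m with
  | introduce w => exact padAll_tops_of_notMem h' s
  | forget w => exact attachAll_tops_of_notMem D h hJ s

lemma lt_stageTops {bag : List V} {s : Tops V} {m : Move V} {v : V} (h' : v ∈ m.apply bag) :
    v ∈ bag ∨ s.inc v < (stageTops D bag s m).inc v ∧ s.out v < (stageTops D bag s m).out v := by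
  cases m with
  | introduce w => exact Or.inr (lt_padAll_tops h' s)
  | forget w => exact Or.inl (List.mem_of_mem_erase h')

lemma build_cons_facets (bag : List V) (s : Tops V) (R : List (Finset (Point V))) (m : Move V)
    (ms : List (Move V)) :
    (build D bag s R (m :: ms)).val.facets = stageFacets D bag s m ++
      (build D (m.apply bag) (stageTops D bag s m)
        (collars (stageTops D bag s m) (m.apply bag)).val ms).val.facets := by
  rw [← stage_bag (D := D) bag s m]
  rfl

lemma build_cons_bags (bag : List V) (s : Tops V) (R : List (Finset (Point V))) (m : Move V)
    (ms : List (Move V)) :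
    (build D bag s R (m :: ms)).val.bags = (R ++ stageFacets D bag s m) ::
      (collars (stageTops D bag s m) (m.apply bag)).val ::
      (build D (m.apply bag) (stageTops D bag s m)
        (collars (stageTops D bag s m) (m.apply bag)).val ms).val.bags := by
  rw [← stage_bag (D := D) bag s m]
  rfl

/-- The triangles added from some step on. Each edge is attached when the first of its ends is
forgotten, so that the edges between the vertices that have not been forgotten before remain. -/
lemma Good.exists_drawn {bag : List V} {ms : List (Move V)} (h : Good D bag ms) (s : Tops V)
    (R : List (Finset (Point V))) :
    ∃ s', Drawn s s' (fun u v => D.Adj u v ∧ Alive bag ms u ∧ Alive bag ms v) (Alive bag ms)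
      (build D bag s R ms).val.facets ∧
      ∀ v, ¬ Alive bag ms v → s'.inc v = s.inc v ∧ s'.out v = s.out v := by
  induction ms generalizing bag s R with
  | nil =>
    have hbag : bag = [] := h.legal
    have ha : ∀ v, ¬ Alive bag [] v := by simp [Alive, bagsFrom, hbag]
    exact ⟨s, (Drawn.nil s).congr (by simp [ha]) (by simp [ha]) fun _ => Iff.rfl,
      fun _ _ => ⟨rfl, rfl⟩⟩
  | cons m ms ih =>
    rw [build_cons_facets]
    cases m with
    | introduce w =>
      obtain ⟨s', hs', htop⟩ := ih h.introduce (stageTops D bag s (.introduce w))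
        (collars (stageTops D bag s (.introduce w)) (w :: bag)).val
      refine ⟨s', ((drawn_stage h.nodup s _).comp hs' (fun _ _ => False.elim)
        fun _ => False.elim).congr ?_ ?_ fun _ => Iff.rfl, fun v hv => ?_⟩
      · simp [stageEdge, Good.alive_introduce]
      · simp [stageJoined, Good.alive_introduce]
      · rw [Good.alive_introduce] at hv
        have h1 := htop v hv
        have hv' : v ∉ w :: bag := fun h => hv (alive_of_mem h)
        have h2 := stageTops_of_notMem (D := D) (s := s) (m := .introduce w)
          (fun h => hv' (List.mem_cons_of_mem _ h)) hv' id
        exact ⟨h1.1.trans h2.1, h1.2.trans h2.2⟩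
    | forget w =>
      obtain ⟨s', hs', htop⟩ := ih h.forget (stageTops D bag s (.forget w))
        (collars (stageTops D bag s (.forget w)) (bag.erase w)).val
      have hw := h.not_alive_of_forget
      refine ⟨s', ((drawn_stage h.nodup s _).comp hs' ?_ ?_).congr ?_ ?_ fun _ => Iff.rfl,
        fun v hv => ?_⟩
      · rintro u v ⟨-, ⟨rfl, -⟩ | ⟨rfl, -⟩⟩ ⟨-, h1, h2⟩
        · exact hw h2
        · exact hw h1
      · rintro v rfl
        exact htop _ hw
      · intro u v
        simp only [stageEdge, h.alive_forget]
        constructor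
        · rintro (⟨h1, ⟨rfl, h2⟩ | ⟨rfl, h2⟩⟩ | ⟨h1, h2, h3⟩)
          · exact ⟨h1, h.alive_forget.mp (alive_of_mem h2), Or.inl rfl⟩
          · exact ⟨h1, Or.inl rfl, h.alive_forget.mp (alive_of_mem h2)⟩
          · exact ⟨h1, Or.inr h2, Or.inr h3⟩
        · rintro ⟨h1, h2, h3⟩
          rcases h2 with rfl | h2
          · exact Or.inl ⟨h1, Or.inr ⟨rfl, h.mem_of_adj (h.alive_forget.mpr h3) (Or.inl h1)⟩⟩
          rcases h3 with rfl | h3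
          · exact Or.inl ⟨h1, Or.inl ⟨rfl,
              h.mem_of_adj (h.alive_forget.mpr (Or.inr h2)) (Or.inr h1)⟩⟩
          · exact Or.inr ⟨h1, h2, h3⟩
      · intro v
        rw [h.alive_forget]
        rfl
      · rw [h.alive_forget, not_or] at hv
        have h1 := htop v hv.2
        have hv' : v ∉ bag.erase w := fun h => hv.2 (alive_of_mem h)
        have h2 := stageTops_of_notMem (D := D) (s := s) (m := .forget w)
          (fun h => hv' ((List.mem_erase_of_ne hv.1).mpr h)) hv' hv.1
        exact ⟨h1.1.trans h2.1, h1.2.trans h2.2⟩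

/-- The complex `Y D P` is given by a layout that contains all edges of `D`. -/
lemma exists_layout (P : NicePathDecomposition D) :
    ∃ L : Layout V, L.Edge = D.Adj ∧ (∀ v, L.Joined v) ∧ Y D P = L.hoopSystem.complex := by
  obtain ⟨s', ⟨L, -, -, hE, hJ, hL⟩, -⟩ := P.good.exists_drawn ⟨fun _ => 0, fun _ => 0⟩ []
  refine ⟨L, ?_, fun v => by rw [hJ]; exact P.alive v, hL.generated_eq⟩
  rw [hE]
  ext u v
  exact and_iff_left ⟨P.alive u, P.alive v⟩

end Induction

/-! ### The path decomposition of the Hasse diagram -/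

section HasseDiagram

variable {V : Type}

namespace Layout

variable {L : Layout V}

lemma OnArc.inc {v : V} {k : ℕ} (h : L.OnArc (.inc v k)) :
    L.start.inc v ≤ k ∧ k ≤ L.finish.inc v ∧ (L.start.inc v < L.finish.inc v ∨ L.Joined v) := by
  obtain ⟨d, h | h⟩ := h
  · cases h with
    | inc _ _ h1 h2 => exact ⟨h1, h2.le, Or.inl (h1.trans_lt h2)⟩
    | inc_mid _ h => exact ⟨L.inc_le v, le_rfl, Or.inr h⟩
  · generalize hc : Hoop.inc v k = c at h
    cases h with
    | inc w j h1 h2 =>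
      obtain ⟨rfl, rfl⟩ := Hoop.inc.inj hc
      exact ⟨by omega, h2, Or.inl (h1.trans_lt h2)⟩
    | edge_inc u w h =>
      obtain ⟨rfl, rfl⟩ := Hoop.inc.inj hc
      have := L.le_recv h
      have := L.recv_le h
      exact ⟨by omega, by omega, Or.inl (by omega)⟩
    | _ => cases hc

lemma OnArc.out {v : V} {k : ℕ} (h : L.OnArc (.out v k)) :
    L.start.out v ≤ k ∧ k ≤ L.finish.out v ∧ (L.start.out v < L.finish.out v ∨ L.Joined v) := by
  obtain ⟨d, h | h⟩ := h
  · generalize hc : Hoop.out v k = c at h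
    cases h with
    | out w j h1 h2 =>
      obtain ⟨rfl, rfl⟩ := Hoop.out.inj hc
      exact ⟨by omega, h2, Or.inl (h1.trans_lt h2)⟩
    | out_edge u w h =>
      obtain ⟨rfl, rfl⟩ := Hoop.out.inj hc
      have := L.le_emit h
      have := L.emit_le h
      exact ⟨by omega, by omega, Or.inl (by omega)⟩
    | _ => cases hc
  · cases h with
    | out _ _ h1 h2 => exact ⟨h1, h2.le, Or.inl (h1.trans_lt h2)⟩
    | mid_out _ h => exact ⟨L.out_le v, le_rfl, Or.inr h⟩

lemma OnArc.mid {v : V} (h : L.OnArc (.mid v)) : L.Joined v := by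
  obtain ⟨d, h | h⟩ := h <;> cases h <;> assumption

lemma OnArc.circ {c : Hoop V} (h : L.OnArc c) (i : Fin 3) : L.OnArc (L.circ c i).1 := by
  simp only [Layout.circ]
  split_ifs
  · cases c with
    | edge u v j =>
      have hE := h.edge
      simp only [pin]
      split_ifs
      · exact ⟨_, Or.inr (.out u _ ((L.le_emit hE).trans (Nat.le_succ _)) (by have := L.emit_le hE; omega))⟩
      · exact ⟨_, Or.inr (.inc v _ (L.le_recv hE) (by have := L.recv_le hE; omega))⟩
      · exact h
    | _ => exact h
  · exact h

/-- A boundary hoop at which the construction is continued. -/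
inductive IsBottom (L : Layout V) : Hoop V → Prop
  | inc (v : V) : L.IsBottom (.inc v (L.start.inc v))
  | out (v : V) : L.IsBottom (.out v (L.start.out v))

lemma IsBottom.circ_eq {c : Hoop V} (h : L.IsBottom c) (i : Fin 3) : L.circ c i = (c, i) := by
  cases h
  · rw [circ_inc]; rfl
  · rw [circ_out]; rfl

lemma eq_of_isBottom {c : Hoop V} (hc : L.OnArc c) {i : Fin 3} (h : L.IsBottom (L.circ c i).1) :
    c = (L.circ c i).1 := by
  simp only [circ] at h ⊢
  split_ifs at h ⊢
  · cases c with
    | edge u v j =>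
      have hE := hc.edge
      simp only [pin] at h ⊢
      split_ifs at h ⊢
      · have := L.le_emit hE
        generalize e : Hoop.out u (L.emit u v + 1) = d at h
        cases h with
        | inc => cases e
        | out w =>
          obtain ⟨rfl, e⟩ := Hoop.out.inj e
          omega
      · have := L.le_recv hE
        generalize e : Hoop.inc v (L.recv u v + 1) = d at h
        cases h with
        | out => cases e
        | inc w =>
          obtain ⟨rfl, e⟩ := Hoop.inc.inj e
          omega
      · rfl
    | _ => rfl
  · rfl

lemma not_isBottom_of_arc {c d : Hoop V} (h : L.Arc c d) (hc : L.IsBottom c) (hd : L.IsBottom d) :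
    False := by
  have aux : ∀ {c d c' d' : Hoop V}, L.Arc c d → L.IsBottom c' → L.IsBottom d' → c = c' → d = d' →
      False := by
    intro c d c' d' h hc hd e1 e2
    cases h <;> cases hc <;> simp only [reduceCtorEq, Hoop.inc.injEq, Hoop.out.injEq] at e1 <;>
      cases hd <;> simp only [reduceCtorEq, Hoop.inc.injEq, Hoop.out.injEq] at e2 <;> grind
  exact aux h hc hd rfl rfl

end Layout

variable [DecidableEq V]

lemma mem_closure {P : Type*} [DecidableEq P] {L : List (Finset P)} {a : Finset P} :
    a ∈ closure L ↔ a.Nonempty ∧ ∃ t ∈ L, a ⊆ t := by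
  simp only [closure, Finset.mem_biUnion, List.mem_toFinset, Finset.mem_erase,
    Finset.mem_powerset, Finset.nonempty_iff_ne_empty]
  constructor
  · rintro ⟨t, ht, hne, ha⟩
    exact ⟨hne, t, ht, ha⟩
  · rintro ⟨hne, t, ht, ha⟩
    exact ⟨t, ht, hne, ha⟩

lemma mem_collars {s : Tops V} {bag : List V} {t : Finset (Point V)} :
    t ∈ (collars s bag).val ↔ ∃ x ∈ bag,
      t ∈ tube (ring (.inc x (s.inc x - 1))) (ring (.inc x (s.inc x))) ∨
      t ∈ tube (ring (.out x (s.out x))) (ring (.out x (s.out x - 1))) := by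
  induction bag with
  | nil => exact ⟨fun h => absurd h List.not_mem_nil, by simp⟩
  | cons x xs ih =>
    change t ∈ (tubes _ ++ tubes _) ++ (collars s xs).val ↔ _
    rw [tubes_pair, tubes_pair, List.mem_append, List.mem_append, ih]
    simp [Timed.look]

/-- A common face of a triangle that has been added before and of one that is added later lies in
one of the current last hoops. -/
lemma mem_closure_collars {s₀ s s' : Tops V} {E E' : V → V → Prop} {J J' : V → Prop}
    {Φ Φ' : List (Finset (Point V))} {bag : List V} (h : Drawn s₀ s E J Φ)
    (h' : Drawn s s' E' J' Φ') (hE : ∀ u v, E u v → ¬ E' u v) (hJ : ∀ v, J v → ¬ J' v)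
    (hbag : ∀ v ∉ bag, (s.inc v = s₀.inc v ∧ s.out v = s₀.out v ∧ ¬ J v) ∨
      (s'.inc v = s.inc v ∧ s'.out v = s.out v ∧ ¬ J' v))
    {a : Finset (Point V)} (ha : a ∈ closure Φ) (ha' : a ∈ closure Φ') :
    a ∈ closure (collars s bag).val := by
  obtain ⟨L, rfl, hs, rfl, rfl, hL⟩ := h
  obtain ⟨L', rfl, rfl, rfl, rfl, hL'⟩ := h'
  obtain ⟨hne, t, ht, hat⟩ := mem_closure.mp ha
  obtain ⟨-, t', ht', hat'⟩ := mem_closure.mp ha'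
  obtain ⟨c, d, hcd, ht⟩ := (hL t).mp ht
  obtain ⟨c', d', hcd', ht'⟩ := (hL' t').mp ht'
  have hinc : ∀ v, L'.start.inc v = L.finish.inc v := fun v => by rw [hs]
  have hout : ∀ v, L'.start.out v = L.finish.out v := fun v => by rw [hs]
  obtain ⟨i, hi⟩ := mem_tube.mp ht
  obtain ⟨j, hj⟩ := mem_tube.mp ht'
  have hpt : ∀ p ∈ a, L.OnArc p.1 := by
    intro p hp
    have hc : L.OnArc c := ⟨d, Or.inl hcd⟩
    have hd : L.OnArc d := ⟨c, Or.inr hcd⟩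
    have hp := hat hp
    rcases hi with rfl | rfl <;> simp only [Finset.mem_insert, Finset.mem_singleton] at hp <;>
      rcases hp with rfl | rfl | rfl <;> first | exact hc.circ _ | exact hd.circ _
  have hpt' : ∀ p ∈ a, ∃ e, (e = c' ∨ e = d') ∧ ∃ i, (i = j ∨ i = j + 1) ∧ p = L'.circ e i := by
    intro p hp
    have hp := hat' hp
    rcases hj with rfl | rfl <;> simp only [Finset.mem_insert, Finset.mem_singleton] at hp <;>
      rcases hp with rfl | rfl | rfl <;>
      first
      | exact ⟨c', Or.inl rfl, _, Or.inl rfl, rfl⟩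
      | exact ⟨c', Or.inl rfl, _, Or.inr rfl, rfl⟩
      | exact ⟨d', Or.inr rfl, _, Or.inl rfl, rfl⟩
      | exact ⟨d', Or.inr rfl, _, Or.inr rfl, rfl⟩
  have hon : ∀ e, (e = c' ∨ e = d') → L'.OnArc e := by
    rintro e (rfl | rfl)
    exacts [⟨_, Or.inl hcd'⟩, ⟨_, Or.inr hcd'⟩]
  -- a common vertex lies on a hoop that is the last one before and the first one afterwards
  have htop : ∀ p ∈ a, L'.IsBottom p.1 ∧ ∃ x ∈ bag,
      p.1 = .inc x (L'.start.inc x) ∨ p.1 = .out x (L'.start.out x) := by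
    intro p hp
    have h1 := hpt p hp
    have h2 : L'.OnArc p.1 := by
      obtain ⟨e, he, i, -, rfl⟩ := hpt' p hp
      exact (hon e he).circ i
    obtain ⟨q, i⟩ := p
    cases q with
    | inc v k =>
      have h1 := h1.inc
      have h2 := h2.inc
      have hv := hinc v
      obtain rfl : k = L'.start.inc v := by omega
      refine ⟨.inc v, v, ?_, Or.inl rfl⟩
      by_contra hb
      rcases hbag v hb with ⟨h3, -, h4⟩ | ⟨h3, -, h4⟩
      · rcases h1.2.2 with h5 | h5
        · omega
        · exact h4 h5
      · rcases h2.2.2 with h5 | h5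
        · omega
        · exact h4 h5
    | out v k =>
      have h1 := h1.out
      have h2 := h2.out
      have hv := hout v
      obtain rfl : k = L'.start.out v := by omega
      refine ⟨.out v, v, ?_, Or.inr rfl⟩
      by_contra hb
      rcases hbag v hb with ⟨-, h3, h4⟩ | ⟨-, h3, h4⟩
      · rcases h1.2.2 with h5 | h5
        · omega
        · exact h4 h5
      · rcases h2.2.2 with h5 | h5
        · omega
        · exact h4 h5
    | mid v => exact absurd h2.mid (hJ v h1.mid)
    | edge u v k => exact absurd h2.edge (hE u v h1.edge)
  obtain ⟨p, hp⟩ := hne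
  obtain ⟨hbot, x, hx, hpx⟩ := htop p hp
  -- no cylinder of the later part joins two such hoops, so that the face lies on one of them
  have hsub : a ⊆ {(p.1, j), (p.1, j + 1)} := by
    intro q hq
    obtain ⟨e, he, i, -, rfl⟩ := hpt' p hp
    obtain ⟨e', he', i', hi', rfl⟩ := hpt' q hq
    have hbot' := (htop _ hq).1
    have h1 := Layout.eq_of_isBottom (hon e he) hbot
    have h2 := Layout.eq_of_isBottom (hon e' he') hbot'
    rw [← h1] at hbot ⊢
    rw [← h2] at hbot'
    rw [hbot'.circ_eq]
    have : e = e' := by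
      rcases he with rfl | rfl <;> rcases he' with rfl | rfl
      · rfl
      · exact (Layout.not_isBottom_of_arc hcd' hbot hbot').elim
      · exact (Layout.not_isBottom_of_arc hcd' hbot' hbot).elim
      · rfl
    rcases hi' with rfl | rfl <;> simp [this]
  refine mem_closure.mpr ⟨⟨p, hp⟩, ?_⟩
  rcases hpx with hpx | hpx
  · refine ⟨_, mem_collars.mpr ⟨x, hx, Or.inl (mem_tube.mpr ⟨j, Or.inr rfl⟩)⟩, hsub.trans ?_⟩
    rw [hpx]
    exact Finset.subset_insert _ _
  · refine ⟨_, mem_collars.mpr ⟨x, hx, Or.inr (mem_tube.mpr ⟨j, Or.inl rfl⟩)⟩, hsub.trans ?_⟩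
    rw [hpx]
    simp only [ring]
    grind

/-- The triangles `Φ` have been added before the bag `bag` is reached: each attached edge has an end
that has been forgotten, completed gadgets belong to forgotten vertices, the gadgets of vertices that
will be introduced are empty, and the collars are there. -/
def Past (bag : List V) (ms : List (Move V)) (s : Tops V) (Φ : List (Finset (Point V))) : Prop :=
  ∃ E J, Drawn ⟨fun _ => 0, fun _ => 0⟩ s E J Φ ∧
    (∀ u v, E u v → ¬ (Alive bag ms u ∧ Alive bag ms v)) ∧ (∀ v, J v → ¬ Alive bag ms v) ∧
    (∀ v, Alive bag ms v → v ∉ bag → s.inc v = 0 ∧ s.out v = 0) ∧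
    ∀ t ∈ (collars s bag).val, t ∈ Φ

lemma past_nil {D : Digraph V} (P : NicePathDecomposition D) :
    Past [] P.moves ⟨fun _ => 0, fun _ => 0⟩ [] :=
  ⟨_, _, Drawn.nil _, fun _ _ => False.elim, fun _ => False.elim, fun _ _ _ => ⟨rfl, rfl⟩,
    fun _ h => h⟩

variable {D : Digraph V} [DecidableRel D.Adj]

/-- The new collars are old collars or have been added in the step. -/
lemma collars_stageTops {bag : List V} (hbag : bag.Nodup) {s : Tops V} {m : Move V}
    {t : Finset (Point V)} (ht : t ∈ (collars (stageTops D bag s m) (m.apply bag)).val) :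
    t ∈ (collars s bag).val ++ stageFacets D bag s m := by
  obtain ⟨L, rfl, hs', -, -, hL⟩ := drawn_stage (D := D) hbag s m
  obtain ⟨x, hx, ht⟩ := mem_collars.mp ht
  have hmem := lt_stageTops (D := D) (s := L.start) hx
  have h1 := L.inc_le x
  have h2 := L.out_le x
  rw [List.mem_append, mem_collars]
  rw [← hs'] at ht hmem
  rcases ht with ht | ht
  · rcases h1.eq_or_lt with e | hlt
    · exact Or.inl ⟨x, hmem.resolve_right (by omega), Or.inl (by rwa [e])⟩
    · obtain ⟨k, hk⟩ : ∃ k, L.finish.inc x = k + 1 := ⟨L.finish.inc x - 1, by omega⟩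
      refine Or.inr ((hL t).mpr ⟨_, _, .inc x k (by omega) (by omega), ?_⟩)
      rw [hk] at ht
      rwa [L.circ_inc, L.circ_inc]
  · rcases h2.eq_or_lt with e | hlt
    · exact Or.inl ⟨x, hmem.resolve_right (by omega), Or.inr (by rwa [e])⟩
    · obtain ⟨k, hk⟩ : ∃ k, L.finish.out x = k + 1 := ⟨L.finish.out x - 1, by omega⟩
      refine Or.inr ((hL t).mpr ⟨_, _, .out x k (by omega) (by omega), ?_⟩)
      rw [hk] at ht
      rwa [L.circ_out, L.circ_out]

lemma Past.stage {bag : List V} {m : Move V} {ms : List (Move V)} {s : Tops V}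
    {Φ : List (Finset (Point V))} (hg : Good D bag (m :: ms)) (h : Past bag (m :: ms) s Φ) :
    Past (m.apply bag) ms (stageTops D bag s m) (Φ ++ stageFacets D bag s m) := by
  obtain ⟨E, J, hΦ, hE, hJ, hs, hR⟩ := h
  have hsub : ∀ v, Alive (m.apply bag) ms v → Alive bag (m :: ms) v := fun v hv =>
    alive_cons.mpr (Or.inr hv)
  have hJ1 : ∀ v, stageJoined m v → Alive bag (m :: ms) v ∧ ¬ Alive (m.apply bag) ms v := by
    cases m with
    | introduce w => exact fun _ => False.elim
    | forget w =>
      rintro v rfl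
      exact ⟨alive_of_mem hg.legal.1, hg.not_alive_of_forget⟩
  have hE1 : ∀ u v, stageEdge D bag m u v → (Alive bag (m :: ms) u ∧ Alive bag (m :: ms) v) ∧
      ¬ (Alive (m.apply bag) ms u ∧ Alive (m.apply bag) ms v) := by
    cases m with
    | introduce w => exact fun _ _ => False.elim
    | forget w =>
      have hw : Alive bag (.forget w :: ms) w := alive_of_mem hg.legal.1
      rintro u v ⟨-, ⟨rfl, h⟩ | ⟨rfl, h⟩⟩
      · exact ⟨⟨alive_of_mem h, hw⟩, fun h => hg.not_alive_of_forget h.2⟩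
      · exact ⟨⟨hw, alive_of_mem h⟩, fun h => hg.not_alive_of_forget h.1⟩
  have hbag : ∀ v, v ∈ bag → v ∉ m.apply bag → ¬ Alive (m.apply bag) ms v := fun v hv hv' hva =>
    hv' (hg.convex_tail.2 v hv hva)
  refine ⟨_, _, hΦ.comp (drawn_stage hg.nodup s m) (fun u v h h' => hE u v h (hE1 u v h').1)
    (fun v hv => stageTops_of_notMem (fun h => hJ v hv (alive_of_mem h))
      (fun h => hJ v hv (hsub v (alive_of_mem h))) fun h => hJ v hv (hJ1 v h).1), ?_, ?_, ?_, ?_⟩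
  · rintro u v (h | h) h'
    · exact hE u v h ⟨hsub u h'.1, hsub v h'.2⟩
    · exact (hE1 u v h).2 h'
  · rintro v (h | h) h'
    · exact hJ v h (hsub v h')
    · exact (hJ1 v h).2 h'
  · intro v hv hv'
    have hvb : v ∉ bag := fun h => hbag v h hv' hv
    have h1 := hs v (hsub v hv) hvb
    have h2 := stageTops_of_notMem (D := D) (s := s) hvb hv' fun h => (hJ1 v h).2 hv
    exact ⟨h2.1.trans h1.1, h2.2.trans h1.2⟩
  · intro t ht
    have := collars_stageTops hg.nodup ht
    rw [List.mem_append] at this ⊢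
    exact this.imp_left (hR t)

/-- The collars separate the earlier part of the complex from the later one. -/
lemma Past.mem_closure_collars {bag : List V} {ms : List (Move V)} {s : Tops V}
    {Φ : List (Finset (Point V))} (hg : Good D bag ms) (h : Past bag ms s Φ)
    (R : List (Finset (Point V))) {a : Finset (Point V)} (ha : a ∈ closure Φ)
    (ha' : a ∈ closure (build D bag s R ms).val.facets) : a ∈ closure (collars s bag).val := by
  obtain ⟨E, J, hΦ, hE, hJ, hs, -⟩ := h
  obtain ⟨s', hs', htop⟩ := hg.exists_drawn s R
  refine CyclesToTori.mem_closure_collars hΦ hs' (fun u v h h' => hE u v h h'.2) hJ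
    (fun v hv => ?_) ha ha'
  by_cases hva : Alive bag ms v
  · exact Or.inl ⟨(hs v hva hv).1, (hs v hva hv).2, fun h => hJ v h hva⟩
  · exact Or.inr ⟨(htop v hva).1, (htop v hva).2, hva⟩

/-- The simplices in the remaining bags belong to the current collars or are added later. -/
lemma mem_of_mem_build_bags {bag : List V} {ms : List (Move V)} (hg : Good D bag ms) {s : Tops V}
    {B : List (Finset (Point V))} {t : Finset (Point V)}
    (hB : B ∈ (build D bag s (collars s bag).val ms).val.bags) (ht : t ∈ B) :
    t ∈ (collars s bag).val ++ (build D bag s (collars s bag).val ms).val.facets := by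
  induction ms generalizing bag s with
  | nil => exact absurd hB List.not_mem_nil
  | cons m ms ih =>
    have hg' : Good D (m.apply bag) ms := by
      cases m
      exacts [hg.introduce, hg.forget]
    have hR := fun ht => collars_stageTops (D := D) (s := s) (m := m) (t := t) hg.nodup ht
    rw [build_cons_bags, List.mem_cons, List.mem_cons] at hB
    rw [build_cons_facets, ← List.append_assoc, List.mem_append]
    rcases hB with rfl | rfl | hB
    · exact Or.inl ht
    · exact Or.inl (hR ht)
    · rcases List.mem_append.mp (ih hg' hB) with h | h
      · exact Or.inl (hR h)
      · exact Or.inr h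

lemma exists_build_bag {bag : List V} {ms : List (Move V)} {s : Tops V}
    {R : List (Finset (Point V))} {t : Finset (Point V)}
    (ht : t ∈ (build D bag s R ms).val.facets) :
    ∃ B ∈ (build D bag s R ms).val.bags, t ∈ B := by
  induction ms generalizing bag s R with
  | nil => exact absurd ht List.not_mem_nil
  | cons m ms ih =>
    rw [build_cons_facets, List.mem_append] at ht
    rw [build_cons_bags]
    rcases ht with ht | ht
    · exact ⟨_, List.mem_cons_self, List.mem_append_right _ ht⟩
    · obtain ⟨B, hB, ht⟩ := ih ht
      exact ⟨B, List.mem_cons_of_mem _ (List.mem_cons_of_mem _ hB), ht⟩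

lemma closure_mono {P : Type*} [DecidableEq P] {L M : List (Finset P)} (h : ∀ t ∈ L, t ∈ M)
    {a : Finset P} (ha : a ∈ closure L) : a ∈ closure M := by
  obtain ⟨hne, t, ht, hat⟩ := mem_closure.mp ha
  exact mem_closure.mpr ⟨hne, t, h t ht, hat⟩

lemma isConvex_build {bag : List V} {ms : List (Move V)} (hg : Good D bag ms) {s : Tops V}
    {Φ : List (Finset (Point V))} (h : Past bag ms s Φ) :
    IsConvex (closure (collars s bag).val ::
      (build D bag s (collars s bag).val ms).val.bags.map closure) := by
  induction ms generalizing bag s Φ with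
  | nil => exact isConvex_singleton _
  | cons m ms ih =>
    have hg' : Good D (m.apply bag) ms := by
      cases m
      exacts [hg.introduce, hg.forget]
    have h' := h.stage hg
    obtain ⟨-, -, -, -, -, -, hR⟩ := h
    rw [build_cons_bags, List.map_cons, List.map_cons, isConvex_cons, isConvex_cons]
    refine ⟨⟨ih hg' h', ?_⟩, fun a ha _ => closure_mono (fun t => List.mem_append_left _) ha⟩
    rintro a ha ⟨B, hB, haB⟩
    rcases List.mem_cons.mp hB with rfl | hB
    · exact haB
    obtain ⟨B, hB', rfl⟩ := List.mem_map.mp hB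
    obtain ⟨hne, t, ht, hat⟩ := mem_closure.mp haB
    rcases List.mem_append.mp (mem_of_mem_build_bags hg' hB' ht) with ht | ht
    · exact mem_closure.mpr ⟨hne, t, ht, hat⟩
    · refine h'.mem_closure_collars hg' _ (closure_mono (fun t ht => ?_) ha)
        (mem_closure.mpr ⟨hne, t, ht, hat⟩)
      rw [List.mem_append] at ht ⊢
      exact ht.imp_left (hR t)

lemma isPathDecomposition_hasseBags (P : NicePathDecomposition D) :
    IsPathDecomposition (Y D P).faces (HasseAdj (Y D P)) (hasseBags D P) := by
  have hv : ∀ a, a ∈ (Y D P).faces ↔ ∃ B ∈ hasseBags D P, a ∈ B := by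
    intro a
    change a ∈ closure (build D [] _ [] P.moves).val.facets ↔
      ∃ B ∈ ([] :: (build D [] _ [] P.moves).val.bags).map closure, a ∈ B
    constructor
    · intro ha
      obtain ⟨hne, t, ht, hat⟩ := mem_closure.mp ha
      obtain ⟨B, hB, ht⟩ := exists_build_bag ht
      exact ⟨closure B, List.mem_map_of_mem (List.mem_cons_of_mem _ hB),
        mem_closure.mpr ⟨hne, t, ht, hat⟩⟩
    · rintro ⟨B, hB, haB⟩
      obtain ⟨B, hB', rfl⟩ := List.mem_map.mp hB
      obtain ⟨hne, t, ht, hat⟩ := mem_closure.mp haB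
      rcases List.mem_cons.mp hB' with rfl | hB''
      · exact absurd ht List.not_mem_nil
      · exact mem_closure.mpr ⟨hne, t, mem_of_mem_build_bags P.good hB'' ht, hat⟩
  refine ⟨List.cons_ne_nil _ _, hv, ?_, ?_⟩
  · rintro a b ⟨ha, hb, hab, -⟩
    obtain ⟨B, hB, hbB⟩ := (hv b).mp hb
    refine ⟨B, hB, ?_, hbB⟩
    obtain ⟨B, -, rfl⟩ := List.mem_map.mp hB
    obtain ⟨-, t, ht, hbt⟩ := mem_closure.mp hbB
    exact mem_closure.mpr ⟨face_nonempty ha, t, ht, hab.trans hbt⟩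
  · exact isConvex_build P.good (past_nil P)

end HasseDiagram

/-! ### The width of the path decomposition -/

section Resources

variable {V : Type} [DecidableEq V]

lemma card_le_maxBag {α : Type*} {bags : List (Finset α)} {B : Finset α} (h : B ∈ bags) :
    B.card ≤ maxBag bags := by
  induction bags with
  | nil => exact absurd h List.not_mem_nil
  | cons b bags ih =>
    change _ ≤ max b.card (maxBag bags)
    rcases List.mem_cons.mp h with rfl | h
    · exact le_max_left _ _
    · exact (ih h).trans (le_max_right _ _)

lemma maxBag_le {α : Type*} {bags : List (Finset α)} {n : ℕ} (h : ∀ B ∈ bags, B.card ≤ n) :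
    maxBag bags ≤ n := by
  induction bags with
  | nil => exact Nat.zero_le _
  | cons b bags ih =>
    exact max_le (h b List.mem_cons_self) (ih fun B hB => h B (List.mem_cons_of_mem _ hB))

/-- A triangle has seven faces. -/
lemma card_closure_le {P : Type*} [DecidableEq P] {L : List (Finset P)}
    (h : ∀ t ∈ L, t.card ≤ 3) : (closure L).card ≤ 8 * L.length := by
  refine (Finset.card_biUnion_le_card_mul _ _ 8 fun t ht => ?_).trans ?_
  · refine (Finset.card_le_card (Finset.erase_subset _ _)).trans ?_
    rw [Finset.card_powerset]
    exact Nat.pow_le_pow_right (n := 2) (by norm_num) (h t (List.mem_toFinset.mp ht))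
  · rw [mul_comm]
    exact Nat.mul_le_mul_left 8 (List.toFinset_card_le L)

lemma Drawn.card_le {s s' : Tops V} {E : V → V → Prop} {J : V → Prop}
    {Φ : List (Finset (Point V))} (h : Drawn s s' E J Φ) {t : Finset (Point V)} (ht : t ∈ Φ) :
    t.card ≤ 3 := by
  obtain ⟨L, -, -, -, -, hL⟩ := h
  obtain ⟨c, d, -, h⟩ := (hL t).mp ht
  obtain ⟨i, rfl | rfl⟩ := mem_tube.mp h <;> exact Finset.card_le_three

lemma length_collars (s : Tops V) (bag : List V) :
    (collars s bag).val.length = 12 * bag.length := by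
  induction bag with
  | nil => rfl
  | cons x xs ih =>
    change (_ ++ (collars s xs).val).length = 12 * (xs.length + 1)
    rw [List.length_append, ih]
    change 12 + _ = _
    ring

lemma length_padAll (xs : List V) (s : Tops V) :
    (padAll xs s).val.facets.length = 12 * xs.length := by
  induction xs generalizing s with
  | nil => rfl
  | cons x xs ih =>
    change (_ ++ (padAll xs (pad x s).val.tops).val.facets).length = 12 * (xs.length + 1)
    rw [List.length_append, ih]
    change 12 + _ = _
    ring

lemma length_attachIf_le (b : Bool) (u v : V) (s : Tops V) :
    (attachIf b u v s).val.facets.length ≤ 90 := by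
  cases b
  · exact Nat.zero_le _
  · exact le_rfl

variable {D : Digraph V} [DecidableRel D.Adj]

lemma length_attachAll_le (w : V) (xs : List V) (s : Tops V) :
    (attachAll D w xs s).val.facets.length ≤ 180 * xs.length := by
  induction xs generalizing s with
  | nil => exact le_rfl
  | cons x xs ih =>
    have h1 := length_attachIf_le (decide (D.Adj x w)) x w s
    have h2 := length_attachIf_le (decide (D.Adj w x) && !decide (x = w)) w x
      (attachIf (decide (D.Adj x w)) x w s).val.tops
    have h3 := ih (attachIf (decide (D.Adj w x) && !decide (x = w)) w x
      (attachIf (decide (D.Adj x w)) x w s).val.tops).val.tops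
    change ((attachIf (decide (D.Adj x w)) x w s).val.facets ++
      ((attachIf (decide (D.Adj w x) && !decide (x = w)) w x
        (attachIf (decide (D.Adj x w)) x w s).val.tops).val.facets ++
      (attachAll D w xs (attachIf (decide (D.Adj w x) && !decide (x = w)) w x
        (attachIf (decide (D.Adj x w)) x w s).val.tops).val.tops).val.facets)).length ≤
      180 * (xs.length + 1)
    rw [List.length_append, List.length_append]
    omega

/-- Introducing a vertex adds 12 triangles for each vertex of the new bag. Forgetting a vertex attaches
at most two edge gadgets with 90 triangles for each vertex of the old bag and adds 12 triangles. -/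
lemma length_stageFacets_le {bag : List V} (s : Tops V) {m : Move V} {ms : List (Move V)}
    (h : Legal bag (m :: ms)) :
    (stageFacets D bag s m).length ≤ 192 * max bag.length (m.apply bag).length := by
  cases m with
  | introduce w =>
    have : (stageFacets D bag s (.introduce w)).length = 12 * (bag.length + 1) :=
      length_padAll (w :: bag) s
    rw [this]
    have : bag.length + 1 ≤ max bag.length ((Move.introduce w).apply bag).length :=
      le_max_right _ _
    omega
  | forget w =>
    have : (stageFacets D bag s (.forget w)).length =
        12 + (attachAll D w bag s).val.facets.length := List.length_append
    have h1 := length_attachAll_le (D := D) w bag s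
    have h2 : 0 < bag.length := List.length_pos_of_mem h.1
    have h3 : bag.length ≤ max bag.length ((Move.forget w).apply bag).length := le_max_left _ _
    omega

lemma Good.tail {bag : List V} {m : Move V} {ms : List (Move V)} {D : Digraph V}
    (h : Good D bag (m :: ms)) : Good D (m.apply bag) ms := by
  cases m
  exacts [h.introduce, h.forget]

/-- Up to `12 n` triangles of collars and `192 n` new triangles are in a bag, if all bags of the path
decomposition of the graph have at most `n` vertices. -/
lemma length_bag_le {bag : List V} {ms : List (Move V)} {s : Tops V}
    {n : ℕ} (hg : Good D bag ms) (hn : ∀ b ∈ bagsFrom bag ms, b.Nodup → b.length ≤ n)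
    {B : List (Finset (Point V))}
    (hB : B ∈ (build D bag s (collars s bag).val ms).val.bags) : B.length ≤ 204 * n := by
  induction ms generalizing bag s with
  | nil => exact absurd hB List.not_mem_nil
  | cons m ms ih =>
    have hn' : ∀ b ∈ bagsFrom (m.apply bag) ms, b.Nodup → b.length ≤ n := fun b hb =>
      hn b (List.mem_cons_of_mem _ hb)
    have h1 : bag.length ≤ n := hn _ List.mem_cons_self hg.nodup
    have h2 : (m.apply bag).length ≤ n := by
      refine hn' _ ?_ hg.tail.nodup
      cases ms <;> exact List.mem_cons_self
    rw [build_cons_bags, List.mem_cons, List.mem_cons] at hB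
    rcases hB with rfl | rfl | hB
    · rw [List.length_append, length_collars]
      have h3 := length_stageFacets_le (D := D) s hg.legal
      have h4 : max bag.length (m.apply bag).length ≤ n := max_le h1 h2
      omega
    · rw [length_collars]
      omega
    · exact ih hg.tail hn' hB

lemma maxBag_hasseBags_le (P : NicePathDecomposition D) :
    maxBag (hasseBags D P) ≤ 1632 * maxBag P.bags := by
  refine maxBag_le fun B hB => ?_
  obtain ⟨B, hB', rfl⟩ := List.mem_map.mp hB
  rcases List.mem_cons.mp hB' with rfl | hB''
  · exact Nat.zero_le _
  obtain ⟨s', hs', -⟩ := P.good.exists_drawn ⟨fun _ => 0, fun _ => 0⟩ []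
  have h1 := card_closure_le (L := B) fun t ht =>
    hs'.card_le (mem_of_mem_build_bags P.good hB'' ht)
  have h2 := length_bag_le (n := maxBag P.bags) P.good (fun b hb hnd => by
    rw [← List.toFinset_card_of_nodup hnd]
    exact card_le_maxBag (List.mem_map_of_mem hb)) hB''
  omega

/-! ### The running time -/

/-- For each vertex, 18 steps are spent on the cylinders, 13 on copying them, and one on the result. -/
lemma steps_padAll (xs : List V) (s : Tops V) : (padAll xs s).steps = 32 * xs.length + 1 := by
  induction xs generalizing s with
  | nil => rfl
  | cons x xs ih =>
    change 18 + ((padAll xs (pad x s).val.tops).steps + (13 + 1)) = 32 * (xs.length + 1) + 1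
    rw [ih]
    ring

lemma steps_attachIf_le (b : Bool) (u v : V) (s : Tops V) : (attachIf b u v s).steps ≤ 96 := by
  cases b
  · exact Nat.le_add_left 1 95
  · exact le_rfl

/-- For each vertex, at most 96 steps are spent on each of the two edge gadgets, 91 on copying each of
them, and four on tests and on the result. -/
lemma steps_attachAll_le (w : V) (xs : List V) (s : Tops V) :
    (attachAll D w xs s).steps ≤ 378 * xs.length + 1 := by
  induction xs generalizing s with
  | nil => exact le_rfl
  | cons x xs ih =>
    have h1 := steps_attachIf_le (decide (D.Adj x w)) x w s
    have h1' := length_attachIf_le (decide (D.Adj x w)) x w s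
    set p := attachIf (decide (D.Adj x w)) x w s with hp
    have h2 := steps_attachIf_le (decide (D.Adj w x) && !decide (x = w)) w x p.val.tops
    have h2' := length_attachIf_le (decide (D.Adj w x) && !decide (x = w)) w x p.val.tops
    set q := attachIf (decide (D.Adj w x) && !decide (x = w)) w x p.val.tops with hq
    have h3 := ih q.val.tops
    change 1 + (p.steps + (1 + (1 + (q.steps + ((attachAll D w xs q.val.tops).steps +
      ((q.val.facets.length + 1) + ((p.val.facets.length + 1) + 1))))))) ≤
      378 * (xs.length + 1) + 1
    omega

lemma steps_collars (s : Tops V) (bag : List V) : (collars s bag).steps = 28 * bag.length + 1 := by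
  induction bag with
  | nil => rfl
  | cons x xs ih =>
    change 1 + (1 + (13 + ((collars s xs).steps + 13))) = 28 * (xs.length + 1) + 1
    rw [ih]
    ring

lemma steps_stage_le (bag : List V) (s : Tops V) (m : Move V) :
    (stage D bag s m).steps ≤ 379 * bag.length + 34 := by
  cases m with
  | introduce w =>
    change (padAll (w :: bag) s).steps + 1 ≤ _
    rw [steps_padAll, List.length_cons]
    omega
  | forget w =>
    change (attachAll D w bag s).steps + (15 + (13 + ((bag.length + 1) + 1))) ≤ _
    have := steps_attachAll_le (D := D) w bag s
    omega

/-- A step of the path decomposition takes linear time in the size of the bags. -/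
lemma steps_build_le {bag : List V} {ms : List (Move V)} {s : Tops V} {n : ℕ}
    (hg : Good D bag ms) (hn : ∀ b : List V, b.Nodup → b.length ≤ n) :
    (build D bag s (collars s bag).val ms).steps ≤ 700 * (n + 1) * ms.length + 1 := by
  induction ms generalizing bag s with
  | nil => exact Nat.le_add_left _ _
  | cons m ms ih =>
    have h1 := hn _ hg.nodup
    have h2 := hn _ hg.tail.nodup
    have h3 := steps_stage_le (D := D) bag s m
    have h4 := length_stageFacets_le (D := D) s hg.legal
    have h5 := steps_collars (stageTops D bag s m) (m.apply bag)
    have h6 := ih (s := stageTops D bag s m) hg.tail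
    have h7 := length_collars s bag
    have h8 : max bag.length (m.apply bag).length ≤ n := max_le h1 h2
    have e : (build D bag s (collars s bag).val (m :: ms)).steps =
        (stage D bag s m).steps + ((collars (stageTops D bag s m) (m.apply bag)).steps +
        (((collars s bag).val.length + 1) +
        ((build D (m.apply bag) (stageTops D bag s m)
          (collars (stageTops D bag s m) (m.apply bag)).val ms).steps +
        (((stageFacets D bag s m).length + 1) + 1)))) := by
      rw [← stage_bag (D := D) bag s m]
      rfl
    rw [e, List.length_cons, mul_add]
    omega

/-- Each vertex that has not been forgotten is introduced at most once and forgotten once. -/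
lemma Good.length_add_length_le {D : Digraph V} [Fintype V] {bag : List V} {ms : List (Move V)}
    (hg : Good D bag ms) : ms.length + bag.length ≤ 2 * {v | Alive bag ms v}.ncard := by
  induction ms generalizing bag with
  | nil =>
    have : bag = [] := hg.legal
    simp [this]
  | cons m ms ih =>
    cases m with
    | introduce w =>
      have := ih hg.introduce
      simp only [Good.alive_introduce, List.length_cons] at this ⊢
      omega
    | forget w =>
      have h1 := ih hg.forget
      have h2 : {v | Alive bag (.forget w :: ms) v} = insert w {v | Alive (bag.erase w) ms v} := by
        ext v
        exact hg.alive_forget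
      have hw : w ∉ {v | Alive (bag.erase w) ms v} := hg.not_alive_of_forget
      rw [h2, Set.ncard_insert_of_notMem hw]
      have h3 := List.length_erase_add_one hg.legal.1
      rw [List.length_cons]
      omega

lemma steps_construction_le [Fintype V] (P : NicePathDecomposition D) :
    (construction D P).steps ≤ 1402 * (Fintype.card V + 1) ^ 2 := by
  set n := Fintype.card V with hn
  have h1 : P.moves.length ≤ 2 * n := by
    have h2 := P.good.length_add_length_le
    have h3 : {v | Alive [] P.moves v}.ncard ≤ n := by
      rw [hn, ← Nat.card_eq_fintype_card]
      exact Set.ncard_le_card _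
    omega
  have h4 := steps_build_le (s := ⟨fun _ => 0, fun _ => 0⟩) (n := n) P.good
    fun b hb => hb.length_le_card
  change (build D [] _ [] P.moves).steps + 1 ≤ _
  have h5 : 700 * (n + 1) * P.moves.length ≤ 700 * (n + 1) * (2 * n) := Nat.mul_le_mul_left _ h1
  calc _ ≤ 700 * (n + 1) * (2 * n) + 1 + 1 := by
        exact Nat.add_le_add_right (h4.trans (Nat.add_le_add_right h5 1)) 1
    _ ≤ _ := by nlinarith

end Resources

/-! ### Surfaces in the complex -/

section Reduction

variable {V : Type} [DecidableEq V] {D : Digraph V} [DecidableRel D.Adj]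
  {P : NicePathDecomposition D}

lemma exists_eq_gridComplex_of_le {S : PreAbstractSimplicialComplex (Point V)} (hle : S ≤ Y D P)
    (hS : IsClosedSurface S) (hconn : IsConnected S) :
    ∃ (m : ℕ) (F : Grid m → Point V), Function.Injective F ∧ S = gridComplex F := by
  obtain ⟨L, -, -, hY⟩ := exists_layout P
  exact L.exists_eq_gridComplex hS.isSurface hS.boundary_eq (hle.trans_eq hY) hconn

lemma exists_component_eq_gridComplex {S : PreAbstractSimplicialComplex (Point V)}
    (hle : S ≤ Y D P) (hS : IsSurface S) (hb : boundary S = ⊥)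
    (c : (skeleton S).ConnectedComponent) :
    ∃ (m : ℕ) (F : Grid m → Point V), Function.Injective F ∧ component S c = gridComplex F :=
  exists_eq_gridComplex_of_le ((component_le c).trans hle) (isClosedSurface_component hS hb c)
    (isConnected_component c)

/-- The tori along vertex-disjoint directed cycles are disjoint. -/
lemma exists_disjoint_grids {l : ℕ} (h : HasDisjointCycles D l) :
    HasDisjointSubcomplexes (Y D P) l
      (fun S => ∃ (m : ℕ) (F : Grid m → Point V), Function.Injective F ∧ S = gridComplex F) := by
  obtain ⟨C, hC⟩ := h
  obtain ⟨L, hE, hJ, hY⟩ := exists_layout P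
  choose m F hF hle howner using fun i => L.exists_gridComplex_le hE hJ (C i)
  refine ⟨fun i => gridComplex (F i), fun i => ⟨(hle i).trans_eq hY.symm, _, _, hF i, rfl⟩,
    fun i j hij => Set.disjoint_left.mpr fun s hs hs' => ?_⟩
  obtain ⟨p, hp⟩ := face_nonempty (K := gridComplex (F i)) hs
  obtain ⟨x, rfl⟩ := exists_of_mem_face hs hp
  obtain ⟨y, hy⟩ := exists_of_mem_face hs' hp
  refine Set.disjoint_left.mp (hC hij) (howner i x) ?_
  rw [hy]
  exact howner j y

lemma hasDisjointCycles_of_subcomplexes [Finite V] {l : ℕ}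
    (h : HasDisjointSubcomplexes (Y D P) l IsClosedSurface) : HasDisjointCycles D l := by
  obtain ⟨T, hT, hdisj⟩ := h
  obtain ⟨L, hE, -, hY⟩ := exists_layout P
  choose C hC using fun i => L.exists_directedCycle (hT i).2.isSurface (hT i).2.boundary_eq
    ((hT i).1.trans_eq hY) hE (hT i).2.ne_bot
  exact ⟨C, fun i j hij => Set.disjoint_left.mpr fun v hv hv' =>
    Set.disjoint_left.mp (hdisj hij) (hC i v hv) (hC j v hv')⟩

lemma subsurfacePacking_of_grids {l : ℕ}
    (h : HasDisjointSubcomplexes (Y D P) l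
      (fun S => ∃ (m : ℕ) (F : Grid m → Point V), Function.Injective F ∧ S = gridComplex F)) :
    SubsurfacePacking (Y D P) ⊥ l := by
  obtain ⟨T, hT, hdisj⟩ := h
  have hclosed : ∀ i, IsClosedSurface (T i) ∧ IsConnected (T i) := by
    intro i
    obtain ⟨-, m, F, hF, e⟩ := hT i
    rw [e]
    exact ⟨isClosedSurface_grid hF, isConnected_grid hF⟩
  obtain ⟨h1, h2⟩ := isSurface_iSup hdisj fun i => (hclosed i).1
  refine ⟨⨆ i, T i, iSup_le fun i => (hT i).1, h1, h2, ?_⟩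
  rw [numComponents_iSup hdisj fun i => (hclosed i).2, Nat.card_fin]

lemma hasDisjointSubcomplexes_of_packing {l : ℕ} (h : SubsurfacePacking (Y D P) ⊥ l) :
    HasDisjointSubcomplexes (Y D P) l IsClosedSurface := by
  obtain ⟨S, hle, hS, hb, rfl⟩ := h
  have := finite_components hS.finite
  let e : (skeleton S).ConnectedComponent ≃ Fin (numComponents S) := Finite.equivFin _
  refine ⟨fun i => component S (e.symm i), fun i => ⟨(component_le _).trans hle,
    isClosedSurface_component hS hb _⟩, fun i j hij => Set.disjoint_left.mpr fun s hs hs' => ?_⟩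
  obtain ⟨p, hp⟩ := face_nonempty (K := component S (e.symm i)) hs
  exact hij (e.symm.injective (component_unique hs hs' hp hp))

/-- A closed surface in the complex is the disjoint union of its components, which are tori. Hence its
number of components determines its total genus and its homeomorphism type. -/
lemma tfae_packing [Finite V] (P : NicePathDecomposition D) (l : ℕ) :
    List.TFAE
      [HasDisjointCycles D l,
        HasDisjointSubcomplexes (Y D P) l IsClosedSurface,
        HasDisjointSubcomplexes (Y D P) l (fun S => IsClosedSurface S ∧ IsTorus S),
        SubsurfacePacking (Y D P) ⊥ l,
        SumOfGenusRecognition (Y D P) ⊥ l l,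
        SubsurfaceRecognition (Y D P) ⊥ (Fin l × Torus)] := by
  have htorus : ∀ S ≤ Y D P, IsSurface S → boundary S = ⊥ →
      Nonempty (realization S ≃ₜ Fin (numComponents S) × Torus) := by
    intro S hle hS hb
    refine realization_homeomorph hS.finite fun c => ?_
    obtain ⟨m, F, hF, e⟩ := exists_component_eq_gridComplex hle hS hb c
    rw [e]
    exact isTorus_grid hF
  tfae_have 1 → 3 := fun h => by
    obtain ⟨T, hT, hdisj⟩ := exists_disjoint_grids (P := P) h
    refine ⟨T, fun i => ⟨(hT i).1, ?_⟩, hdisj⟩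
    obtain ⟨-, m, F, hF, e⟩ := hT i
    rw [e]
    exact ⟨isClosedSurface_grid hF, isTorus_grid hF⟩
  tfae_have 3 → 2 := fun ⟨T, hT, hdisj⟩ => ⟨T, fun i => ⟨(hT i).1, (hT i).2.1⟩, hdisj⟩
  tfae_have 2 → 1 := hasDisjointCycles_of_subcomplexes
  tfae_have 1 → 4 := fun h => subsurfacePacking_of_grids (exists_disjoint_grids h)
  tfae_have 4 → 2 := hasDisjointSubcomplexes_of_packing
  tfae_have 4 → 5 := by
    rintro ⟨S, hle, hS, hb, rfl⟩
    refine ⟨S, hle, hS, hb, totalGenus_eq hS.finite (fun c => ?_) (fun c => ?_), rfl⟩ <;>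
      obtain ⟨m, F, hF, e⟩ := exists_component_eq_gridComplex hle hS hb c <;> rw [e]
    exacts [orientable_grid hF, genus_grid hF]
  tfae_have 5 → 4 := fun ⟨S, hle, hS, hb, _, hc⟩ => ⟨S, hle, hS, hb, hc⟩
  tfae_have 4 → 6 := by
    rintro ⟨S, hle, hS, hb, rfl⟩
    exact ⟨S, hle, hS, hb, htorus S hle hS hb⟩
  tfae_have 6 → 4 := by
    rintro ⟨S, hle, hS, hb, ⟨f⟩⟩
    obtain ⟨g⟩ := htorus S hle hS hb
    exact ⟨S, hle, hS, hb, le_antisymm (card_le_of_homeomorph (g.symm.trans f))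
      (card_le_of_homeomorph (f.symm.trans g))⟩
  tfae_finish

end Reduction

end CyclesToTori

theorem mainTheorem6 :
    ∃ c C d : ℕ, ∀ (V : Type) [Fintype V] [DecidableEq V] (D : Digraph V) [DecidableRel D.Adj]
      (P : CyclesToTori.NicePathDecomposition D),
      (∀ l : ℕ, List.TFAE
        [CyclesToTori.HasDisjointCycles D l,
          CyclesToTori.HasDisjointSubcomplexes (CyclesToTori.Y D P) l
            CyclesToTori.IsClosedSurface,
          CyclesToTori.HasDisjointSubcomplexes (CyclesToTori.Y D P) l
            (fun S => CyclesToTori.IsClosedSurface S ∧ CyclesToTori.IsTorus S),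
          CyclesToTori.SubsurfacePacking (CyclesToTori.Y D P) ⊥ l,
          CyclesToTori.SumOfGenusRecognition (CyclesToTori.Y D P) ⊥ l l,
          CyclesToTori.SubsurfaceRecognition (CyclesToTori.Y D P) ⊥
            (Fin l × CyclesToTori.Torus)]) ∧
      (∀ S ≤ CyclesToTori.Y D P, CyclesToTori.IsClosedSurface S → CyclesToTori.IsConnected S →
        CyclesToTori.IsTorus S) ∧
      CyclesToTori.IsPathDecomposition (CyclesToTori.Y D P).faces
        (CyclesToTori.HasseAdj (CyclesToTori.Y D P)) (CyclesToTori.hasseBags D P) ∧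
      CyclesToTori.maxBag (CyclesToTori.hasseBags D P) ≤ c * CyclesToTori.maxBag P.bags ∧
      (CyclesToTori.construction D P).steps ≤ C * (Fintype.card V + 1) ^ d := by
  refine ⟨1632, 1402, 2, fun V _ _ D _ P => ⟨CyclesToTori.tfae_packing P, fun S hle hS hconn => ?_,
    CyclesToTori.isPathDecomposition_hasseBags P, CyclesToTori.maxBag_hasseBags_le P,
    CyclesToTori.steps_construction_le P⟩⟩
  obtain ⟨m, F, hF, rfl⟩ := CyclesToTori.exists_eq_gridComplex_of_le hle hS hconn
  exact CyclesToTori.isTorus_grid hF
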